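/- Let $N\ge 3$ be odd, $k'\in\{1,\dots,N-1\}$ prime to $N$, $A=e^{2i\pi k'/N}$, $k=2k'$, $q=A^2$, $q^z=e^{2i\pi kz/N}$, $\{z\}=q^z-q^{-z}$, $[z]=\{z\}/(q-q^{-1})$, $\{d\}!=\{1\}\cdots\{d\}$, and for $d\in\mathbb N$ let $\binom{x}{x-d}_q=\{x\}\{x-1\}\cdots\{x-d+1\}/\{d\}!$ (for integers $M\geq 0$ and $y\notin[0,M]$, $\binom{M}{y}_q=0$). Let $H_N=\{k(N-1-2t):0\le t\le N-1\}$ and $\ddot{\mathbb C}=(\mathbb C\setminus\frac12\mathbb Z)\cup\frac N2\mathbb Z$. Let $U=U_q^H\mathfrak{sl}_2$ be the algebra generated by $E,F,K^{\pm1},H$ with $KE=q^2EK$, $KF=q^{-2}FK$, $[E,F]=\frac{K-K^{-1}}{q-q^{-1}}$, $[H,E]=2E$, $[H,F]=-2F$, $[H,K]=0$ and coproduct $\Delta E=1\otimes E+E\otimes K$, $\Delta F=K^{-1}\otimes F+F\otimes1$, $\Delta K=K\otimes K$, $\Delta H=H\otimes1+1\otimes H$. The module $V_\alpha$ $(\alpha\in\mathbb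 C)$ has basis $v_0,\dots,v_{N-1}$ with $Hv_n=(\frac\alpha k+N-1-2n)v_n$, $K=q^H$, $Fv_n=v_{n+1}$ $(v_N=0)$, $Ev_n=[n][\frac\alpha k-n]v_{n-1}$; $S_1$ has basis $e_0,e_1$ with $He_i=(1-2i)e_i$, $K=q^H$, $Fe_0=e_1$, $Fe_1=0$, $Ee_0=0$, $Ee_1=e_0$. Set $\kappa_n^\alpha=q^{-\frac n2(\frac\alpha k+N-1)+\frac{n(n-1)}2}\prod_{t=0}^{n-1}[\frac\alpha k+N-1-t]$. For $\alpha+\beta-\gamma\in H_N$ put $C_{i,j,n}^{\alpha,\beta,\gamma}=0$ unless $i+j-n=\frac{\alpha+\beta-\gamma}{2k}+\frac{N-1}2$, and in that case $$C_{i,j,n}^{\alpha,\beta,\gamma}=(-1)^{j-n}q^{\frac12[j(\frac\beta k-j)-i(\frac\alpha k-i)]}\binom{\frac\gamma k+N-1}{\frac\gamma k+N-1-n}_q^{-1}\binom{\frac\gamma k+N-1}{\frac{\alpha+\beta+\gamma}{2k}+\frac{N-1}2}_q\sum_{z+w=n}(-1)^zq^{\frac12(2z-n)(\frac\gamma k-n)}\binom{i+j-n}{i-z}_q\binom{\frac\alpha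 k-i+z+N-1}{\frac\alpha k-i+N-1}_q\binom{\frac\beta k-j+w+N-1}{\frac\beta k-j+N-1}_q .$$ Put $D_{i,j,n}^{\alpha,\beta,\gamma}=\frac{\kappa_n^\gamma}{\kappa_i^\alpha\kappa_j^\beta}C_{i,j,n}^{\alpha,\beta,\gamma}$ and $E_{i,j,n}^{\alpha,\beta,\gamma}=\frac{\kappa_i^\alpha\kappa_j^\beta}{\kappa_n^\gamma}C_{N-1-j,N-1-i,N-1-n}^{-\beta,-\alpha,-\gamma}$. If $\alpha+\beta-\gamma\in\frac k2\mathbb Z$, let $n$ be the unique integer with $\alpha+\beta-\gamma\in\frac N2kn+H_N$, put $\gamma'=\gamma+\frac N2kn$, and let $Y_\gamma^{\alpha,\beta}:V_{\gamma'}\to V_\alpha\otimes V_\beta$ be $v_l\mapsto\sum_{i,j}D_{i,j,l}^{\alpha,\beta,\gamma'}v_i\otimes v_j$. (Here $V_{\gamma'}$ is $V_\gamma$ tensored with a one-dimensional module; both are identified with $\mathbb C^N$.) For $\varepsilon=\pm1$ let $$I^\alpha_\varepsilon:V_{\alpha+\varepsilon k}\to V_\alpha\otimes S_1,\quad v_l\mapsto\sum_{i}\sum_{\nu=0,1}D_{i,N-2+\nu,l}^{\alpha,k(N-2),\alpha+\varepsilon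 k}\,v_i\otimes e_\nu,$$ $$J^\beta_\varepsilon:S_1\otimes V_{\beta+\varepsilon k}\to V_\beta,\quad e_\nu\otimes v_j\mapsto\sum_lE_{N-2+\nu,j,l}^{k(N-2),\beta+\varepsilon k,\beta}\,v_l,$$ where in $\kappa_{N-2+\nu}^{k(N-2)}$ the factor $[N]=0$ is omitted. Let $\varepsilon_1,\varepsilon_2\in\{-1,+1\}$. Call $(\alpha,\beta,\gamma)\in\mathbb C^3$ admissible if $\alpha+\beta-\gamma\in\frac k2\mathbb Z$ and $\alpha,\beta,\gamma,\alpha+\varepsilon_1k,\beta+\varepsilon_2k\in\ddot{\mathbb C}$. For admissible $(\alpha,\beta,\gamma)$ the $6j$-symbol $6S(\alpha,\beta,\gamma;\varepsilon_1,\varepsilon_2)$ is the scalar $s$ defined by the following identity of linear maps $\mathbb C^N\to V_\alpha\otimes V_\beta$: $$(\mathrm{id}_{V_\alpha}\otimes J^\beta_{\varepsilon_2})\circ(I^\alpha_{\varepsilon_1}\otimes\mathrm{id}_{V_{\beta+\varepsilon_2k}})\circ Y_\gamma^{\alpha+\varepsilon_1k,\beta+\varepsilon_2k}=s\,Y_\gamma^{\alpha,\beta}.$$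 Proposition. There is a non-zero rational fraction $R\in\mathbb Q(A)(X_1,X_2,X_3)$, depending only on $A$, $\varepsilon_1$ and $\varepsilon_2$, such that: 1. for every admissible $(\alpha,\beta,\gamma)$, the maps $Y_\gamma^{\alpha,\beta}$, $I^\alpha_{\varepsilon_1}$, $J^\beta_{\varepsilon_2}$ are $U$-linear, exactly one scalar $s$ satisfies the identity above, $R$ is regular at the point $(e^{i\pi\alpha/N},e^{i\pi\beta/N},e^{i\pi\gamma/N})$, and $$6S(\alpha,\beta,\gamma;\varepsilon_1,\varepsilon_2)=R(e^{i\pi\alpha/N},e^{i\pi\beta/N},e^{i\pi\gamma/N});$$ 2. for all integers $0\le m\le N-1$ and $n$, there is an admissible $(\alpha,\beta,\gamma)$ with $\alpha+\beta-\gamma=\frac N2kn+k(2m-(N-1))$ and $6S(\alpha,\beta,\gamma;\varepsilon_1,\varepsilon_2)\ne0$ if and only if $0\le m+\frac{\varepsilon_1+\varepsilon_2}2\le N-1$. -/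

import Mathlib

open scoped TensorProduct

noncomputable section

namespace UnrolledSl2

/-- A root of unity `A = exp (2 i π k' / N)` of odd order `N ≥ 3`, with `1 ≤ k' ≤ N - 1` prime
to `N`. -/
structure RootData where
  N : ℕ
  k' : ℕ
  odd : Odd N
  three_le : 3 ≤ N
  pos : 1 ≤ k'
  lt : k' < N
  coprime : Nat.Coprime k' N

/-! ### The unrolled quantum group -/

/-- Generators of the unrolled quantum group. -/
inductive Gen
  | E | F | K | Kinv | H

/-- Defining relations of the unrolled quantum group of `sl₂` at the parameter `q`. -/
inductive Rel (q : ℂ) : FreeAlgebra ℂ Gen → FreeAlgebra ℂ Gen → Prop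
  | K_Kinv : Rel q (FreeAlgebra.ι ℂ Gen.K * FreeAlgebra.ι ℂ Gen.Kinv) 1
  | Kinv_K : Rel q (FreeAlgebra.ι ℂ Gen.Kinv * FreeAlgebra.ι ℂ Gen.K) 1
  | K_E : Rel q (FreeAlgebra.ι ℂ Gen.K * FreeAlgebra.ι ℂ Gen.E)
      (q ^ 2 • (FreeAlgebra.ι ℂ Gen.E * FreeAlgebra.ι ℂ Gen.K))
  | K_F : Rel q (FreeAlgebra.ι ℂ Gen.K * FreeAlgebra.ι ℂ Gen.F)
      ((q ^ 2)⁻¹ • (FreeAlgebra.ι ℂ Gen.F * FreeAlgebra.ι ℂ Gen.K))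
  | E_F : Rel q
      (FreeAlgebra.ι ℂ Gen.E * FreeAlgebra.ι ℂ Gen.F
        - FreeAlgebra.ι ℂ Gen.F * FreeAlgebra.ι ℂ Gen.E)
      ((q - q⁻¹)⁻¹ • (FreeAlgebra.ι ℂ Gen.K - FreeAlgebra.ι ℂ Gen.Kinv))
  | H_E : Rel q
      (FreeAlgebra.ι ℂ Gen.H * FreeAlgebra.ι ℂ Gen.E
        - FreeAlgebra.ι ℂ Gen.E * FreeAlgebra.ι ℂ Gen.H)
      ((2 : ℂ) • FreeAlgebra.ι ℂ Gen.E)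
  | H_F : Rel q
      (FreeAlgebra.ι ℂ Gen.H * FreeAlgebra.ι ℂ Gen.F
        - FreeAlgebra.ι ℂ Gen.F * FreeAlgebra.ι ℂ Gen.H)
      (-((2 : ℂ) • FreeAlgebra.ι ℂ Gen.F))
  | H_K : Rel q (FreeAlgebra.ι ℂ Gen.H * FreeAlgebra.ι ℂ Gen.K)
      (FreeAlgebra.ι ℂ Gen.K * FreeAlgebra.ι ℂ Gen.H)

/-- The algebra `U_q^H sl₂`. -/
abbrev UqH (q : ℂ) : Type := RingQuot (Rel q)

/-- The image of a generator in `U_q^H sl₂`. -/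
def UqH.gen (q : ℂ) (g : Gen) : UqH q :=
  RingQuot.mkAlgHom ℂ (Rel q) (FreeAlgebra.ι ℂ g)

section lift

variable {B : Type*} [Ring B] [Algebra ℂ B]

/-- The algebra morphism out of `U_q^H sl₂` with prescribed values on the generators. -/
def UqH.lift (q : ℂ) (e f k ki h : B) (h1 : k * ki = 1) (h2 : ki * k = 1)
    (h3 : k * e = q ^ 2 • (e * k)) (h4 : k * f = (q ^ 2)⁻¹ • (f * k))
    (h5 : e * f - f * e = (q - q⁻¹)⁻¹ • (k - ki))
    (h6 : h * e - e * h = (2 : ℂ) • e) (h7 : h * f - f * h = -((2 : ℂ) • f))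
    (h8 : h * k = k * h) : UqH q →ₐ[ℂ] B :=
  RingQuot.liftAlgHom ℂ
    ⟨FreeAlgebra.lift ℂ (fun g => Gen.casesOn g e f k ki h), by
      intro x y hxy
      induction hxy <;> simpa [FreeAlgebra.lift_ι_apply]⟩

theorem UqH.lift_gen (q : ℂ) (e f k ki h : B) (h1 : k * ki = 1) (h2 : ki * k = 1)
    (h3 : k * e = q ^ 2 • (e * k)) (h4 : k * f = (q ^ 2)⁻¹ • (f * k))
    (h5 : e * f - f * e = (q - q⁻¹)⁻¹ • (k - ki))
    (h6 : h * e - e * h = (2 : ℂ) • e) (h7 : h * f - f * h = -((2 : ℂ) • f))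
    (h8 : h * k = k * h) (g : Gen) :
    UqH.lift q e f k ki h h1 h2 h3 h4 h5 h6 h7 h8 (UqH.gen q g)
      = Gen.casesOn g e f k ki h := by
  simp [UqH.lift, UqH.gen]

end lift

section relations

variable (q : ℂ)

theorem UqH.gen_K_Kinv : UqH.gen q .K * UqH.gen q .Kinv = 1 := by
  simpa [UqH.gen] using RingQuot.mkAlgHom_rel ℂ (Rel.K_Kinv (q := q))

theorem UqH.gen_Kinv_K : UqH.gen q .Kinv * UqH.gen q .K = 1 := by
  simpa [UqH.gen] using RingQuot.mkAlgHom_rel ℂ (Rel.Kinv_K (q := q))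

theorem UqH.gen_K_E : UqH.gen q .K * UqH.gen q .E = q ^ 2 • (UqH.gen q .E * UqH.gen q .K) := by
  simpa [UqH.gen] using RingQuot.mkAlgHom_rel ℂ (Rel.K_E (q := q))

theorem UqH.gen_K_F :
    UqH.gen q .K * UqH.gen q .F = (q ^ 2)⁻¹ • (UqH.gen q .F * UqH.gen q .K) := by
  simpa [UqH.gen] using RingQuot.mkAlgHom_rel ℂ (Rel.K_F (q := q))

theorem UqH.gen_E_F : UqH.gen q .E * UqH.gen q .F - UqH.gen q .F * UqH.gen q .E
    = (q - q⁻¹)⁻¹ • (UqH.gen q .K - UqH.gen q .Kinv) := by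
  simpa [UqH.gen] using RingQuot.mkAlgHom_rel ℂ (Rel.E_F (q := q))

theorem UqH.gen_H_E : UqH.gen q .H * UqH.gen q .E - UqH.gen q .E * UqH.gen q .H
    = (2 : ℂ) • UqH.gen q .E := by
  simpa [UqH.gen] using RingQuot.mkAlgHom_rel ℂ (Rel.H_E (q := q))

theorem UqH.gen_H_F : UqH.gen q .H * UqH.gen q .F - UqH.gen q .F * UqH.gen q .H
    = -((2 : ℂ) • UqH.gen q .F) := by
  simpa [UqH.gen] using RingQuot.mkAlgHom_rel ℂ (Rel.H_F (q := q))

theorem UqH.gen_H_K : UqH.gen q .H * UqH.gen q .K = UqH.gen q .K * UqH.gen q .H := by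
  simpa [UqH.gen] using RingQuot.mkAlgHom_rel ℂ (Rel.H_K (q := q))

end relations

section coproduct

variable (q : ℂ)

theorem UqH.comul_EF_aux :
    (((1 : UqH q) ⊗ₜ[ℂ] UqH.gen q .E + UqH.gen q .E ⊗ₜ[ℂ] UqH.gen q .K)
        * (UqH.gen q .Kinv ⊗ₜ[ℂ] UqH.gen q .F + UqH.gen q .F ⊗ₜ[ℂ] (1 : UqH q))
      - (UqH.gen q .Kinv ⊗ₜ[ℂ] UqH.gen q .F + UqH.gen q .F ⊗ₜ[ℂ] (1 : UqH q))
        * ((1 : UqH q) ⊗ₜ[ℂ] UqH.gen q .E + UqH.gen q .E ⊗ₜ[ℂ] UqH.gen q .K))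
      = (q - q⁻¹)⁻¹ • (UqH.gen q .K ⊗ₜ[ℂ] UqH.gen q .K
          - UqH.gen q .Kinv ⊗ₜ[ℂ] UqH.gen q .Kinv)
        + ((UqH.gen q .E * UqH.gen q .Kinv) ⊗ₜ[ℂ] (UqH.gen q .K * UqH.gen q .F)
          - (UqH.gen q .Kinv * UqH.gen q .E) ⊗ₜ[ℂ] (UqH.gen q .F * UqH.gen q .K)) := by
  have h := UqH.gen_E_F q
  have e1 : UqH.gen q .E * UqH.gen q .F = UqH.gen q .F * UqH.gen q .E
      + (q - q⁻¹)⁻¹ • (UqH.gen q .K - UqH.gen q .Kinv) := by rw [← h]; abel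
  simp only [add_mul, mul_add, Algebra.TensorProduct.tmul_mul_tmul, one_mul, mul_one, e1,
    TensorProduct.tmul_add, TensorProduct.add_tmul, TensorProduct.tmul_smul,
    TensorProduct.smul_tmul', TensorProduct.tmul_sub, TensorProduct.sub_tmul, smul_sub]
  abel

theorem UqH.gen_E_Kinv :
    UqH.gen q .E * UqH.gen q .Kinv = q ^ 2 • (UqH.gen q .Kinv * UqH.gen q .E) := by
  have h : UqH.gen q .Kinv * (UqH.gen q .K * UqH.gen q .E) * UqH.gen q .Kinv
      = UqH.gen q .Kinv * (q ^ 2 • (UqH.gen q .E * UqH.gen q .K)) * UqH.gen q .Kinv := by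
    rw [UqH.gen_K_E]
  rw [← mul_assoc (UqH.gen q .Kinv), UqH.gen_Kinv_K, one_mul, mul_smul_comm, smul_mul_assoc,
    mul_assoc, mul_assoc, UqH.gen_K_Kinv, mul_one] at h
  exact h

/-- The coproduct of `U_q^H sl₂`: `Δ E = 1 ⊗ E + E ⊗ K`, `Δ F = K⁻¹ ⊗ F + F ⊗ 1`,
`Δ K = K ⊗ K`, `Δ H = H ⊗ 1 + 1 ⊗ H`. -/
def UqH.comul (hq : q ≠ 0) : UqH q →ₐ[ℂ] UqH q ⊗[ℂ] UqH q :=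
  UqH.lift q
    ((1 : UqH q) ⊗ₜ[ℂ] UqH.gen q .E + UqH.gen q .E ⊗ₜ[ℂ] UqH.gen q .K)
    (UqH.gen q .Kinv ⊗ₜ[ℂ] UqH.gen q .F + UqH.gen q .F ⊗ₜ[ℂ] (1 : UqH q))
    (UqH.gen q .K ⊗ₜ[ℂ] UqH.gen q .K)
    (UqH.gen q .Kinv ⊗ₜ[ℂ] UqH.gen q .Kinv)
    (UqH.gen q .H ⊗ₜ[ℂ] 1 + (1 : UqH q) ⊗ₜ[ℂ] UqH.gen q .H)
    (by simp [UqH.gen_K_Kinv, Algebra.TensorProduct.one_def])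
    (by simp [UqH.gen_Kinv_K, Algebra.TensorProduct.one_def])
    (by
      simp only [mul_add, add_mul, Algebra.TensorProduct.tmul_mul_tmul, UqH.gen_K_E, one_mul,
        mul_one, TensorProduct.tmul_smul, TensorProduct.smul_tmul', smul_add])
    (by
      simp only [mul_add, add_mul, Algebra.TensorProduct.tmul_mul_tmul, UqH.gen_K_F, one_mul,
        mul_one, TensorProduct.tmul_smul, TensorProduct.smul_tmul', smul_add, UqH.gen_K_Kinv,
        UqH.gen_Kinv_K])
    (by
      rw [UqH.comul_EF_aux, UqH.gen_E_Kinv, UqH.gen_K_F, TensorProduct.tmul_smul,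
        ← TensorProduct.smul_tmul', smul_smul, inv_mul_cancel₀ (pow_ne_zero 2 hq), one_smul,
        sub_self, add_zero])
    (by
      have h := UqH.gen_H_E q
      have e1 : UqH.gen q .H * UqH.gen q .E = UqH.gen q .E * UqH.gen q .H
        + (2 : ℂ) • UqH.gen q .E := by rw [← h]; abel
      simp only [mul_add, add_mul, Algebra.TensorProduct.tmul_mul_tmul, one_mul, mul_one, e1,
        UqH.gen_H_K, TensorProduct.tmul_add, TensorProduct.add_tmul, TensorProduct.tmul_smul,
        TensorProduct.smul_tmul', smul_add]
      abel)
    (by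
      have h := UqH.gen_H_F q
      have e1 : UqH.gen q .H * UqH.gen q .F = UqH.gen q .F * UqH.gen q .H
        - (2 : ℂ) • UqH.gen q .F := by rw [sub_eq_add_neg, ← h]; abel
      have e2 : UqH.gen q .H * UqH.gen q .Kinv = UqH.gen q .Kinv * UqH.gen q .H := by
        calc UqH.gen q .H * UqH.gen q .Kinv
            = UqH.gen q .Kinv * (UqH.gen q .K * UqH.gen q .H) * UqH.gen q .Kinv := by
              rw [← mul_assoc (UqH.gen q .Kinv), UqH.gen_Kinv_K, one_mul]
          _ = UqH.gen q .Kinv * UqH.gen q .H := by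
              rw [← UqH.gen_H_K, mul_assoc, mul_assoc, UqH.gen_K_Kinv, mul_one]
      simp only [mul_add, add_mul, Algebra.TensorProduct.tmul_mul_tmul, one_mul, mul_one, e1, e2,
        TensorProduct.tmul_sub, TensorProduct.sub_tmul, TensorProduct.tmul_smul,
        TensorProduct.smul_tmul', smul_add]
      abel)
    (by
      simp only [mul_add, add_mul, Algebra.TensorProduct.tmul_mul_tmul, one_mul, mul_one,
        UqH.gen_H_K])

/-- A representation of `U_q^H sl₂` on a vector space. -/
abbrev Rep (q : ℂ) (V : Type*) [AddCommGroup V] [Module ℂ V] : Type _ :=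
  UqH q →ₐ[ℂ] Module.End ℂ V

variable {q}
variable {V W : Type*} [AddCommGroup V] [Module ℂ V] [AddCommGroup W] [Module ℂ W]

/-- The tensor product of two representations, through the coproduct. -/
def Rep.tensor (hq : q ≠ 0) (ρ : Rep q V) (σ : Rep q W) : Rep q (V ⊗[ℂ] W) :=
  (Module.endTensorEndAlgHom (R := ℂ) (A := ℂ) (M := V) (N := W)).comp
    ((Algebra.TensorProduct.map ρ σ).comp (UqH.comul q hq))

/-- `f` is a morphism of representations. -/
def IsHom (ρ : Rep q V) (σ : Rep q W) (f : V →ₗ[ℂ] W) : Prop :=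
  ∀ u : UqH q, f ∘ₗ ρ u = σ u ∘ₗ f

end coproduct

/-! ### Quantum numbers -/

namespace RootData

variable (r : RootData)

/-- `k = 2 k'`. -/
def k : ℂ := 2 * (r.k' : ℂ)

/-- `A = exp (2 i π k' / N)`. -/
def A : ℂ := Complex.exp (2 * Real.pi * Complex.I * r.k' / r.N)

/-- `q ^ z = A ^ (2 z) = exp (2 i π k z / N)`. -/
def qp (z : ℂ) : ℂ := Complex.exp (2 * Real.pi * Complex.I * r.k * z / r.N)

/-- `q = A ^ 2`, i.e. `q ^ z` at `z = 1`. -/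
def q : ℂ := r.qp 1

/-- `{z} = q ^ z - q ^ (-z)`. -/
def br (z : ℂ) : ℂ := r.qp z - r.qp (-z)

/-- `[z] = {z} / (q - q⁻¹)`. -/
def qint (z : ℂ) : ℂ := r.br z / (r.q - r.q⁻¹)

/-- The field `ℚ(A)`. -/
abbrev QA : IntermediateField ℚ ℂ := IntermediateField.adjoin ℚ {r.A}

theorem N_ne_zero : (r.N : ℂ) ≠ 0 := by
  have := r.three_le
  exact_mod_cast (by omega : r.N ≠ 0)

theorem qp_add (x y : ℂ) : r.qp (x + y) = r.qp x * r.qp y := by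
  rw [qp, qp, qp, ← Complex.exp_add]; congr 1; ring

theorem qp_neg (x : ℂ) : r.qp (-x) = (r.qp x)⁻¹ := by
  rw [qp, qp, ← Complex.exp_neg]; congr 1; ring

theorem qp_ne_zero (x : ℂ) : r.qp x ≠ 0 := Complex.exp_ne_zero _

theorem q_ne_zero : r.q ≠ 0 := r.qp_ne_zero 1

theorem q_eq : r.q = r.A ^ 2 := by
  rw [q, qp, A, ← Complex.exp_nat_mul]; congr 1; simp [k]; ring

theorem qp_N : r.qp r.N = 1 := by
  rw [qp, mul_div_assoc, div_self r.N_ne_zero, k, Complex.exp_eq_one_iff]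
  exact ⟨2 * r.k', by push_cast; ring⟩

theorem qint_zero : r.qint 0 = 0 := by simp [qint, br]

theorem qint_N : r.qint r.N = 0 := by simp [qint, br, qp_neg, qp_N]

theorem qint_key (l : ℂ) (n : ℕ) :
    r.qint ((n + 1 : ℕ) : ℂ) * r.qint (l - ((n + 1 : ℕ) : ℂ) + 1)
      - r.qint n * r.qint (l - n + 1) = r.qint (l - 2 * n) := by
  by_cases hz : r.q - r.q⁻¹ = 0
  · simp [qint, hz]
  have h1 := r.qp_ne_zero 1
  have h2 := r.qp_ne_zero n
  have h3 := r.qp_ne_zero l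
  have hz' := hz
  rw [q] at hz'
  have e1 : l - ((n + 1 : ℕ) : ℂ) + 1 = l + -(n : ℂ) := by push_cast; ring
  have e2 : l - (n : ℂ) + 1 = l + -(n : ℂ) + 1 := by ring
  have e3 : l - 2 * (n : ℂ) = l + -(n : ℂ) + -(n : ℂ) := by ring
  have e4 : (((n + 1 : ℕ) : ℕ) : ℂ) = n + 1 := by push_cast; ring
  rw [e1, e2, e3, e4]
  simp only [qint, br, q, qp_add, qp_neg]
  rw [div_mul_div_comm, div_mul_div_comm, ← sub_div, div_eq_div_iff (mul_ne_zero hz' hz') hz']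
  field_simp
  ring

theorem qint_add_N (x : ℂ) : r.qint (x + r.N) = r.qint x := by
  simp [qint, br, qp_neg, qp_add, qp_N]

/-! ### Highest weight modules -/

end RootData

/-- The basis vector `v_n` of `ℂ ^ d`, with `v_n = 0` for `n ≥ d`. -/
def vec (d n : ℕ) : Fin d → ℂ := fun j => if (j : ℕ) = n then 1 else 0

theorem vec_eq_zero {d n : ℕ} (h : d ≤ n) : vec d n = 0 := by
  funext j
  have := j.2
  simp only [vec, Pi.zero_apply, ite_eq_right_iff, one_ne_zero, imp_false]
  omega

theorem basisFun_eq_vec (d : ℕ) (j : Fin d) : Pi.basisFun ℂ (Fin d) j = vec d j := by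
  funext i
  simp [vec, Pi.single_apply, Fin.ext_iff]

section linear

variable {V W : Type*} [AddCommGroup V] [Module ℂ V]

/-- The linear map on `ℂ ^ d` that sends `v_n` to `f n` for `n < d`. -/
def lin (d : ℕ) (f : ℕ → V) : (Fin d → ℂ) →ₗ[ℂ] V :=
  (Pi.basisFun ℂ (Fin d)).constr ℂ (fun j => f j)

theorem lin_vec {d n : ℕ} (f : ℕ → V) (h : n < d) : lin d f (vec d n) = f n := by
  have := (Pi.basisFun ℂ (Fin d)).constr_basis ℂ (fun j : Fin d => f j) ⟨n, h⟩
  rwa [basisFun_eq_vec] at this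

theorem lin_vec' {d n : ℕ} (f : ℕ → V) (h : d ≤ n → f n = 0) : lin d f (vec d n) = f n := by
  rcases lt_or_ge n d with h' | h'
  · exact lin_vec f h'
  · rw [vec_eq_zero h', map_zero, h h']

theorem ext_vec {d : ℕ} {f g : (Fin d → ℂ) →ₗ[ℂ] V}
    (h : ∀ n < d, f (vec d n) = g (vec d n)) : f = g := by
  refine (Pi.basisFun ℂ (Fin d)).ext fun j => ?_
  rw [basisFun_eq_vec]
  exact h j j.2

/-- The linear map on `ℂ ^ d ⊗ ℂ ^ e` that sends `v_i ⊗ v_j` to `f i j` for `i < d`, `j < e`. -/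
def lin₂ (d e : ℕ) (f : ℕ → ℕ → V) : (Fin d → ℂ) ⊗[ℂ] (Fin e → ℂ) →ₗ[ℂ] V :=
  TensorProduct.lift (lin d fun i => lin e fun j => f i j)

end linear

namespace RootData

variable (r : RootData)

/-- The module of highest weight `l` with basis `v_0, …, v_{d-1}` and
`H v_n = (l - 2n) v_n`, `K v_n = q ^ (l - 2n) v_n`, `F v_n = v_{n+1}`, `F v_{d-1} = 0`,
`E v_n = [n] [l - n + 1] v_{n-1}`. -/
def hwRep (d : ℕ) (l : ℂ) (h : r.qint d * r.qint (l - d + 1) = 0) : Rep r.q (Fin d → ℂ) :=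
  have hE : ∀ n ≤ d, lin d (fun n => (r.qint n * r.qint (l - n + 1)) • vec d (n - 1)) (vec d n)
      = (r.qint n * r.qint (l - n + 1)) • vec d (n - 1) := fun n hn =>
    lin_vec' (fun n => (r.qint n * r.qint (l - n + 1)) • vec d (n - 1)) (fun h' => by
      obtain rfl := le_antisymm hn h'
      simp only [h, zero_smul])
  have hF : ∀ n, lin d (fun n => vec d (n + 1)) (vec d n) = vec d (n + 1) := fun n =>
    lin_vec' (fun n => vec d (n + 1)) (fun h' => vec_eq_zero (by omega))
  have hD : ∀ (c : ℕ → ℂ) n, lin d (fun n => c n • vec d n) (vec d n) = c n • vec d n :=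
    fun c n => lin_vec' (fun n => c n • vec d n) (fun h' => by simp [vec_eq_zero h'])
  UqH.lift r.q
    (lin d fun n => (r.qint n * r.qint (l - n + 1)) • vec d (n - 1))
    (lin d fun n => vec d (n + 1))
    (lin d fun n => r.qp (l - 2 * n) • vec d n)
    (lin d fun n => r.qp (-(l - 2 * n)) • vec d n)
    (lin d fun n => (l - 2 * n) • vec d n)
    (by
      refine ext_vec fun n hn => ?_
      simp only [Module.End.mul_apply, Module.End.one_apply, hD (fun n => r.qp (l - 2 * n)),
        hD (fun n => r.qp (-(l - 2 * n))), map_smul, smul_smul]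
      rw [← qp_add, neg_add_cancel]; simp [qp])
    (by
      refine ext_vec fun n hn => ?_
      simp only [Module.End.mul_apply, Module.End.one_apply, hD (fun n => r.qp (l - 2 * n)),
        hD (fun n => r.qp (-(l - 2 * n))), map_smul, smul_smul]
      rw [← qp_add, add_neg_cancel]; simp [qp])
    (by
      refine ext_vec fun n hn => ?_
      simp only [Module.End.mul_apply, LinearMap.smul_apply, hD (fun n => r.qp (l - 2 * n)),
        hE n hn.le, map_smul, smul_smul]
      rcases n with _ | n
      · simp [qint_zero]
      · congr 1
        rw [show l - 2 * ((n + 1 - 1 : ℕ) : ℂ) = (l - 2 * ((n + 1 : ℕ) : ℂ)) + (1 + 1) by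
          push_cast [Nat.add_sub_cancel]; ring, qp_add, qp_add, q]
        ring)
    (by
      refine ext_vec fun n hn => ?_
      simp only [Module.End.mul_apply, LinearMap.smul_apply, hD (fun n => r.qp (l - 2 * n)),
        hF, map_smul, smul_smul]
      congr 1
      rw [show l - 2 * (n : ℂ) = (l - 2 * ((n + 1 : ℕ) : ℂ)) + (1 + 1) by push_cast; ring,
        qp_add, qp_add, q]
      have := r.qp_ne_zero 1
      field_simp)
    (by
      refine ext_vec fun n hn => ?_
      simp only [Module.End.mul_apply, LinearMap.smul_apply, LinearMap.sub_apply,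
        hD (fun n => r.qp (l - 2 * n)), hD (fun n => r.qp (-(l - 2 * n))),
        hF, hE n hn.le, hE (n + 1) hn, map_smul, Nat.add_sub_cancel]
      have e1 : (r.qint n * r.qint (l - n + 1)) • vec d (n - 1 + 1)
          = (r.qint n * r.qint (l - n + 1)) • vec d n := by
        rcases n with _ | n
        · simp [qint_zero]
        · rw [Nat.add_sub_cancel]
      rw [e1, ← sub_smul, ← sub_smul, smul_smul, r.qint_key]
      congr 1
      rw [qint, br, div_eq_inv_mul])
    (by
      refine ext_vec fun n hn => ?_
      simp only [Module.End.mul_apply, LinearMap.smul_apply, LinearMap.sub_apply,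
        hD (fun n => (l - 2 * (n : ℂ))), hE n hn.le, map_smul, smul_smul]
      rcases n with _ | n
      · simp [qint_zero]
      · rw [← sub_smul]
        congr 1
        push_cast [Nat.add_sub_cancel]
        ring)
    (by
      refine ext_vec fun n hn => ?_
      simp only [Module.End.mul_apply, LinearMap.smul_apply, LinearMap.sub_apply,
        LinearMap.neg_apply, hD (fun n => (l - 2 * (n : ℂ))), hF, map_smul]
      rw [← sub_smul, ← neg_smul]
      congr 1
      push_cast
      ring)
    (by
      refine ext_vec fun n hn => ?_
      rw [Module.End.mul_apply, Module.End.mul_apply, hD (fun n => r.qp (l - 2 * n)),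
        hD (fun n => (l - 2 * (n : ℂ))), map_smul, map_smul, hD (fun n => r.qp (l - 2 * n)),
        hD (fun n => (l - 2 * (n : ℂ))), smul_comm])

end RootData

namespace RootData

variable (r : RootData)

/-- The module `V_α`: highest weight `α/k + N - 1`, dimension `N`. Since `q ^ N = 1`, the
coefficient `[n] [α/k + N - n]` of its `E`-action equals `[n] [α/k - n]`. -/
def V (α : ℂ) : Rep r.q (Fin r.N → ℂ) :=
  r.hwRep r.N (α / r.k + r.N - 1) (by rw [qint_N, zero_mul])

/-- The two-dimensional module `S₁` with basis `e_0, e_1`. -/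
def S₁ : Rep r.q (Fin 2 → ℂ) :=
  r.hwRep 2 1 (by norm_num [qint_zero])

/-! ### Coefficients of the trivalent vertices -/

/-- `{d}! = {1} {2} ⋯ {d}`. -/
def brFact (d : ℕ) : ℂ := ∏ t ∈ Finset.range d, r.br ((t : ℂ) + 1)

/-- The quantum binomial with top entry `x` and bottom entry `x - d`:
`{x} {x - 1} ⋯ {x - d + 1} / {d}!`. -/
def qbin (x : ℂ) (d : ℕ) : ℂ := (∏ t ∈ Finset.range d, r.br (x - t)) / r.brFact d

/-- `κ_n^α = q ^ (-(n/2) (α/k + N - 1) + n (n-1) / 2) ∏_{t < n} [α/k + N - 1 - t]`. -/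
def kappa (α : ℂ) (n : ℕ) : ℂ :=
  r.qp (-((n : ℂ) / 2) * (α / r.k + r.N - 1) + (n : ℂ) * (n - 1) / 2)
    * ∏ t ∈ Finset.range n, r.qint (α / r.k + r.N - 1 - t)

/-- `κ_{N-2+ν}^{k(N-2)}` for `ν = 0, 1`, with the factor `[N] = 0` (the one of index `t = N - 3`)
left out. -/
def kappaS (ν : ℕ) : ℂ :=
  r.qp (-(((r.N - 2 + ν : ℕ) : ℂ) / 2) * (2 * r.N - 3)
      + ((r.N - 2 + ν : ℕ) : ℂ) * ((r.N - 2 + ν : ℕ) - 1) / 2)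
    * ∏ t ∈ (Finset.range (r.N - 2 + ν)).erase (r.N - 3), r.qint (2 * r.N - 3 - t)

open Classical in
/-- The coefficient `C_{i,j,n}^{α,β,γ}`. It vanishes unless
`i + j - n = (α + β - γ) / (2k) + (N - 1) / 2`. The integral quantum binomial with entries
`i + j - n` and `i - z` is zero unless `z ≤ i` and `w ≤ j`, where `z + w = n`. -/
def coefC (α β γ : ℂ) (i j n : ℕ) : ℂ :=
  if (i : ℂ) + j - n = (α + β - γ) / (2 * r.k) + ((r.N : ℂ) - 1) / 2 then
    (-1) ^ (j + n)
      * r.qp (((j : ℂ) * (β / r.k - j) - (i : ℂ) * (α / r.k - i)) / 2)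
      * (r.qbin (γ / r.k + r.N - 1) n)⁻¹
      * r.qbin (γ / r.k + r.N - 1) (r.N - 1 + n - (i + j))
      * ∑ p ∈ Finset.HasAntidiagonal.antidiagonal n,
          (-1) ^ p.1 * r.qp ((2 * (p.1 : ℂ) - n) * (γ / r.k - n) / 2)
            * (if p.1 ≤ i ∧ p.2 ≤ j then r.qbin ((i : ℂ) + j - n) (j - p.2) else 0)
            * r.qbin (α / r.k - i + p.1 + r.N - 1) p.1
            * r.qbin (β / r.k - j + p.2 + r.N - 1) p.2
  else 0

/-- `D_{i,j,n}^{α,β,γ} = κ_n^γ / (κ_i^α κ_j^β) C_{i,j,n}^{α,β,γ}`. -/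
def coefD (α β γ : ℂ) (i j n : ℕ) : ℂ :=
  r.kappa γ n / (r.kappa α i * r.kappa β j) * r.coefC α β γ i j n

/-- `D_{i,N-2+ν,n}^{α,k(N-2),α+εk}`, with `κ_{N-2+ν}^{k(N-2)}` replaced by its regularization. -/
def coefDS (ε : ℤˣ) (α : ℂ) (i ν n : ℕ) : ℂ :=
  r.kappa (α + (ε : ℤ) * r.k) n / (r.kappa α i * r.kappaS ν)
    * r.coefC α (r.k * (r.N - 2)) (α + (ε : ℤ) * r.k) i (r.N - 2 + ν) n

/-- `E_{N-2+ν,j,n}^{k(N-2),β+εk,β}`, with `κ_{N-2+ν}^{k(N-2)}` replaced by its regularization,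
where `E_{i,j,n}^{α,β,γ} = κ_i^α κ_j^β / κ_n^γ C_{N-1-j,N-1-i,N-1-n}^{-β,-α,-γ}`. -/
def coefES (ε : ℤˣ) (β : ℂ) (ν j n : ℕ) : ℂ :=
  r.kappaS ν * r.kappa (β + (ε : ℤ) * r.k) j / r.kappa β n
    * r.coefC (-(β + (ε : ℤ) * r.k)) (-(r.k * (r.N - 2))) (-β)
        (r.N - 1 - j) (1 - ν) (r.N - 1 - n)

/-! ### The trivalent vertices -/

/-- `H_N = {k (N - 1 - 2t) : 0 ≤ t ≤ N - 1}`. -/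
def HN : Set ℂ := {x | ∃ t : ℕ, t < r.N ∧ x = r.k * (r.N - 1 - 2 * t)}

open Classical in
/-- For `α + β - γ ∈ (k/2) ℤ`, the colour `γ + n k N / 2`, where `n` is the unique integer with
`α + β - γ ∈ n k N / 2 + H_N`. The module of this colour is `V_γ ⊗ σ^n`, with the same underlying
space as `V_γ`. -/
def shift (α β γ : ℂ) : ℂ :=
  if h : ∃ n : ℤ, α + β - (γ + n * (r.k * r.N / 2)) ∈ r.HN
  then γ + h.choose * (r.k * r.N / 2) else γ

/-- The vertex `Y_γ^{α,β} : V_γ (⊗ σ^n) → V_α ⊗ V_β`, `v_n ↦ ∑_{i,j} D_{i,j,n} v_i ⊗ v_j`. -/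
def vertex (α β γ : ℂ) : (Fin r.N → ℂ) →ₗ[ℂ] (Fin r.N → ℂ) ⊗[ℂ] (Fin r.N → ℂ) :=
  lin r.N fun n => ∑ i ∈ Finset.range r.N, ∑ j ∈ Finset.range r.N,
    r.coefD α β (r.shift α β γ) i j n • (vec r.N i ⊗ₜ[ℂ] vec r.N j)

/-- The vertex `V_{α+εk} → V_α ⊗ S₁`. -/
def emit (ε : ℤˣ) (α : ℂ) : (Fin r.N → ℂ) →ₗ[ℂ] (Fin r.N → ℂ) ⊗[ℂ] (Fin 2 → ℂ) :=
  lin r.N fun n => ∑ i ∈ Finset.range r.N, ∑ ν ∈ Finset.range 2,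
    r.coefDS ε α i ν n • (vec r.N i ⊗ₜ[ℂ] vec 2 ν)

/-- The vertex `S₁ ⊗ V_{β+εk} → V_β`. -/
def absorb (ε : ℤˣ) (β : ℂ) : (Fin 2 → ℂ) ⊗[ℂ] (Fin r.N → ℂ) →ₗ[ℂ] (Fin r.N → ℂ) :=
  lin₂ 2 r.N fun ν j => ∑ n ∈ Finset.range r.N, r.coefES ε β ν j n • vec r.N n

/-! ### The 6j-symbol -/

/-- The triangle
`V_γ → V_{α+ε₁k} ⊗ V_{β+ε₂k} → V_α ⊗ S₁ ⊗ V_{β+ε₂k} → V_α ⊗ V_β`. -/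
def triangle (ε₁ ε₂ : ℤˣ) (α β γ : ℂ) :
    (Fin r.N → ℂ) →ₗ[ℂ] (Fin r.N → ℂ) ⊗[ℂ] (Fin r.N → ℂ) :=
  (r.absorb ε₂ β).lTensor (Fin r.N → ℂ)
    ∘ₗ (TensorProduct.assoc ℂ (Fin r.N → ℂ) (Fin 2 → ℂ) (Fin r.N → ℂ)).toLinearMap
    ∘ₗ (r.emit ε₁ α).rTensor (Fin r.N → ℂ)
    ∘ₗ r.vertex (α + (ε₁ : ℤ) * r.k) (β + (ε₂ : ℤ) * r.k) γ

open Classical in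
/-- The 6j-symbol `6S(α, β, γ; ε₁, ε₂)`: the scalar `s` with `triangle = s • Y_γ^{α,β}`. -/
def sixJ (ε₁ ε₂ : ℤˣ) (α β γ : ℂ) : ℂ :=
  if h : ∃ s : ℂ, r.triangle ε₁ ε₂ α β γ = s • r.vertex α β γ then h.choose else 0

/-- `ℂ̈ = (ℂ ∖ ½ℤ) ∪ (N/2) ℤ`. -/
def simpleColours : Set ℂ := {z | (∀ j : ℤ, z ≠ j / 2) ∨ ∃ j : ℤ, z = j * (r.N / 2)}

/-- Colours for which the five modules `V_α`, `V_β`, `V_γ`, `V_{α+ε₁k}`, `V_{β+ε₂k}` of the skein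
relation have their colours in `ℂ̈` and the vertices are admissible. -/
structure Admissible (ε₁ ε₂ : ℤˣ) (α β γ : ℂ) : Prop where
  left : α ∈ r.simpleColours
  right : β ∈ r.simpleColours
  bottom : γ ∈ r.simpleColours
  left' : α + (ε₁ : ℤ) * r.k ∈ r.simpleColours
  right' : β + (ε₂ : ℤ) * r.k ∈ r.simpleColours
  vertex : ∃ j : ℤ, α + β - γ = j * (r.k / 2)

/-- The rational fraction `R` over `ℚ(A)` is regular at the point `x` with value `v`. -/
def HasValueAt (R : FractionRing (MvPolynomial (Fin 3) r.QA)) (x : Fin 3 → ℂ) (v : ℂ) : Prop :=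
  ∃ P Q : MvPolynomial (Fin 3) r.QA,
    R = algebraMap _ (FractionRing (MvPolynomial (Fin 3) r.QA)) P
        / algebraMap _ (FractionRing (MvPolynomial (Fin 3) r.QA)) Q
      ∧ MvPolynomial.aeval x Q ≠ 0
      ∧ v = MvPolynomial.aeval x P / MvPolynomial.aeval x Q

/-- The point `(e^{iπα/N}, e^{iπβ/N}, e^{iπγ/N})`. -/
def point (α β γ : ℂ) : Fin 3 → ℂ :=
  ![Complex.exp (Real.pi * Complex.I * α / r.N), Complex.exp (Real.pi * Complex.I * β / r.N),
    Complex.exp (Real.pi * Complex.I * γ / r.N)]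

end RootData

end UnrolledSl2

end

noncomputable section

namespace UnrolledSl2

namespace RootData

variable (r : RootData)

/-! ### Vanishing of quantum numbers -/

/-! Everything reduces to one coordinate, because the morphisms V_γ' → V_α ⊗ V_β form a line.

If α and α ± k are both simple, then α is not a half-integer (`not_half_int`), so no {hw α + t} with
t an integer vanishes; the same holds for β. For γ only the factors {hw γ − t} with t < N − 1 are
known to be non-zero, and this suffices. The condition on α + β − γ means that, once γ is shifted by
n k N / 2, hw γ = hw α + hw β − 2m for exactly one level 0 ≤ m < N (`exists_level`, `level_unique`).

A highest weight vector of that weight in V_α ⊗ V_β is determined by its coordinate along v_0 ⊗ v_m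
(`eq_zero_of_highest`), since E v_i is a non-zero multiple of v_{i−1} in the first factor for 0 < i
< N. Hence any morphism is a multiple of Y (`eq_smul_vertexAt`), and it is zero when no level fits
(`eq_zero_of_no_level`). Y itself is linear because its coefficients at n = 0 are killed by E
(`coefD_hw`) and those at n are the q-binomial expansion of Fⁿ (`coefD_eq_desc`). For I and J the
defining sums collapse to at most two terms, giving short formulas on basis vectors (`emit_pos_vec`,
`absorb_pos_zero` and their companions) on which linearity is checked directly.

The scalar is therefore the ratio of the coordinates along v_0 ⊗ v_m. For the triangle this
coordinate has at most two contributions, and the four sign choices give the closed forms of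
`levelValue`. If m + (ε₁ + ε₂)/2 leaves 0, …, N − 1, the triangle starts from a module of another
highest weight and is zero, as is the closed form (`triangle_eq_smul`).

At fixed m, `levelValue` is rational in q^(α/k) and q^(β/k). The level is read from e^(2iπ(α+β−γ)/N)
= q^(2m+1), whose N values are distinct and do not depend on n (`levelCoord_eq`, `qp_level_ne`), so
Lagrange interpolation over the levels gives R. Part 2 is read off the factors of the closed forms
(`levelValue_ne_zero_iff`). -/

theorem k'_ne_zero : (r.k' : ℂ) ≠ 0 := by
  have := r.pos
  exact_mod_cast (by omega : r.k' ≠ 0)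

theorem k_ne_zero : r.k ≠ 0 := mul_ne_zero two_ne_zero r.k'_ne_zero

theorem qp_zero : r.qp 0 = 1 := by simp [qp]

theorem qp_eq_one_iff (z : ℂ) : r.qp z = 1 ↔ ∃ t : ℤ, r.k * z = t * r.N := by
  have hN := r.N_ne_zero
  have hpi : (2 * Real.pi * Complex.I : ℂ) ≠ 0 := Complex.two_pi_I_ne_zero
  rw [qp, Complex.exp_eq_one_iff]
  refine exists_congr fun t => ?_
  rw [div_eq_iff hN]
  constructor
  · intro h
    apply mul_left_cancel₀ hpi
    linear_combination h
  · intro h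
    linear_combination (2 * Real.pi * Complex.I : ℂ) * h

/-- The exponent is 2iπk't because k = 2k' is even: already N/2, and not only N, is a period of z ↦
q^z. -/
theorem qp_half_mul_N (t : ℤ) : r.qp (t * r.N / 2) = 1 :=
  (r.qp_eq_one_iff _).2 ⟨r.k' * t, by rw [k]; push_cast; ring⟩

/-- `q ^ z` only depends on `z` modulo `N / 2`. -/
theorem qp_congr {x y : ℂ} (t : ℤ) (h : x - y = t * r.N / 2) : r.qp x = r.qp y := by
  rw [show x = y + t * r.N / 2 by rw [← h]; ring, qp_add, qp_half_mul_N, mul_one]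

theorem br_eq_zero_iff (z : ℂ) : r.br z = 0 ↔ ∃ t : ℤ, 2 * (r.k * z) = t * r.N := by
  have h : r.br z = 0 ↔ r.qp (2 * z) = 1 := by
    rw [br, sub_eq_zero, qp_neg, two_mul, qp_add, mul_eq_one_iff_eq_inv₀ (r.qp_ne_zero z)]
  rw [h, qp_eq_one_iff]
  exact exists_congr fun t => by rw [mul_left_comm]

/-- N is odd and prime to k', so 4k' is invertible modulo N. One factor 2 comes from k = 2k', the
other from {z} = 0 meaning q^(2z) = 1. -/
theorem dvd_of_dvd_four_mul {n : ℤ} (h : (r.N : ℤ) ∣ 4 * r.k' * n) : (r.N : ℤ) ∣ n := by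
  have h2 : IsCoprime (r.N : ℤ) 2 := by
    rw [Int.isCoprime_iff_gcd_eq_one]
    have := r.odd.coprime_two_right
    exact_mod_cast this
  have h3 : IsCoprime (r.N : ℤ) (r.k' : ℤ) := Nat.isCoprime_iff_coprime.2 r.coprime.symm
  have h4 : IsCoprime (r.N : ℤ) (4 * r.k') := by
    rw [show (4 : ℤ) = 2 * 2 by norm_num]
    exact (h2.mul_right h2).mul_right h3
  exact h4.dvd_of_dvd_mul_left h

theorem br_int_ne_zero {n : ℤ} (h : ¬ (r.N : ℤ) ∣ n) : r.br n ≠ 0 := by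
  rw [Ne, br_eq_zero_iff]
  rintro ⟨t, ht⟩
  refine h (r.dvd_of_dvd_four_mul ⟨t, ?_⟩)
  rw [k] at ht
  have : ((4 * r.k' * n : ℤ) : ℂ) = ((r.N * t : ℤ) : ℂ) := by push_cast; linear_combination ht
  exact_mod_cast this

theorem br_nat_ne_zero {n : ℕ} (h : 0 < n) (h' : n < r.N) : r.br n ≠ 0 := by
  have := r.br_int_ne_zero (n := n) (fun hd => by
    have := Int.le_of_dvd (by exact_mod_cast h) hd
    omega)
  exact_mod_cast this

theorem br_one : r.br 1 = r.q - r.q⁻¹ := by rw [br, qp_neg, q]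

theorem br_one_ne_zero : r.br 1 ≠ 0 := by
  have := r.three_le
  have h := r.br_nat_ne_zero (n := 1) one_pos (by omega)
  exact_mod_cast h

theorem q_sub_ne_zero : r.q - r.q⁻¹ ≠ 0 := r.br_one ▸ r.br_one_ne_zero

theorem qint_eq (z : ℂ) : r.qint z = r.br z / r.br 1 := by rw [qint, br_one]

theorem qint_ne_zero {z : ℂ} (h : r.br z ≠ 0) : r.qint z ≠ 0 :=
  div_ne_zero h r.q_sub_ne_zero

theorem qint_one : r.qint 1 = 1 := by rw [qint_eq, div_self r.br_one_ne_zero]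

theorem br_neg (z : ℂ) : r.br (-z) = -r.br z := by simp [br]

theorem br_zero : r.br 0 = 0 := by simp [br]

theorem qint_neg (z : ℂ) : r.qint (-z) = -r.qint z := by rw [qint_eq, qint_eq, br_neg, neg_div]

/-- `{z}` only depends on `z` modulo `N / 2`. -/
theorem br_congr {x y : ℂ} (t : ℤ) (h : x - y = t * r.N / 2) : r.br x = r.br y := by
  rw [br, br, r.qp_congr t h, r.qp_congr (x := -x) (y := -y) (-t) (by
    push_cast; linear_combination -h)]

theorem qint_congr {x y : ℂ} (t : ℤ) (h : x - y = t * r.N / 2) : r.qint x = r.qint y := by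
  rw [qint_eq, qint_eq, r.br_congr t h]

theorem br_N : r.br r.N = 0 := by
  rw [r.br_congr (y := 0) 2 (by push_cast; ring), br_zero]

theorem brFact_zero : r.brFact 0 = 1 := by simp [brFact]

theorem brFact_succ (d : ℕ) : r.brFact (d + 1) = r.brFact d * r.br ((d : ℂ) + 1) := by
  rw [brFact, Finset.prod_range_succ, brFact]

theorem brFact_ne_zero {d : ℕ} (h : d < r.N) : r.brFact d ≠ 0 := by
  refine Finset.prod_ne_zero_iff.2 fun t ht => ?_
  rw [Finset.mem_range] at ht
  have := r.br_nat_ne_zero (n := t + 1) (by omega) (by omega)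
  exact_mod_cast this

/-! ### Simple colours -/

/-- A zero would give 2α = tN − 4k'n. This makes α a half-integer, and for α in (N/2)ℤ it forces N
to divide 4k'n. -/
theorem br_ne_zero_of_simple {α : ℂ} (hα : α ∈ r.simpleColours) {n : ℤ} (h : ¬ (r.N : ℤ) ∣ n) :
    r.br (α / r.k + n) ≠ 0 := by
  have hk := r.k_ne_zero
  rw [Ne, br_eq_zero_iff]
  rintro ⟨t, ht⟩
  have h2 : 2 * α = t * r.N - 4 * r.k' * n := by
    have h3 : r.k * (α / r.k + n) = α + 2 * r.k' * n := by
      rw [mul_add, mul_div_cancel₀ _ hk, k]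
    rw [h3] at ht
    linear_combination ht
  rcases hα with h1 | ⟨j, hj⟩
  · refine h1 (t * r.N - 4 * r.k' * n) ?_
    push_cast
    rw [← h2]; ring
  · refine h (r.dvd_of_dvd_four_mul ⟨t - j, ?_⟩)
    have : ((4 * r.k' * n : ℤ) : ℂ) = ((r.N * (t - j) : ℤ) : ℂ) := by
      push_cast; rw [hj] at h2; linear_combination h2
    exact_mod_cast this

/-- A colour that is simple together with one of its neighbours `α ± k` is not a half-integer. -/
theorem not_half_int {α : ℂ} (hα : α ∈ r.simpleColours) (ε : ℤˣ)
    (hα' : α + (ε : ℤ) * r.k ∈ r.simpleColours) (j : ℤ) : α ≠ j / 2 := by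
  rcases hα with h | ⟨a, ha⟩
  · exact h j
  rcases hα' with h' | ⟨b, hb⟩
  · exact absurd (show α + (ε : ℤ) * r.k = ((a * r.N + 4 * ε * r.k' : ℤ) : ℂ) / 2 by
      rw [ha, k]; push_cast; ring) (h' _)
  -- Both colours lie in (N/2)ℤ, so N divides 4k'ε, hence the unit ε.
  · exfalso
    have h1 : ((4 * r.k' * (ε : ℤ) : ℤ) : ℂ) = ((r.N * (b - a) : ℤ) : ℂ) := by
      rw [ha, k] at hb; push_cast; linear_combination 2 * hb
    have h2 := r.dvd_of_dvd_four_mul ⟨b - a, by exact_mod_cast h1⟩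
    have h3 := r.three_le
    have h4 := (Int.isUnit_iff_natAbs_eq.1 ε.isUnit)
    have h5 := Int.natAbs_dvd_natAbs.2 h2
    rw [h4, Int.natAbs_natCast, Nat.dvd_one] at h5
    omega

theorem br_ne_zero_of_not_half_int {α : ℂ} (h : ∀ j : ℤ, α ≠ j / 2) (n : ℤ) :
    r.br (α / r.k + n) ≠ 0 := by
  have hk := r.k_ne_zero
  rw [Ne, br_eq_zero_iff]
  rintro ⟨t, ht⟩
  have h3 : r.k * (α / r.k + n) = α + 2 * r.k' * n := by
      rw [mul_add, mul_div_cancel₀ _ hk, k]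
  rw [h3] at ht
  refine h (t * r.N - 4 * r.k' * n) ?_
  push_cast
  linear_combination ht / 2

end RootData

/-! ### Morphisms of representations -/

section hom

variable {q : ℂ} {V W X : Type*} [AddCommGroup V] [Module ℂ V] [AddCommGroup W] [Module ℂ W]
  [AddCommGroup X] [Module ℂ X]

theorem IsHom.of_gen {ρ : Rep q V} {σ : Rep q W} {f : V →ₗ[ℂ] W}
    (h : ∀ g, f ∘ₗ ρ (UqH.gen q g) = σ (UqH.gen q g) ∘ₗ f) : IsHom ρ σ f := by
  intro u
  obtain ⟨a, rfl⟩ := RingQuot.mkAlgHom_surjective ℂ (Rel q) u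
  induction a using FreeAlgebra.induction with
  | grade0 c =>
    rw [AlgHom.commutes, AlgHom.commutes, AlgHom.commutes]
    ext x
    simp [Module.algebraMap_end_apply]
  | grade1 g => exact h g
  | mul a b ha hb =>
    rw [map_mul, map_mul, map_mul, Module.End.mul_eq_comp, Module.End.mul_eq_comp,
      ← LinearMap.comp_assoc, ha, LinearMap.comp_assoc, hb, LinearMap.comp_assoc]
  | add a b ha hb =>
    rw [map_add, map_add, map_add, LinearMap.comp_add, LinearMap.add_comp, ha, hb]

theorem Rep.K_Kinv_apply (ρ : Rep q V) (x : V) :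
    ρ (UqH.gen q .K) (ρ (UqH.gen q .Kinv) x) = x := by
  rw [← Module.End.mul_apply, ← map_mul, UqH.gen_K_Kinv, map_one, Module.End.one_apply]

theorem Rep.Kinv_K_apply (ρ : Rep q V) (x : V) :
    ρ (UqH.gen q .Kinv) (ρ (UqH.gen q .K) x) = x := by
  rw [← Module.End.mul_apply, ← map_mul, UqH.gen_Kinv_K, map_one, Module.End.one_apply]

/-- Commutation with the generator `K⁻¹` is automatic. -/
theorem IsHom.of_EFKH {ρ : Rep q V} {σ : Rep q W} {f : V →ₗ[ℂ] W}
    (hE : f ∘ₗ ρ (UqH.gen q .E) = σ (UqH.gen q .E) ∘ₗ f)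
    (hF : f ∘ₗ ρ (UqH.gen q .F) = σ (UqH.gen q .F) ∘ₗ f)
    (hK : f ∘ₗ ρ (UqH.gen q .K) = σ (UqH.gen q .K) ∘ₗ f)
    (hH : f ∘ₗ ρ (UqH.gen q .H) = σ (UqH.gen q .H) ∘ₗ f) : IsHom ρ σ f := by
  refine IsHom.of_gen fun g => ?_
  cases g with
  | E => exact hE
  | F => exact hF
  | K => exact hK
  | H => exact hH
  | Kinv =>
    refine LinearMap.ext fun x => ?_
    have h := LinearMap.congr_fun hK (ρ (UqH.gen q .Kinv) x)
    rw [LinearMap.comp_apply, LinearMap.comp_apply, ρ.K_Kinv_apply] at h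
    rw [LinearMap.comp_apply, LinearMap.comp_apply, h, σ.Kinv_K_apply]

theorem IsHom.apply {ρ : Rep q V} {σ : Rep q W} {f : V →ₗ[ℂ] W} (h : IsHom ρ σ f) (u : UqH q)
    (x : V) : f (ρ u x) = σ u (f x) := LinearMap.congr_fun (h u) x

theorem IsHom.comp {ρ : Rep q V} {σ : Rep q W} {τ : Rep q X} {f : V →ₗ[ℂ] W} {g : W →ₗ[ℂ] X}
    (hg : IsHom σ τ g) (hf : IsHom ρ σ f) : IsHom ρ τ (g ∘ₗ f) := fun u => by
  rw [LinearMap.comp_assoc, hf u, ← LinearMap.comp_assoc, hg u, LinearMap.comp_assoc]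

section tensor

variable (hq : q ≠ 0) (ρ : Rep q V) (σ : Rep q W) (x : V) (y : W)

theorem Rep.tensor_E : ρ.tensor hq σ (UqH.gen q .E) (x ⊗ₜ[ℂ] y)
    = x ⊗ₜ[ℂ] σ (UqH.gen q .E) y + ρ (UqH.gen q .E) x ⊗ₜ[ℂ] σ (UqH.gen q .K) y := by
  simp [Rep.tensor, UqH.comul, UqH.lift_gen, Module.endTensorEndAlgHom_apply]

theorem Rep.tensor_F : ρ.tensor hq σ (UqH.gen q .F) (x ⊗ₜ[ℂ] y)
    = ρ (UqH.gen q .Kinv) x ⊗ₜ[ℂ] σ (UqH.gen q .F) y + ρ (UqH.gen q .F) x ⊗ₜ[ℂ] y := by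
  simp [Rep.tensor, UqH.comul, UqH.lift_gen, Module.endTensorEndAlgHom_apply]

theorem Rep.tensor_K : ρ.tensor hq σ (UqH.gen q .K) (x ⊗ₜ[ℂ] y)
    = ρ (UqH.gen q .K) x ⊗ₜ[ℂ] σ (UqH.gen q .K) y := by
  simp [Rep.tensor, UqH.comul, UqH.lift_gen, Module.endTensorEndAlgHom_apply]

theorem Rep.tensor_Kinv : ρ.tensor hq σ (UqH.gen q .Kinv) (x ⊗ₜ[ℂ] y)
    = ρ (UqH.gen q .Kinv) x ⊗ₜ[ℂ] σ (UqH.gen q .Kinv) y := by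
  simp [Rep.tensor, UqH.comul, UqH.lift_gen, Module.endTensorEndAlgHom_apply]

theorem Rep.tensor_H : ρ.tensor hq σ (UqH.gen q .H) (x ⊗ₜ[ℂ] y)
    = ρ (UqH.gen q .H) x ⊗ₜ[ℂ] y + x ⊗ₜ[ℂ] σ (UqH.gen q .H) y := by
  simp [Rep.tensor, UqH.comul, UqH.lift_gen, Module.endTensorEndAlgHom_apply]

variable {ρ σ}

theorem IsHom.lTensor {τ : Rep q X} {f : W →ₗ[ℂ] X} (h : IsHom σ τ f) :
    IsHom (ρ.tensor hq σ) (ρ.tensor hq τ) (f.lTensor V) := by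
  have e : ∀ (u : UqH q) y, f (σ u y) = τ u (f y) := h.apply
  refine IsHom.of_gen fun g => TensorProduct.ext' fun x y => ?_
  cases g <;> simp [Rep.tensor_E, Rep.tensor_F, Rep.tensor_K, Rep.tensor_Kinv, Rep.tensor_H, e]

theorem IsHom.rTensor {τ : Rep q X} {f : V →ₗ[ℂ] X} (h : IsHom ρ τ f) :
    IsHom (ρ.tensor hq σ) (τ.tensor hq σ) (f.rTensor W) := by
  have e : ∀ (u : UqH q) y, f (ρ u y) = τ u (f y) := h.apply
  refine IsHom.of_gen fun g => TensorProduct.ext' fun x y => ?_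
  cases g <;> simp [Rep.tensor_E, Rep.tensor_F, Rep.tensor_K, Rep.tensor_Kinv, Rep.tensor_H, e]

variable (ρ σ)

theorem IsHom.assoc (τ : Rep q X) :
    IsHom ((ρ.tensor hq σ).tensor hq τ) (ρ.tensor hq (σ.tensor hq τ))
      (TensorProduct.assoc ℂ V W X).toLinearMap := by
  refine IsHom.of_gen fun g => TensorProduct.ext_threefold fun x y z => ?_
  cases g <;> simp [Rep.tensor_E, Rep.tensor_F, Rep.tensor_K, Rep.tensor_Kinv, Rep.tensor_H,
    TensorProduct.add_tmul, TensorProduct.tmul_add, add_assoc]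

end tensor

/-- `K F = q⁻² F K` in a representation. -/
theorem Rep.K_F_apply (σ : Rep q W) (w : W) : σ (UqH.gen q .K) (σ (UqH.gen q .F) w)
    = (q ^ 2)⁻¹ • σ (UqH.gen q .F) (σ (UqH.gen q .K) w) := by
  rw [← Module.End.mul_apply, ← map_mul, UqH.gen_K_F, map_smul, map_mul]; rfl

theorem Rep.H_F_apply (σ : Rep q W) (w : W) : σ (UqH.gen q .H) (σ (UqH.gen q .F) w)
    = σ (UqH.gen q .F) (σ (UqH.gen q .H) w) - (2 : ℂ) • σ (UqH.gen q .F) w := by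
  have h := congrArg (fun u => σ u w) (UqH.gen_H_F q)
  simp only [map_sub, map_mul, map_neg, map_smul, LinearMap.sub_apply, Module.End.mul_apply,
    LinearMap.neg_apply, LinearMap.smul_apply] at h
  rw [sub_eq_iff_eq_add] at h
  rw [h]; abel

theorem Rep.E_F_apply (σ : Rep q W) (w : W) : σ (UqH.gen q .E) (σ (UqH.gen q .F) w)
    = σ (UqH.gen q .F) (σ (UqH.gen q .E) w)
      + (q - q⁻¹)⁻¹ • (σ (UqH.gen q .K) w - σ (UqH.gen q .Kinv) w) := by
  have h := congrArg (fun u => σ u w) (UqH.gen_E_F q)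
  simp only [map_sub, map_mul, map_smul, LinearMap.sub_apply, Module.End.mul_apply,
    LinearMap.smul_apply] at h
  rw [sub_eq_iff_eq_add] at h
  rw [h]; abel

end hom

namespace RootData

variable (r : RootData)

/-! ### Highest weight modules -/

section hw

variable {d : ℕ} {l : ℂ} (h : r.qint d * r.qint (l - d + 1) = 0)

include h in
theorem hwRep_E {n : ℕ} (hn : n ≤ d) : r.hwRep d l h (UqH.gen r.q .E) (vec d n)
    = (r.qint n * r.qint (l - n + 1)) • vec d (n - 1) := by
  rw [hwRep, UqH.lift_gen]
  refine lin_vec' (fun n => (r.qint n * r.qint (l - n + 1)) • vec d (n - 1)) (fun h' => ?_)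
  obtain rfl := le_antisymm hn h'
  simp only [h, zero_smul]

theorem hwRep_F (n : ℕ) : r.hwRep d l h (UqH.gen r.q .F) (vec d n) = vec d (n + 1) := by
  rw [hwRep, UqH.lift_gen]
  exact lin_vec' (fun n => vec d (n + 1)) (fun h' => vec_eq_zero (by omega))

theorem hwRep_K (n : ℕ) :
    r.hwRep d l h (UqH.gen r.q .K) (vec d n) = r.qp (l - 2 * n) • vec d n := by
  rw [hwRep, UqH.lift_gen]
  exact lin_vec' (fun n => r.qp (l - 2 * n) • vec d n) (fun h' => by simp [vec_eq_zero h'])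

theorem hwRep_Kinv (n : ℕ) :
    r.hwRep d l h (UqH.gen r.q .Kinv) (vec d n) = r.qp (-(l - 2 * n)) • vec d n := by
  rw [hwRep, UqH.lift_gen]
  exact lin_vec' (fun n => r.qp (-(l - 2 * n)) • vec d n) (fun h' => by simp [vec_eq_zero h'])

theorem hwRep_H (n : ℕ) :
    r.hwRep d l h (UqH.gen r.q .H) (vec d n) = (l - 2 * n) • vec d n := by
  rw [hwRep, UqH.lift_gen]
  exact lin_vec' (fun n => (l - 2 * n) • vec d n) (fun h' => by simp [vec_eq_zero h'])

variable {W : Type*} [AddCommGroup W] [Module ℂ W] {σ : Rep r.q W}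

/-- A highest weight vector `w 0` whose descendants `w n = Fⁿ w 0` vanish for `n = d` defines a
morphism out of a highest weight module. -/
theorem isHom_lin_of_hw {w : ℕ → W} (hF : ∀ n < d, σ (UqH.gen r.q .F) (w n) = w (n + 1))
    (hd : w d = 0) (hE : σ (UqH.gen r.q .E) (w 0) = 0)
    (hK : σ (UqH.gen r.q .K) (w 0) = r.qp l • w 0) (hH : σ (UqH.gen r.q .H) (w 0) = l • w 0) :
    IsHom (r.hwRep d l h) σ (lin d w) := by
  have hK' : ∀ n < d, σ (UqH.gen r.q .K) (w n) = r.qp (l - 2 * n) • w n := by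
    intro n
    induction n with
    | zero => intro _; simpa using hK
    | succ n ih =>
      intro hn
      rw [← hF n (by omega), σ.K_F_apply, ih (by omega), map_smul, smul_smul]
      congr 1
      rw [q, show l - 2 * ((n + 1 : ℕ) : ℂ) = (l - 2 * n) + (-(1 + 1)) by push_cast; ring,
        qp_add _ _ (-(1 + 1)), qp_neg, qp_add]
      ring
  have hH' : ∀ n < d, σ (UqH.gen r.q .H) (w n) = (l - 2 * n) • w n := by
    intro n
    induction n with
    | zero => intro _; simpa using hH
    | succ n ih =>
      intro hn
      rw [← hF n (by omega), σ.H_F_apply, ih (by omega), map_smul, ← sub_smul]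
      congr 1
      push_cast
      ring
  have hKi : ∀ n < d, σ (UqH.gen r.q .Kinv) (w n) = r.qp (-(l - 2 * n)) • w n := by
    intro n hn
    have h1 := congrArg (fun x => r.qp (-(l - 2 * n)) • σ (UqH.gen r.q .Kinv) x) (hK' n hn)
    simp only [σ.Kinv_K_apply, map_smul, smul_smul] at h1
    rw [h1, qp_neg, inv_mul_cancel₀ (r.qp_ne_zero _), one_smul]
  have hE' : ∀ n < d, σ (UqH.gen r.q .E) (w n) = (r.qint n * r.qint (l - n + 1)) • w (n - 1) := by
    intro n
    induction n with
    | zero => intro _; simpa [qint_zero] using hE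
    | succ n ih =>
      intro hn
      rw [← hF n (by omega), σ.E_F_apply, ih (by omega), map_smul, hK' n (by omega),
        hKi n (by omega), ← sub_smul, smul_smul, Nat.add_sub_cancel]
      have e1 : (r.qint n * r.qint (l - n + 1)) • σ (UqH.gen r.q .F) (w (n - 1))
          = (r.qint n * r.qint (l - n + 1)) • w n := by
        rcases n with _ | n
        · simp [qint_zero]
        · rw [Nat.add_sub_cancel, hF n (by omega)]
      rw [e1, ← add_smul]
      congr 1
      -- `qint_key` is [n + 1][l − n] = [n][l − n + 1] + [l − 2n], exactly what the commutator of E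
      -- and F demands.
      have e2 := r.qint_key l n
      have e3 : r.qint (l - 2 * n)
          = (r.q - r.q⁻¹)⁻¹ * (r.qp (l - 2 * n) - r.qp (-(l - 2 * n))) := by
        rw [qint, br, div_eq_inv_mul]
      rw [← e3, ← e2]
      ring
  refine IsHom.of_EFKH (ext_vec fun n hn => ?_) (ext_vec fun n hn => ?_)
    (ext_vec fun n hn => ?_) (ext_vec fun n hn => ?_)
  · rw [LinearMap.comp_apply, LinearMap.comp_apply, r.hwRep_E h hn.le, map_smul, lin_vec w hn,
      lin_vec w (by omega), hE' n hn]
  · rw [LinearMap.comp_apply, LinearMap.comp_apply, r.hwRep_F h, lin_vec w hn, hF n hn]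
    refine lin_vec' w fun h' => ?_
    obtain rfl : n + 1 = d := by omega
    exact hd
  · rw [LinearMap.comp_apply, LinearMap.comp_apply, r.hwRep_K h, map_smul, lin_vec w hn, hK' n hn]
  · rw [LinearMap.comp_apply, LinearMap.comp_apply, r.hwRep_H h, map_smul, lin_vec w hn, hH' n hn]

/-- A morphism out of a highest weight module is determined by the image of `v_0`. -/
theorem hom_ext_of_hw {f g : (Fin d → ℂ) →ₗ[ℂ] W} (hf : IsHom (r.hwRep d l h) σ f)
    (hg : IsHom (r.hwRep d l h) σ g) (h0 : f (vec d 0) = g (vec d 0)) : f = g := by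
  refine ext_vec fun n _ => ?_
  induction n with
  | zero => exact h0
  | succ n ih =>
    rw [← r.hwRep_F h, hf.apply, hg.apply, ih (by omega)]

end hw

end RootData

/-! ### Coordinates -/

section coord

/-- The coordinate of index `(i, j)` on `ℂ ^ d ⊗ ℂ ^ e`. -/
def coord (d e i j : ℕ) : (Fin d → ℂ) ⊗[ℂ] (Fin e → ℂ) →ₗ[ℂ] ℂ :=
  lin₂ d e fun a b => if a = i ∧ b = j then 1 else 0

theorem lin₂_vec {V : Type*} [AddCommGroup V] [Module ℂ V] {d e a b : ℕ} (f : ℕ → ℕ → V)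
    (ha : a < d) (hb : b < e) : lin₂ d e f (vec d a ⊗ₜ vec e b) = f a b := by
  rw [lin₂, TensorProduct.lift.tmul, lin_vec _ ha, lin_vec _ hb]

theorem coord_vec {d e a b : ℕ} (i j : ℕ) (ha : a < d) (hb : b < e) :
    coord d e i j (vec d a ⊗ₜ vec e b) = if a = i ∧ b = j then 1 else 0 := by
  rw [coord, lin₂_vec _ ha hb]

theorem ext_vec₂ {V : Type*} [AddCommGroup V] [Module ℂ V] {d e : ℕ}
    {f g : (Fin d → ℂ) ⊗[ℂ] (Fin e → ℂ) →ₗ[ℂ] V}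
    (h : ∀ a < d, ∀ b < e, f (vec d a ⊗ₜ vec e b) = g (vec d a ⊗ₜ vec e b)) : f = g := by
  refine TensorProduct.ext ?_
  refine ext_vec fun a ha => ext_vec fun b hb => ?_
  exact h a ha b hb

theorem sum_coord {d e : ℕ} (t : (Fin d → ℂ) ⊗[ℂ] (Fin e → ℂ)) :
    t = ∑ i ∈ Finset.range d, ∑ j ∈ Finset.range e, coord d e i j t • (vec d i ⊗ₜ vec e j) := by
  have h : LinearMap.id = ∑ i ∈ Finset.range d, ∑ j ∈ Finset.range e,
      (coord d e i j).smulRight (vec d i ⊗ₜ[ℂ] vec e j) := by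
    refine ext_vec₂ fun a ha b hb => ?_
    simp only [LinearMap.id_apply, LinearMap.sum_apply, LinearMap.smulRight_apply,
      coord_vec _ _ ha hb]
    rw [Finset.sum_eq_single a, Finset.sum_eq_single b]
    · simp
    · intro j _ hj; simp [hj.symm]
    · intro hb'; exact absurd (Finset.mem_range.2 hb) hb'
    · intro i _ hi; simp [hi.symm]
    · intro ha'; exact absurd (Finset.mem_range.2 ha) ha'
  simpa using LinearMap.congr_fun h t

theorem coord_ext {d e : ℕ} {s t : (Fin d → ℂ) ⊗[ℂ] (Fin e → ℂ)}
    (h : ∀ i < d, ∀ j < e, coord d e i j s = coord d e i j t) : s = t := by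
  rw [sum_coord s, sum_coord t]
  refine Finset.sum_congr rfl fun i hi => Finset.sum_congr rfl fun j hj => ?_
  rw [h i (Finset.mem_range.1 hi) j (Finset.mem_range.1 hj)]

theorem coord_eq_zero {d e i j : ℕ} (h : d ≤ i ∨ e ≤ j) (t : (Fin d → ℂ) ⊗[ℂ] (Fin e → ℂ)) :
    coord d e i j t = 0 := by
  have : coord d e i j = 0 := by
    refine ext_vec₂ fun a ha b hb => ?_
    rw [coord_vec _ _ ha hb, if_neg (by omega), LinearMap.zero_apply]
  rw [this, LinearMap.zero_apply]

theorem coord_sum {d e i j : ℕ} (hi : i < d) (hj : j < e) (c : ℕ → ℕ → ℂ) :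
    coord d e i j (∑ a ∈ Finset.range d, ∑ b ∈ Finset.range e, c a b • (vec d a ⊗ₜ vec e b))
      = c i j := by
  have : ∀ a ∈ Finset.range d, ∀ b ∈ Finset.range e,
      coord d e i j (c a b • (vec d a ⊗ₜ[ℂ] vec e b)) = if a = i ∧ b = j then c a b else 0 := by
    intro a ha b hb
    rw [map_smul, coord_vec _ _ (Finset.mem_range.1 ha) (Finset.mem_range.1 hb)]
    split_ifs <;> simp
  simp only [map_sum]
  rw [Finset.sum_congr rfl fun a ha => Finset.sum_congr rfl (this a ha),
    Finset.sum_eq_single i, Finset.sum_eq_single j]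
  · simp
  · intro b _ hb; simp [hb]
  · intro h; exact absurd (Finset.mem_range.2 hj) h
  · intro a _ ha; simp [ha]
  · intro h; exact absurd (Finset.mem_range.2 hi) h

end coord

/-! ### Coordinates of the action of E, F, K and H on a tensor product -/

namespace RootData

variable (r : RootData) {d e : ℕ} {l l' : ℂ} (h : r.qint d * r.qint (l - d + 1) = 0)
  (h' : r.qint e * r.qint (l' - e + 1) = 0)

include h h'

theorem coord_E (i j : ℕ) (t : (Fin d → ℂ) ⊗[ℂ] (Fin e → ℂ)) (hi : i < d) (hj : j < e) :
    coord d e i j (Rep.tensor r.q_ne_zero (r.hwRep d l h) (r.hwRep e l' h') (UqH.gen r.q .E) t)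
      = r.qint ((j : ℂ) + 1) * r.qint (l' - j) * coord d e i (j + 1) t
        + r.qint ((i : ℂ) + 1) * r.qint (l - i) * r.qp (l' - 2 * j) * coord d e (i + 1) j t := by
  refine LinearMap.congr_fun (f := coord d e i j ∘ₗ _) (g := (_ : ℂ) • coord d e i (j + 1)
    + (_ : ℂ) • coord d e (i + 1) j) (ext_vec₂ fun a ha b hb => ?_) t
  simp only [LinearMap.comp_apply, Rep.tensor_E, r.hwRep_E h ha.le, r.hwRep_E h' hb.le,
    r.hwRep_K h', map_add, TensorProduct.tmul_smul, ← TensorProduct.smul_tmul', map_smul,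
    LinearMap.add_apply, LinearMap.smul_apply]
  rw [coord_vec _ _ ha (by omega), coord_vec _ _ (by omega) hb, coord_vec _ _ ha hb,
    coord_vec _ _ ha hb]
  congr 1
  · rcases b with _ | b
    · simp [qint_zero]
    · simp only [Nat.add_sub_cancel, Nat.add_right_cancel_iff]
      split_ifs with hc
      · obtain ⟨rfl, rfl⟩ := hc
        simp only [smul_eq_mul, mul_one]
        push_cast
        congr 2
        ring
      · simp
  · rcases a with _ | a
    · simp [qint_zero]
    · simp only [Nat.add_sub_cancel, Nat.add_right_cancel_iff]
      split_ifs with hc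
      · obtain ⟨rfl, rfl⟩ := hc
        simp only [smul_eq_mul, mul_one]
        push_cast
        rw [show l - ((a : ℂ) + 1) + 1 = l - a by ring]
        ring
      · simp

theorem coord_H (i j : ℕ) (t : (Fin d → ℂ) ⊗[ℂ] (Fin e → ℂ)) :
    coord d e i j (Rep.tensor r.q_ne_zero (r.hwRep d l h) (r.hwRep e l' h') (UqH.gen r.q .H) t)
      = (l + l' - 2 * (i + j)) * coord d e i j t := by
  refine LinearMap.congr_fun (f := coord d e i j ∘ₗ _) (g := (_ : ℂ) • coord d e i j)
    (ext_vec₂ fun a ha b hb => ?_) t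
  simp only [LinearMap.comp_apply, Rep.tensor_H, r.hwRep_H h, r.hwRep_H h', map_add,
    TensorProduct.tmul_smul, ← TensorProduct.smul_tmul', map_smul, LinearMap.smul_apply]
  rw [coord_vec _ _ ha hb]
  split_ifs with hc
  · obtain ⟨rfl, rfl⟩ := hc
    simp only [smul_eq_mul, mul_one]
    ring
  · simp

theorem coord_K (i j : ℕ) (t : (Fin d → ℂ) ⊗[ℂ] (Fin e → ℂ)) :
    coord d e i j (Rep.tensor r.q_ne_zero (r.hwRep d l h) (r.hwRep e l' h') (UqH.gen r.q .K) t)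
      = r.qp (l + l' - 2 * (i + j)) * coord d e i j t := by
  refine LinearMap.congr_fun (f := coord d e i j ∘ₗ _) (g := (_ : ℂ) • coord d e i j)
    (ext_vec₂ fun a ha b hb => ?_) t
  simp only [LinearMap.comp_apply, Rep.tensor_K, r.hwRep_K h, r.hwRep_K h',
    TensorProduct.tmul_smul, ← TensorProduct.smul_tmul', map_smul, LinearMap.smul_apply]
  rw [coord_vec _ _ ha hb]
  split_ifs with hc
  · obtain ⟨rfl, rfl⟩ := hc
    simp only [smul_eq_mul, mul_one]
    rw [← qp_add]
    congr 1
    ring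
  · simp

theorem coord_F (i j : ℕ) (t : (Fin d → ℂ) ⊗[ℂ] (Fin e → ℂ)) (hi : i < d) (hj : j < e) :
    coord d e i j (Rep.tensor r.q_ne_zero (r.hwRep d l h) (r.hwRep e l' h') (UqH.gen r.q .F) t)
      = (if 1 ≤ j then r.qp (-(l - 2 * i)) * coord d e i (j - 1) t else 0)
        + if 1 ≤ i then coord d e (i - 1) j t else 0 := by
  -- At j = 0 the truncated j − 1 is again 0, so the coefficient has to vanish instead of the
  -- coordinate; likewise for i.
  refine LinearMap.congr_fun (f := coord d e i j ∘ₗ _)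
    (g := (if 1 ≤ j then r.qp (-(l - 2 * i)) else 0) • coord d e i (j - 1)
    + (if 1 ≤ i then (1 : ℂ) else 0) • coord d e (i - 1) j) (ext_vec₂ fun a ha b hb => ?_) t |>.trans ?_
  · simp only [LinearMap.comp_apply, Rep.tensor_F, r.hwRep_F h, r.hwRep_F h', r.hwRep_Kinv h,
      map_add, ← TensorProduct.smul_tmul', map_smul, LinearMap.add_apply, LinearMap.smul_apply]
    rw [coord_vec i (j - 1) ha hb, coord_vec (i - 1) j ha hb]
    congr 1
    · by_cases hb' : b + 1 < e
      · rw [coord_vec _ _ ha hb']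
        by_cases hc : a = i ∧ b + 1 = j
        · obtain ⟨rfl, rfl⟩ := hc
          simp
        · rw [if_neg hc]
          split_ifs <;> first | omega | simp
      · rw [vec_eq_zero (d := e) (by omega), TensorProduct.tmul_zero, map_zero]
        split_ifs <;> first | omega | simp
    · by_cases ha' : a + 1 < d
      · rw [coord_vec _ _ ha' hb]
        by_cases hc : a + 1 = i ∧ b = j
        · obtain ⟨rfl, rfl⟩ := hc
          simp
        · rw [if_neg hc]
          split_ifs <;> first | omega | simp
      · rw [vec_eq_zero (d := d) (by omega), TensorProduct.zero_tmul, map_zero]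
        split_ifs <;> first | omega | simp
  · simp only [LinearMap.add_apply, LinearMap.smul_apply, smul_eq_mul]
    split_ifs <;> simp

end RootData

namespace RootData

variable (r : RootData)

/-! ### Coefficients of the trivalent vertices -/

/-- The highest weight of `V_α`. -/
def hw (α : ℂ) : ℂ := α / r.k + r.N - 1

theorem kappa_eq (α : ℂ) (n : ℕ) : r.kappa α n =
    r.qp (-((n : ℂ) / 2) * r.hw α + (n : ℂ) * (n - 1) / 2)
      * ∏ t ∈ Finset.range n, r.qint (r.hw α - t) := rfl

theorem kappa_zero (α : ℂ) : r.kappa α 0 = 1 := by simp [kappa, qp_zero]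

theorem qbin_zero (x : ℂ) : r.qbin x 0 = 1 := by simp [qbin, brFact_zero]

theorem qbin_one (x : ℂ) : r.qbin x 1 = r.qint x := by
  simp [qbin, brFact, qint_eq]

theorem qbin_ne_zero {x : ℂ} {d : ℕ} (hd : d < r.N) (h : ∀ t < d, r.br (x - t) ≠ 0) :
    r.qbin x d ≠ 0 :=
  div_ne_zero (Finset.prod_ne_zero_iff.2 fun t ht => h t (Finset.mem_range.1 ht))
    (r.brFact_ne_zero hd)

theorem kappa_ne_zero {α : ℂ} {n : ℕ} (h : ∀ t < n, r.br (r.hw α - t) ≠ 0) :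
    r.kappa α n ≠ 0 :=
  mul_ne_zero (r.qp_ne_zero _) (Finset.prod_ne_zero_iff.2 fun t ht =>
    r.qint_ne_zero (h t (Finset.mem_range.1 ht)))

theorem kappa_succ (α : ℂ) (n : ℕ) : r.kappa α (n + 1)
    = r.kappa α n * (r.qp (-(r.hw α) / 2 + n) * r.qint (r.hw α - n)) := by
  rw [kappa_eq, kappa_eq, Finset.prod_range_succ,
    show -(((n + 1 : ℕ) : ℂ) / 2) * r.hw α + ((n + 1 : ℕ) : ℂ) * ((n + 1 : ℕ) - 1) / 2
      = (-((n : ℂ) / 2) * r.hw α + (n : ℂ) * (n - 1) / 2) + (-(r.hw α) / 2 + n) by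
        push_cast; ring, qp_add]
  ring

/-- The product of quantum integers in κ_{n+z} / κ_n is a falling factorial; written as {z}! times a
binomial it cancels against the binomials of `coefC`. -/
theorem kappa_add (α : ℂ) (n z : ℕ) (hz : z < r.N) : r.kappa α (n + z)
    = r.kappa α n * (r.qp (-((z : ℂ) / 2) * r.hw α + (z : ℂ) * (z - 1) / 2 + n * z)
        * (r.brFact z * r.qbin (r.hw α - n) z / r.br 1 ^ z)) := by
  have hb := r.brFact_ne_zero hz
  have e1 : r.brFact z * r.qbin (r.hw α - n) z / r.br 1 ^ z
      = ∏ t ∈ Finset.range z, r.qint (r.hw α - (n + t : ℕ)) := by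
    rw [qbin, mul_div_cancel₀ _ hb]
    rw [show r.br 1 ^ z = ∏ _t ∈ Finset.range z, r.br 1 by simp, ← Finset.prod_div_distrib]
    refine Finset.prod_congr rfl fun t _ => ?_
    rw [qint_eq]
    push_cast
    rw [sub_sub]
  rw [e1, kappa_eq, kappa_eq, Finset.prod_range_add,
    show -(((n + z : ℕ) : ℂ) / 2) * r.hw α + ((n + z : ℕ) : ℂ) * ((n + z : ℕ) - 1) / 2
      = (-((n : ℂ) / 2) * r.hw α + (n : ℂ) * (n - 1) / 2)
        + (-((z : ℂ) / 2) * r.hw α + (z : ℂ) * (z - 1) / 2 + n * z) by push_cast; ring, qp_add]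
  ring

section level

variable {α β γ : ℂ} {m : ℕ} (hm : (α + β - γ) / (2 * r.k) + ((r.N : ℂ) - 1) / 2 = m)

include hm

/-- This is the weight of the vectors v_i ⊗ v_j with i + j = m, the only ones that can occur in the
image of v_0. -/
theorem hw_level : r.hw γ = r.hw α + r.hw β - 2 * m := by
  have hk := r.k_ne_zero
  rw [hw, hw, hw, ← hm]
  field_simp
  ring

theorem coefC_eq_zero {i j n : ℕ} (h : i + j ≠ m + n) : r.coefC α β γ i j n = 0 := by
  rw [coefC, if_neg]
  rw [hm]
  intro h'
  have : ((i + j : ℕ) : ℂ) = (m + n : ℕ) := by push_cast; linear_combination h'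
  exact h (by exact_mod_cast this)

theorem coefC_eq {i j n : ℕ} (h : i + j = m + n) : r.coefC α β γ i j n =
    (-1) ^ (j + n)
      * r.qp (((j : ℂ) * (β / r.k - j) - (i : ℂ) * (α / r.k - i)) / 2)
      * (r.qbin (r.hw γ) n)⁻¹ * r.qbin (r.hw γ) (r.N - 1 - m)
      * ∑ p ∈ Finset.HasAntidiagonal.antidiagonal n,
          if p.1 ≤ i ∧ p.2 ≤ j then
            (-1) ^ p.1 * r.qp ((2 * (p.1 : ℂ) - n) * (γ / r.k - n) / 2)
              * r.qbin m (j - p.2)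
              * r.qbin (r.hw α - (i - p.1 : ℕ)) p.1
              * r.qbin (r.hw β - (j - p.2 : ℕ)) p.2
          else 0 := by
  have hc : (i : ℂ) + j = m + n := by exact_mod_cast h
  rw [coefC, if_pos (by rw [hm]; linear_combination hc), h,
    show r.N - 1 + n - (m + n) = r.N - 1 - m by omega]
  congr 1
  refine Finset.sum_congr rfl fun p _ => ?_
  split_ifs with hp
  · rw [Nat.cast_sub hp.1, Nat.cast_sub hp.2, hw, hw]
    rw [show (i : ℂ) + j - n = m by linear_combination hc,
      show α / r.k - i + p.1 + r.N - 1 = α / r.k + r.N - 1 - (i - p.1) by ring,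
      show β / r.k - j + p.2 + r.N - 1 = β / r.k + r.N - 1 - (j - p.2) by ring]
  · simp

theorem coefD_eq_zero {i j n : ℕ} (h : i + j ≠ m + n) : r.coefD α β γ i j n = 0 := by
  rw [coefD, r.coefC_eq_zero hm h, mul_zero]

theorem coefD_base {i j : ℕ} (h : i + j = m) : r.coefD α β γ i j 0 =
    (-1) ^ j * r.qp (((j : ℂ) * (β / r.k - j) - (i : ℂ) * (α / r.k - i)) / 2)
      * r.qbin (r.hw γ) (r.N - 1 - m) * r.qbin m j / (r.kappa α i * r.kappa β j) := by
  rw [coefD, r.coefC_eq hm (n := 0) (by omega)]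
  simp [kappa_zero, qbin_zero, qp_zero]
  ring

/-- The coefficients of `Fⁿ` applied to `∑ c_{i,j} v_i ⊗ v_j`. -/
theorem coefD_eq_sum {i j n : ℕ} (h : i + j = m + n) (hn : n < r.N)
    (hγ : r.qbin (r.hw γ) n ≠ 0) (hi : r.kappa α i ≠ 0) (hj : r.kappa β j ≠ 0) :
    r.coefD α β γ i j n = ∑ p ∈ Finset.HasAntidiagonal.antidiagonal n,
      if p.1 ≤ i ∧ p.2 ≤ j then
        r.brFact n / (r.brFact p.1 * r.brFact p.2)
          * r.qp ((p.1 : ℂ) * p.2 - p.2 * (r.hw α - 2 * ((i : ℂ) - p.1)))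
          * r.coefD α β γ (i - p.1) (j - p.2) 0
      else 0 := by
  -- The sum in C already has the shape of the q-binomial expansion of Fⁿ: terms match one by one,
  -- each up to a sign (`hsign`), a power of q (`hexp`) and the binomials produced by `kappa_add`.
  rw [coefD, r.coefC_eq hm h, ← mul_assoc, Finset.mul_sum]
  refine Finset.sum_congr rfl fun p hp => ?_
  obtain ⟨z, w⟩ := p
  rw [Finset.HasAntidiagonal.mem_antidiagonal] at hp
  simp only at hp ⊢
  split_ifs with hzw
  swap
  · simp
  obtain ⟨i₀, rfl⟩ : ∃ i₀, i = i₀ + z := ⟨i - z, by omega⟩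
  obtain ⟨j₀, rfl⟩ : ∃ j₀, j = j₀ + w := ⟨j - w, by omega⟩
  have e0 := r.coefD_base hm (i := i₀) (j := j₀) (by omega)
  have eγ := r.kappa_add γ 0 n hn
  have eα := r.kappa_add α i₀ z (by omega)
  have eβ := r.kappa_add β j₀ w (by omega)
  rw [zero_add, kappa_zero, one_mul, Nat.cast_zero, sub_zero, zero_mul, add_zero] at eγ
  rw [Nat.add_sub_cancel, Nat.add_sub_cancel, e0]
  have hz := r.brFact_ne_zero (d := z) (by omega)
  have hw' := r.brFact_ne_zero (d := w) (by omega)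
  have hb := r.br_one_ne_zero
  rw [eα] at hi ⊢
  rw [eβ] at hj ⊢
  rw [eγ]
  obtain ⟨hi0, hi1⟩ := mul_ne_zero_iff.1 hi
  obtain ⟨hj0, hj1⟩ := mul_ne_zero_iff.1 hj
  have hi2 := (div_ne_zero_iff.1 (mul_ne_zero_iff.1 hi1).2).1
  have hj2 := (div_ne_zero_iff.1 (mul_ne_zero_iff.1 hj1).2).1
  have hi3 := (mul_ne_zero_iff.1 hi2).2
  have hj3 := (mul_ne_zero_iff.1 hj2).2
  have hsign : ((-1 : ℂ)) ^ (j₀ + w + n) * (-1) ^ z = (-1) ^ j₀ := by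
    rw [← pow_add, ← hp, show j₀ + w + (z + w) + z = j₀ + 2 * (z + w) by ring, pow_add, pow_mul]
    norm_num
  have hexp : r.qp (-((n : ℂ) / 2) * r.hw γ + (n : ℂ) * (n - 1) / 2)
      * r.qp ((((j₀ + w : ℕ) : ℂ) * (β / r.k - (j₀ + w : ℕ))
          - ((i₀ + z : ℕ) : ℂ) * (α / r.k - (i₀ + z : ℕ))) / 2)
      * r.qp ((2 * (z : ℂ) - n) * (γ / r.k - n) / 2)
      = r.qp (-((z : ℂ) / 2) * r.hw α + (z : ℂ) * (z - 1) / 2 + i₀ * z)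
        * r.qp (-((w : ℂ) / 2) * r.hw β + (w : ℂ) * (w - 1) / 2 + j₀ * w)
        * (r.qp ((z : ℂ) * w - w * (r.hw α - 2 * (((i₀ + z : ℕ) : ℂ) - z)))
          * r.qp (((j₀ : ℂ) * (β / r.k - j₀) - (i₀ : ℂ) * (α / r.k - i₀)) / 2)) := by
    simp only [← qp_add]
    congr 1
    have h1 : γ / r.k = r.hw γ - r.N + 1 := by rw [hw]; ring
    have h2 : α / r.k = r.hw α - r.N + 1 := by rw [hw]; ring
    have h3 : β / r.k = r.hw β - r.N + 1 := by rw [hw]; ring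
    have h4 : (m : ℂ) = i₀ + j₀ := by
      have : m = i₀ + j₀ := by omega
      rw [this]; push_cast; ring
    rw [h1, h2, h3, r.hw_level hm, h4, ← hp]
    push_cast
    ring
  have hcn : r.br 1 ^ n = r.br 1 ^ z * r.br 1 ^ w := by rw [← pow_add, hp]
  rw [hcn]
  have q1 := r.qp_ne_zero (-((z : ℂ) / 2) * r.hw α + (z : ℂ) * (z - 1) / 2 + i₀ * z)
  have q2 := r.qp_ne_zero (-((w : ℂ) / 2) * r.hw β + (w : ℂ) * (w - 1) / 2 + j₀ * w)
  generalize r.qp (-((n : ℂ) / 2) * r.hw γ + (n : ℂ) * (n - 1) / 2) = a1 at *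
  generalize r.qp ((((j₀ + w : ℕ) : ℂ) * (β / r.k - (j₀ + w : ℕ))
          - ((i₀ + z : ℕ) : ℂ) * (α / r.k - (i₀ + z : ℕ))) / 2) = a2 at *
  generalize r.qp ((2 * (z : ℂ) - n) * (γ / r.k - n) / 2) = a3 at *
  generalize r.qp (-((z : ℂ) / 2) * r.hw α + (z : ℂ) * (z - 1) / 2 + i₀ * z) = b1 at *
  generalize r.qp (-((w : ℂ) / 2) * r.hw β + (w : ℂ) * (w - 1) / 2 + j₀ * w) = b2 at *
  generalize r.qp ((z : ℂ) * w - w * (r.hw α - 2 * (((i₀ + z : ℕ) : ℂ) - z))) = b3 at *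
  generalize r.qp (((j₀ : ℂ) * (β / r.k - j₀) - (i₀ : ℂ) * (α / r.k - i₀)) / 2) = b4 at *
  rw [← hsign]
  generalize ((-1 : ℂ)) ^ (j₀ + w + n) = s1
  generalize ((-1 : ℂ)) ^ z = s2
  generalize r.qbin (r.hw γ) n = Q1 at *
  generalize r.qbin (r.hw γ) (r.N - 1 - m) = Q2 at *
  generalize r.qbin (r.hw α - i₀) z = Q3 at *
  generalize r.qbin (r.hw β - j₀) w = Q4 at *
  generalize r.qbin m j₀ = Q5 at *
  have hA : a1 * a2 * a3 / (b1 * b2) = b3 * b4 := by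
    rw [hexp, mul_div_cancel_left₀ _ (mul_ne_zero q1 q2)]
  calc _ = (a1 * a2 * a3 / (b1 * b2)) * (s1 * s2 * r.brFact n * Q2 * Q5
        / (r.brFact z * r.brFact w * r.kappa α i₀ * r.kappa β j₀)) := by
        field_simp
    _ = _ := by
        rw [hA]
        ring

end level

/-- The coefficient of `v_i ⊗ v_j` in `Fⁿ (∑ c_{a,b} v_a ⊗ v_b)`, where the first tensor factor has
highest weight `l`. -/
def desc (l : ℂ) (c : ℕ → ℕ → ℂ) (i j n : ℕ) : ℂ :=
  ∑ p ∈ Finset.HasAntidiagonal.antidiagonal n,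
    if p.1 ≤ i ∧ p.2 ≤ j then
      r.brFact n / (r.brFact p.1 * r.brFact p.2)
        * r.qp ((p.1 : ℂ) * p.2 - p.2 * (l - 2 * ((i : ℂ) - p.1))) * c (i - p.1) (j - p.2)
    else 0

theorem desc_zero (l : ℂ) (c : ℕ → ℕ → ℂ) (i j : ℕ) : r.desc l c i j 0 = c i j := by
  simp [desc, brFact_zero, qp_zero]

theorem brFact_N : r.brFact r.N = 0 := by
  obtain ⟨n, hn⟩ : ∃ n, r.N = n + 1 := ⟨r.N - 1, by have := r.three_le; omega⟩
  have h := r.br_N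
  rw [hn] at h ⊢
  rw [brFact_succ]
  push_cast at h
  rw [h, mul_zero]

/-- The numerator {N}! contains {N} = 0: this is Fᴺ = 0 on the tensor product. -/
theorem desc_N (l : ℂ) (c : ℕ → ℕ → ℂ) (i j : ℕ) : r.desc l c i j r.N = 0 := by
  simp [desc, brFact_N]

theorem br_add_eq (z w : ℂ) : r.br (z + w) = r.br z * r.qp (-w) + r.br w * r.qp z := by
  simp only [br, qp_neg, qp_add, mul_inv]
  ring

/-- A q-Pascal rule: for z + w = n + 1, {n + 1} = {z} q^(−w) + {w} q^z splits each term in two, one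
part for each summand of ΔF. The bounds on i and j keep {z}! and {w}! invertible. -/
theorem desc_succ (l : ℂ) (c : ℕ → ℕ → ℂ) {i j : ℕ} (hi : i < r.N) (hj : j < r.N) (n : ℕ) :
    r.desc l c i j (n + 1) = (if 1 ≤ j then r.qp (-(l - 2 * i)) * r.desc l c i (j - 1) n else 0)
      + if 1 ≤ i then r.desc l c (i - 1) j n else 0 := by
  set T : ℕ × ℕ → ℂ := fun p => if p.1 ≤ i ∧ p.2 ≤ j then
      r.brFact n / (r.brFact p.1 * r.brFact p.2)
        * r.qp ((p.1 : ℂ) * p.2 - p.2 * (l - 2 * ((i : ℂ) - p.1))) * c (i - p.1) (j - p.2)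
    else 0 with hT
  have h1 : r.desc l c i j (n + 1)
      = ∑ p ∈ Finset.HasAntidiagonal.antidiagonal (n + 1), r.br p.2 * r.qp p.1 * T p
        + ∑ p ∈ Finset.HasAntidiagonal.antidiagonal (n + 1), r.br p.1 * r.qp (-p.2) * T p := by
    rw [desc, ← Finset.sum_add_distrib]
    refine Finset.sum_congr rfl fun p hp => ?_
    rw [Finset.HasAntidiagonal.mem_antidiagonal] at hp
    simp only [hT]
    split_ifs
    · rw [brFact_succ, show (n : ℂ) + 1 = p.1 + p.2 by exact_mod_cast hp.symm, br_add_eq]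
      ring
    · simp
  rw [h1, Finset.Nat.sum_antidiagonal_succ', Finset.Nat.sum_antidiagonal_succ]
  simp only [Nat.cast_zero, br_zero, zero_mul, zero_add]
  congr 1
  · split_ifs with hj1
    · rw [desc, Finset.mul_sum]
      refine Finset.sum_congr rfl fun p _ => ?_
      obtain ⟨z, w⟩ := p
      simp only [hT]
      by_cases hc : z ≤ i ∧ w + 1 ≤ j
      · rw [if_pos hc, if_pos ⟨hc.1, by omega⟩, brFact_succ,
          show j - (w + 1) = j - 1 - w by omega]
        have hb := r.br_nat_ne_zero (n := w + 1) (by omega) (by omega)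
        have hw' := r.brFact_ne_zero (d := w) (by omega)
        have hz' := r.brFact_ne_zero (d := z) (by omega)
        push_cast at hb ⊢
        have e : r.qp (z * ((w : ℂ) + 1) - ((w : ℂ) + 1) * (l - 2 * ((i : ℂ) - z))) * r.qp z
            = r.qp (-(l - 2 * i)) * r.qp (z * (w : ℂ) - w * (l - 2 * ((i : ℂ) - z))) := by
          rw [← qp_add, ← qp_add]
          congr 1
          ring
        calc _ = r.brFact n / (r.brFact z * r.brFact w)
              * (r.qp (z * ((w : ℂ) + 1) - ((w : ℂ) + 1) * (l - 2 * ((i : ℂ) - z))) * r.qp z)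
              * c (i - z) (j - 1 - w) := by field_simp
          _ = _ := by rw [e]; ring
      · rw [if_neg hc, if_neg (by omega), mul_zero, mul_zero]
    · refine Finset.sum_eq_zero fun p _ => ?_
      simp only [hT]
      rw [if_neg (by omega), mul_zero]
  · split_ifs with hi1
    · rw [desc]
      refine Finset.sum_congr rfl fun p _ => ?_
      obtain ⟨z, w⟩ := p
      simp only [hT]
      by_cases hc : z + 1 ≤ i ∧ w ≤ j
      · rw [if_pos hc, if_pos ⟨by omega, hc.2⟩, brFact_succ,
          show i - (z + 1) = i - 1 - z by omega]
        have hb := r.br_nat_ne_zero (n := z + 1) (by omega) (by omega)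
        have hw' := r.brFact_ne_zero (d := w) (by omega)
        have hz' := r.brFact_ne_zero (d := z) (by omega)
        rw [Nat.cast_sub hi1]
        push_cast at hb ⊢
        have e : r.qp (((z : ℂ) + 1) * w - w * (l - 2 * ((i : ℂ) - (z + 1)))) * r.qp (-w)
            = r.qp (z * (w : ℂ) - w * (l - 2 * ((i : ℂ) - 1 - z))) := by
          rw [← qp_add]
          congr 1
          ring
        calc _ = r.brFact n / (r.brFact z * r.brFact w)
              * (r.qp (((z : ℂ) + 1) * w - w * (l - 2 * ((i : ℂ) - (z + 1)))) * r.qp (-w))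
              * c (i - 1 - z) (j - w) := by field_simp
          _ = _ := by rw [e]
      · rw [if_neg hc, if_neg (by omega), mul_zero]
    · refine Finset.sum_eq_zero fun p _ => ?_
      simp only [hT]
      rw [if_neg (by omega), mul_zero]

/-! ### Linearity of the vertex V_γ → V_α ⊗ V_β -/

section level

variable {α β γ : ℂ} {m : ℕ} (hm : (α + β - γ) / (2 * r.k) + ((r.N : ℂ) - 1) / 2 = m)

include hm

theorem coefD_eq_desc {i j n : ℕ} (hn : n < r.N)
    (hγ : r.qbin (r.hw γ) n ≠ 0) (hi : r.kappa α i ≠ 0) (hj : r.kappa β j ≠ 0) :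
    r.coefD α β γ i j n = r.desc (r.hw α) (fun a b => r.coefD α β γ a b 0) i j n := by
  by_cases h : i + j = m + n
  · exact r.coefD_eq_sum hm h hn hγ hi hj
  · rw [r.coefD_eq_zero hm h, desc, Finset.sum_eq_zero]
    intro p hp
    rw [Finset.HasAntidiagonal.mem_antidiagonal] at hp
    split_ifs with hc
    · rw [r.coefD_eq_zero hm (by omega), mul_zero]
    · rfl

/-- The recursion that expresses that `∑ D_{i,j,0} v_i ⊗ v_j` is killed by `E`. -/
theorem coefD_hw {i j : ℕ} (hj : j + 1 < r.N) (hi : i + 1 < r.N)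
    (hα : ∀ t < r.N - 1, r.br (r.hw α - t) ≠ 0) (hβ : ∀ t < r.N - 1, r.br (r.hw β - t) ≠ 0) :
    r.qint ((j : ℂ) + 1) * r.qint (r.hw β - j) * r.coefD α β γ i (j + 1) 0
      + r.qint ((i : ℂ) + 1) * r.qint (r.hw α - i) * r.qp (r.hw β - 2 * j)
        * r.coefD α β γ (i + 1) j 0 = 0 := by
  by_cases h : i + j + 1 = m
  swap
  · rw [r.coefD_eq_zero hm (by omega), r.coefD_eq_zero hm (by omega), mul_zero, mul_zero, add_zero]
  rw [r.coefD_base hm (by omega), r.coefD_base hm (by omega), kappa_succ, kappa_succ]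
  have ha := r.qint_ne_zero (hα i (by omega))
  have hb := r.qint_ne_zero (hβ j (by omega))
  have hka := r.kappa_ne_zero (α := α) (n := i) fun t ht => hα t (by omega)
  have hkb := r.kappa_ne_zero (α := β) (n := j) fun t ht => hβ t (by omega)
  have hq1 := r.qp_ne_zero (-(r.hw α) / 2 + i)
  have hq2 := r.qp_ne_zero (-(r.hw β) / 2 + j)
  have hj1 : r.qint ((j : ℂ) + 1) ≠ 0 := by
    have := r.qint_ne_zero (r.br_nat_ne_zero (n := j + 1) (by omega) hj)
    exact_mod_cast this
  -- The ratio of consecutive binomials, where m − j = i + 1.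
  have e1 : r.qint ((j : ℂ) + 1) * r.qbin m (j + 1) = r.qint ((i : ℂ) + 1) * r.qbin m j := by
    have hb1 := r.brFact_ne_zero (d := j) (by omega)
    have hb2 : r.br ((j : ℂ) + 1) ≠ 0 := by
      have := r.br_nat_ne_zero (n := j + 1) (by omega) hj
      exact_mod_cast this
    rw [qbin, qbin, Finset.prod_range_succ, brFact_succ, qint_eq, qint_eq,
      show (i : ℂ) + 1 = m - j by rw [← h]; push_cast; ring]
    field_simp
  have e2 : r.qp ((((j + 1 : ℕ) : ℂ) * (β / r.k - (j + 1 : ℕ)) - (i : ℂ) * (α / r.k - i)) / 2)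
        * r.qp (-(r.hw α) / 2 + i)
      = r.qp (((j : ℂ) * (β / r.k - j) - ((i + 1 : ℕ) : ℂ) * (α / r.k - (i + 1 : ℕ))) / 2)
        * r.qp (-(r.hw β) / 2 + j) * r.qp (r.hw β - 2 * j) := by
    simp only [← qp_add]
    -- The exponents differ by −N, which the power of q does not see.
    refine r.qp_congr (-2) ?_
    rw [hw, hw]
    push_cast
    ring
  generalize r.qp ((((j + 1 : ℕ) : ℂ) * (β / r.k - (j + 1 : ℕ)) - (i : ℂ) * (α / r.k - i)) / 2)
    = a1 at *
  generalize r.qp (((j : ℂ) * (β / r.k - j) - ((i + 1 : ℕ) : ℂ) * (α / r.k - (i + 1 : ℕ))) / 2)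
    = a2 at *
  generalize r.qp (-(r.hw α) / 2 + i) = a3 at *
  generalize r.qp (-(r.hw β) / 2 + j) = a4 at *
  generalize r.qp (r.hw β - 2 * j) = a5 at *
  rw [pow_succ]
  field_simp
  linear_combination (-1) ^ j * r.qbin (r.hw γ) (r.N - 1 - m)
    * (-(a1 * a3) * e1 - r.qint (i + 1) * r.qbin m j * e2)

/-- The vertex `V_γ → V_α ⊗ V_β` at level `m`, without a change of colour. -/
theorem isHom_lin_coefD (hmN : m < r.N) (hα : ∀ t < r.N - 1, r.br (r.hw α - t) ≠ 0)
    (hβ : ∀ t < r.N - 1, r.br (r.hw β - t) ≠ 0) (hγ : ∀ t < r.N - 1, r.br (r.hw γ - t) ≠ 0) :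
    IsHom (r.V γ) (Rep.tensor r.q_ne_zero (r.V α) (r.V β))
      (lin r.N fun n => ∑ i ∈ Finset.range r.N, ∑ j ∈ Finset.range r.N,
        r.coefD α β γ i j n • (vec r.N i ⊗ₜ[ℂ] vec r.N j)) := by
  have hN := r.three_le
  set w : ℕ → (Fin r.N → ℂ) ⊗[ℂ] (Fin r.N → ℂ) := fun n =>
    ∑ i ∈ Finset.range r.N, ∑ j ∈ Finset.range r.N,
      r.desc (r.hw α) (fun a b => r.coefD α β γ a b 0) i j n • (vec r.N i ⊗ₜ[ℂ] vec r.N j) with hw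
  have hcw : ∀ {i j : ℕ} (n : ℕ), i < r.N → j < r.N → coord r.N r.N i j (w n)
      = r.desc (r.hw α) (fun a b => r.coefD α β γ a b 0) i j n := fun n hi hj => coord_sum hi hj _
  have hlin : (lin r.N fun n => ∑ i ∈ Finset.range r.N, ∑ j ∈ Finset.range r.N,
      r.coefD α β γ i j n • (vec r.N i ⊗ₜ[ℂ] vec r.N j)) = lin r.N w := by
    refine ext_vec fun n hn => ?_
    rw [lin_vec _ hn, lin_vec _ hn, hw]
    refine Finset.sum_congr rfl fun i hi => Finset.sum_congr rfl fun j hj => ?_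
    rw [Finset.mem_range] at hi hj
    rw [r.coefD_eq_desc hm hn (r.qbin_ne_zero hn fun t ht => hγ t (by omega))
      (r.kappa_ne_zero fun t ht => hα t (by omega)) (r.kappa_ne_zero fun t ht => hβ t (by omega))]
  rw [hlin]
  have hlevel := r.hw_level hm
  refine r.isHom_lin_of_hw (l := r.hw γ) (by rw [qint_N, zero_mul]) (fun n hn => ?_) ?_ ?_ ?_ ?_
  · refine coord_ext fun i hi j hj => ?_
    refine (r.coord_F _ _ i j (w n) hi hj).trans ?_
    rw [hcw (n + 1) hi hj, r.desc_succ _ _ hi hj n, hcw n (by omega) hj, hcw n hi (by omega)]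
    rfl
  · simp only [hw, desc_N, zero_smul, Finset.sum_const_zero]
  · refine coord_ext fun i hi j hj => ?_
    refine (r.coord_E _ _ i j (w 0) hi hj).trans ?_
    rw [map_zero]
    -- On the diagonal i + j + 1 = m, the bound m < N keeps i + 1 and j + 1 below N, as `coefD_hw`
    -- requires; elsewhere both coordinates are off the level.
    by_cases h : i + j + 1 = m
    · rw [hcw 0 hi (by omega), hcw 0 (by omega) hj, desc_zero, desc_zero]
      exact r.coefD_hw hm (by omega) (by omega) hα hβ
    · have h0 : ∀ a b, a + b ≠ m → coord r.N r.N a b (w 0) = 0 := by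
        intro a b hab
        by_cases hc : a < r.N ∧ b < r.N
        · rw [hcw 0 hc.1 hc.2, desc_zero, r.coefD_eq_zero hm (by omega)]
        · exact coord_eq_zero (by omega) _
      rw [h0 _ _ (by omega), h0 _ _ (by omega), mul_zero, mul_zero, add_zero]
  · refine coord_ext fun i hi j hj => ?_
    refine (r.coord_K _ _ i j (w 0)).trans ?_
    rw [map_smul, hcw 0 hi hj, desc_zero, smul_eq_mul]
    by_cases h : i + j = m
    · have : (i : ℂ) + j = m := by exact_mod_cast h
      rw [this, hlevel]
      rfl
    · rw [r.coefD_eq_zero hm (by omega), mul_zero, mul_zero]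
  · refine coord_ext fun i hi j hj => ?_
    refine (r.coord_H _ _ i j (w 0)).trans ?_
    rw [map_smul, hcw 0 hi hj, desc_zero, smul_eq_mul]
    by_cases h : i + j = m
    · have : (i : ℂ) + j = m := by exact_mod_cast h
      rw [this, hlevel]
      rfl
    · rw [r.coefD_eq_zero hm (by omega), mul_zero, mul_zero]

end level

end RootData

namespace RootData

variable (r : RootData)

/-! ### The vertices with an edge of colour `S₁` -/

theorem hw_add_int (α : ℂ) (ε : ℤ) : r.hw (α + ε * r.k) = r.hw α + ε := by
  have hk := r.k_ne_zero
  rw [hw, hw, add_div, mul_div_cancel_right₀ _ hk]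
  ring

theorem div_k (α : ℂ) : α / r.k = r.hw α - r.N + 1 := by rw [hw]; ring

/-- In V_{k(N−2)} the vectors v_{N−2} and v_{N−1} have weights 1 and −1 and span a copy of S₁, which
is why e_ν carries the index N − 2 + ν. -/
theorem hw_S : r.hw (r.k * (r.N - 2)) = 2 * r.N - 3 := by
  rw [hw, mul_div_cancel_left₀ _ r.k_ne_zero]; ring

theorem qbin_succ (x : ℂ) {d : ℕ} (hd : d + 1 < r.N) :
    r.br ((d : ℂ) + 1) * r.qbin x (d + 1) = r.br (x - d) * r.qbin x d := by
  have hb1 := r.brFact_ne_zero (d := d) (by omega)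
  have hb2 : r.br ((d : ℂ) + 1) ≠ 0 := by
    have := r.br_nat_ne_zero (n := d + 1) (by omega) hd
    exact_mod_cast this
  rw [qbin, qbin, Finset.prod_range_succ, brFact_succ]
  field_simp

theorem qbin_self {d : ℕ} (hd : d < r.N) : r.qbin d d = 1 := by
  rw [qbin, div_eq_one_iff_eq (r.brFact_ne_zero hd), brFact, ← Finset.prod_range_reflect]
  refine Finset.prod_congr rfl fun t ht => ?_
  rw [Finset.mem_range] at ht
  congr 1
  rw [Nat.cast_sub (by omega), Nat.cast_sub (by omega)]
  push_cast
  ring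

theorem qbin_eq_zero {x : ℂ} {d t : ℕ} (ht : t < d) (h : r.br (x - t) = 0) : r.qbin x d = 0 := by
  rw [qbin, Finset.prod_eq_zero (Finset.mem_range.2 ht) h, zero_div]

theorem qint_N_sub_one : r.qint (r.N - 1) = -1 := by
  rw [r.qint_congr (y := -1) 2 (by push_cast; ring), qint_neg, qint_one]

theorem qbin_N_sub_one : r.qbin (r.N - 1) (r.N - 2) = -1 := by
  have hN := r.three_le
  have h1 := r.qbin_succ (r.N - 1 : ℕ) (d := r.N - 2) (by omega)
  rw [show r.N - 2 + 1 = r.N - 1 by omega, r.qbin_self (by omega), Nat.cast_sub (by omega),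
    Nat.cast_sub (by omega), mul_one] at h1
  push_cast at h1
  rw [show (r.N : ℂ) - 1 - (r.N - 2) = 1 by ring,
    r.br_congr (y := -1) 2 (by push_cast; ring), br_neg] at h1
  apply mul_left_cancel₀ r.br_one_ne_zero
  rw [← h1]
  ring

theorem neg_one_pow_N : (-1 : ℂ) ^ r.N = -1 := r.odd.neg_one_pow

/-- Among the arguments 2N − 3 − t with t < N − 1 only t = N − 3 gives a multiple of N, and that
factor is left out. -/
theorem kappaS_ne_zero {ν : ℕ} (hν : ν < 2) : r.kappaS ν ≠ 0 := by
  have hN := r.three_le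
  refine mul_ne_zero (r.qp_ne_zero _) (Finset.prod_ne_zero_iff.2 fun t ht => ?_)
  rw [Finset.mem_erase, Finset.mem_range] at ht
  have h := r.br_int_ne_zero (n := 2 * r.N - 3 - t) (by
    intro hd
    obtain ⟨c, hc⟩ := (dvd_sub_self_left (a := (r.N : ℤ)) (b := r.N - 3 - t)).1 (by
      rw [show (r.N : ℤ) - (r.N - 3 - t) = 3 + t by ring]
      have := (dvd_mul_right (r.N : ℤ) 2).sub hd
      rwa [show (r.N : ℤ) * 2 - (2 * r.N - 3 - t) = 3 + t by ring] at this)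
    have h1 : ((r.N : ℤ) - 3 - t).natAbs < r.N := by omega
    have h2 := Int.eq_zero_of_dvd_of_natAbs_lt_natAbs ⟨c, hc⟩ (by simpa using h1)
    omega)
  push_cast at h
  exact r.qint_ne_zero h

/-- The product for ν = 1 has one more factor, at t = N − 2, namely [N − 1] = −1. -/
theorem kappaS_one : r.kappaS 1 = -(r.qp (-1 / 2) * r.kappaS 0) := by
  have hN := r.three_le
  rw [kappaS, kappaS, show Finset.range (r.N - 2 + 1) = insert (r.N - 2) (Finset.range (r.N - 2 + 0))
    from by rw [Finset.range_add_one, add_zero], Finset.erase_insert_of_ne (by omega),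
    Finset.prod_insert (by simp), Nat.cast_add, Nat.cast_add, Nat.cast_sub (by omega)]
  rw [show (2 * (r.N : ℂ) - 3 - ((r.N : ℂ) - (2 : ℕ))) = r.N - 1 by push_cast; ring, qint_N_sub_one]
  have e : r.qp (-(((r.N : ℂ) - (2 : ℕ) + (1 : ℕ)) / 2) * (2 * r.N - 3)
      + ((r.N : ℂ) - (2 : ℕ) + (1 : ℕ)) * ((r.N : ℂ) - (2 : ℕ) + (1 : ℕ) - 1) / 2)
      = r.qp (-1 / 2) * r.qp (-(((r.N : ℂ) - (2 : ℕ) + (0 : ℕ)) / 2) * (2 * r.N - 3)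
      + ((r.N : ℂ) - (2 : ℕ) + (0 : ℕ)) * ((r.N : ℂ) - (2 : ℕ) + (0 : ℕ) - 1) / 2) := by
    rw [← qp_add]
    congr 1
    push_cast
    ring
  rw [e]
  ring

/-- When one colour of C stands for the two-dimensional S₁, only the terms w = 0 and w = 1
contribute. -/
theorem sum_antidiagonal_of_small {f : ℕ × ℕ → ℂ} {n : ℕ}
    (h : ∀ z w, z + w = n → 2 ≤ w → f (z, w) = 0) :
    ∑ p ∈ Finset.HasAntidiagonal.antidiagonal n, f p
      = f (n, 0) + if 1 ≤ n then f (n - 1, 1) else 0 := by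
  rcases n with _ | n
  · simp
  · rw [Finset.Nat.sum_antidiagonal_succ', Finset.sum_eq_single (n, 0)]
    · simp
    · rintro ⟨z, w⟩ hp hne
      rw [Finset.HasAntidiagonal.mem_antidiagonal] at hp
      simp only at hp
      rcases w with _ | w
      · exact absurd (by rw [Prod.mk.injEq]; omega) hne
      · exact h _ _ (by omega) (by omega)
    · intro hn
      exact absurd (Finset.HasAntidiagonal.mem_antidiagonal.2 (add_zero n)) hn

theorem level_emit (ε : ℤ) (α : ℂ) {m : ℕ} (h : (2 * m : ℂ) = 2 * r.N - 3 - ε) :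
    (α + r.k * (r.N - 2) - (α + ε * r.k)) / (2 * r.k) + ((r.N : ℂ) - 1) / 2 = m := by
  have hk := r.k_ne_zero
  field_simp
  linear_combination (-r.k) * h

/-- The quantum binomials that kill all but one or two terms of `C` when one of the colours is
`k (N - 2)`. -/
theorem qbin_S_eq_zero {ν w : ℕ} (h : ν < w) (hw' : w ≤ r.N - 2 + ν) :
    r.qbin (r.hw (r.k * (r.N - 2)) - (r.N - 2 + ν - w : ℕ)) w = 0 := by
  have hN := r.three_le
  -- The factor with this index is {N} = 0.
  refine r.qbin_eq_zero (t := w - 1 - ν) (by omega) ?_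
  rw [hw_S, Nat.cast_sub hw', Nat.cast_add, Nat.cast_sub (by omega), Nat.sub_sub,
    Nat.cast_sub (by omega),
    r.br_congr (y := 0) 2 (by push_cast; ring), br_zero]

theorem qbin_succ' (x : ℂ) {d : ℕ} (hd : d + 1 < r.N) :
    r.br ((d : ℂ) + 1) * r.qbin x (d + 1) = r.br x * r.qbin (x - 1) d := by
  have hb1 := r.brFact_ne_zero (d := d) (by omega)
  have hb2 : r.br ((d : ℂ) + 1) ≠ 0 := by
    have := r.br_nat_ne_zero (n := d + 1) (by omega) hd
    exact_mod_cast this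
  rw [qbin, qbin, Finset.prod_range_succ', brFact_succ]
  have e : ∀ t ∈ Finset.range d, r.br (x - (t + 1 : ℕ)) = r.br (x - 1 - t) := fun t _ => by
    congr 1; push_cast; ring
  rw [Finset.prod_congr rfl e, Nat.cast_zero, sub_zero]
  field_simp

theorem neg_one_pow_sub_two : (-1 : ℂ) ^ (r.N - 2) = -1 := by
  have h := r.neg_one_pow_N
  rw [show r.N = r.N - 2 + 2 by have := r.three_le; omega, pow_add] at h
  simpa using h

/-! ### The vertex V_{α+εk} → V_α ⊗ S₁ -/

section emit

variable {α : ℂ}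

/-- `qbin_S_eq_zero` kills every w > ν. What remains is w = 0 and, for ν = 1 only, w = 1, whose
binomial is [N − 1] = −1. -/
theorem coefDS_eq (ε : ℤˣ) {m i ν n : ℕ} (h2m : (2 * m : ℂ) = 2 * r.N - 3 - (ε : ℤ))
    (hν : ν < 2) (h : i + (r.N - 2 + ν) = m + n) :
    r.coefDS ε α i ν n = r.kappa (α + (ε : ℤ) * r.k) n / (r.kappa α i * r.kappaS ν)
      * (-(-1) ^ ν * (-1) ^ n
        * r.qp ((-((r.N - 2 + ν) * ν) - i * (r.hw α - r.N + 1 - i)) / 2)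
        * (r.qbin (r.hw α + (ε : ℤ)) n)⁻¹ * r.qbin (r.hw α + (ε : ℤ)) (r.N - 1 - m)
        * ((if n ≤ i then (-1) ^ n * r.qp (n * (r.hw α + (ε : ℤ) - r.N + 1 - n) / 2)
              * r.qbin m (r.N - 2 + ν) * r.qbin (r.hw α - (i - n : ℕ)) n else 0)
          + if 1 ≤ n ∧ n - 1 ≤ i ∧ ν = 1 then
              (-1) ^ n * r.qp (((n : ℂ) - 2) * (r.hw α + (ε : ℤ) - r.N + 1 - n) / 2)
              * r.qbin m (r.N - 2) * r.qbin (r.hw α - (i - (n - 1) : ℕ)) (n - 1)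
            else 0)) := by
  have hN := r.three_le
  have hz : ∀ w, ν < w → w ≤ r.N - 2 + ν →
      r.qbin (r.hw (r.k * (r.N - 2)) - (r.N - 2 + ν - w : ℕ)) w = 0 :=
    fun w h1 h2 => r.qbin_S_eq_zero h1 h2
  rw [coefDS, r.coefC_eq (r.level_emit ε α h2m) h, sum_antidiagonal_of_small, hw_add_int,
    pow_add, pow_add, neg_one_pow_sub_two, div_k, div_k, div_k, hw_add_int]
  rotate_left
  · intro z w hzw hw2
    dsimp only
    split_ifs with h2
    · rw [hz w (by omega) h2.2, mul_zero]
    · rfl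
  congr 2
  · congr 1
    congr 1
    · congr 1
      · ring
      · congr 1
        rw [hw_S, Nat.cast_add, Nat.cast_sub (by omega)]
        push_cast
        ring
  · congr 1
    · dsimp only
      simp only [Nat.zero_le, and_true, Nat.sub_zero, qbin_zero, mul_one]
      refine if_congr Iff.rfl ?_ rfl
      congr 4
      ring
    · by_cases h1 : 1 ≤ n
      · rw [if_pos h1]
        dsimp only
        by_cases hν1 : ν = 1
        · subst hν1
          by_cases h3 : n - 1 ≤ i
          · rw [if_pos ⟨h3, by omega⟩, if_pos ⟨h1, h3, rfl⟩, Nat.add_sub_cancel, hw_S, qbin_one,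
              Nat.cast_sub (show 2 ≤ r.N by omega), Nat.cast_sub h1, Nat.cast_one,
              show (2 * r.N - 3 - ((r.N : ℂ) - (2 : ℕ))) = r.N - 1 by push_cast; ring,
              qint_N_sub_one, show (2 * ((n : ℂ) - 1) - n) = n - 2 by ring]
            obtain ⟨c, rfl⟩ : ∃ c, n = c + 1 := ⟨n - 1, by omega⟩
            rw [Nat.add_sub_cancel, pow_succ]
            ring
          · rw [if_neg (by omega), if_neg (by omega)]
        · rw [if_neg (show ¬(1 ≤ n ∧ n - 1 ≤ i ∧ ν = 1) by omega)]
          split_ifs with h2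
          · rw [hz 1 (by omega) h2.2, mul_zero]
          · rfl
      · rw [if_neg h1, if_neg (by omega)]

theorem kappa_eq_qbin (α : ℂ) {n : ℕ} (hn : n < r.N) : r.kappa α n
    = r.qp (-((n : ℂ) / 2) * r.hw α + (n : ℂ) * (n - 1) / 2)
      * (r.brFact n * r.qbin (r.hw α) n / r.br 1 ^ n) := by
  have e1 := r.kappa_add α 0 n hn
  rwa [zero_add, kappa_zero, one_mul, Nat.cast_zero, sub_zero, zero_mul, add_zero] at e1

/-- For ε = 1 the level is N − 2. The quotient of the κ's cancels all that depends on n, so the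
coefficient is constant in n; the same scalar appears for ν = 1 in `coefDS_pos_one`. -/
theorem coefDS_pos_zero {n : ℕ} (hn : n < r.N) (hα : ∀ t < r.N - 1, r.br (r.hw α - t) ≠ 0)
    (hγ : ∀ t < r.N - 1, r.br (r.hw α + 1 - t) ≠ 0) :
    r.coefDS 1 α n 0 n = -(r.qint (r.hw α + 1) / r.kappaS 0) := by
  have hN := r.three_le
  rw [r.coefDS_eq 1 (m := r.N - 2) (by rw [Nat.cast_sub (by omega)]; push_cast; ring) (by omega)
    (by omega), r.kappa_eq_qbin _ hn, r.kappa_eq_qbin α hn, hw_add_int, if_pos le_rfl,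
    if_neg (by omega), Nat.sub_self, add_zero, show r.N - 2 + 0 = r.N - 2 from rfl, r.qbin_self (d := r.N - 2) (by omega),
    show r.N - 1 - (r.N - 2) = 1 by omega, qbin_one]
  have hb := r.brFact_ne_zero hn
  have hc := r.br_one_ne_zero
  have h1 := r.qbin_ne_zero hn fun t ht => hα t (by omega)
  have h2 := r.qbin_ne_zero hn fun t ht => hγ t (by omega)
  have h3 := r.kappaS_ne_zero (ν := 0) (by omega)
  have hs : (-1 : ℂ) ^ n * (-1) ^ n = 1 := by rw [← mul_pow]; norm_num
  have hexp : r.qp (-((n : ℂ) / 2) * (r.hw α + 1) + (n : ℂ) * (n - 1) / 2)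
      * r.qp ((-((r.N - 2 + (0 : ℕ)) * (0 : ℕ)) - n * (r.hw α - r.N + 1 - n)) / 2)
      * r.qp (n * (r.hw α + 1 - r.N + 1 - n) / 2)
      = r.qp (-((n : ℂ) / 2) * r.hw α + (n : ℂ) * (n - 1) / 2) := by
    simp only [← qp_add]
    congr 1
    push_cast
    ring
  have q1 := r.qp_ne_zero (-((n : ℂ) / 2) * r.hw α + (n : ℂ) * (n - 1) / 2)
  simp only [Units.val_one, Int.cast_one, pow_zero, Nat.cast_zero, sub_zero] at *
  generalize r.qp (-((n : ℂ) / 2) * (r.hw α + 1) + (n : ℂ) * (n - 1) / 2) = a1 at *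
  generalize r.qp ((-((r.N - 2 + 0) * 0) - n * (r.hw α - r.N + 1 - n)) / 2) = a2 at *
  generalize r.qp (n * (r.hw α + 1 - r.N + 1 - n) / 2) = a3 at *
  generalize r.qp (-((n : ℂ) / 2) * r.hw α + (n : ℂ) * (n - 1) / 2) = a4 at *
  field_simp
  linear_combination r.qint (r.hw α + 1) * ((-a1 * a2 * a3) * hs - hexp)

theorem coefDS_pos_one {n : ℕ} (hn : n + 1 < r.N) (hα : ∀ t < r.N - 1, r.br (r.hw α - t) ≠ 0)
    (hγ : ∀ t < r.N - 1, r.br (r.hw α + 1 - t) ≠ 0) :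
    r.coefDS 1 α n 1 (n + 1) = -(r.qint (r.hw α + 1) / r.kappaS 0)
      * (r.qp (n - r.hw α) * r.qint ((n : ℂ) + 1)) := by
  have hN := r.three_le
  rw [r.coefDS_eq 1 (m := r.N - 2) (by rw [Nat.cast_sub (by omega)]; push_cast; ring) (by omega)
    (by omega), r.kappa_eq_qbin _ hn, r.kappa_eq_qbin α (by omega), hw_add_int, if_neg (by omega),
    if_pos ⟨by omega, by omega, rfl⟩, Nat.add_sub_cancel, Nat.sub_self, zero_add,
    r.qbin_self (d := r.N - 2) (by omega),
    show r.N - 1 - (r.N - 2) = 1 by omega, qbin_one, kappaS_one, brFact_succ,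
    r.qint_eq ((n : ℂ) + 1)]
  have hb := r.brFact_ne_zero (d := n) (by omega)
  have hc := r.br_one_ne_zero
  have h1 := r.qbin_ne_zero (x := r.hw α) (d := n) (by omega) fun t ht => hα t (by omega)
  have h2 := r.qbin_ne_zero hn fun t ht => hγ t (by omega)
  have h3 := r.kappaS_ne_zero (ν := 0) (by omega)
  have hs : (-1 : ℂ) ^ n * (-1) ^ n = 1 := by rw [← mul_pow]; norm_num
  have hexp : r.qp (-(((n + 1 : ℕ) : ℂ) / 2) * (r.hw α + 1) + ((n + 1 : ℕ) : ℂ) * ((n + 1 : ℕ) - 1) / 2)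
      * r.qp ((-((r.N - 2 + (1 : ℕ)) * (1 : ℕ)) - n * (r.hw α - r.N + 1 - n)) / 2)
      * r.qp ((((n + 1 : ℕ) : ℂ) - 2) * (r.hw α + 1 - r.N + 1 - (n + 1 : ℕ)) / 2)
      = r.qp (-((n : ℂ) / 2) * r.hw α + (n : ℂ) * (n - 1) / 2) * r.qp (-1 / 2)
        * r.qp (n - r.hw α) := by
    simp only [← qp_add]
    refine r.qp_congr 0 ?_
    push_cast
    ring
  have q1 := r.qp_ne_zero (-((n : ℂ) / 2) * r.hw α + (n : ℂ) * (n - 1) / 2)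
  have q2 := r.qp_ne_zero (-1 / 2)
  simp only [Units.val_one, Int.cast_one] at *
  generalize r.qp (-(((n + 1 : ℕ) : ℂ) / 2) * (r.hw α + 1)
    + ((n + 1 : ℕ) : ℂ) * ((n + 1 : ℕ) - 1) / 2) = a1 at *
  generalize r.qp ((-((r.N - 2 + (1 : ℕ)) * (1 : ℕ)) - n * (r.hw α - r.N + 1 - n)) / 2) = a2 at *
  generalize r.qp ((((n + 1 : ℕ) : ℂ) - 2) * (r.hw α + 1 - r.N + 1 - (n + 1 : ℕ)) / 2) = a3 at *
  generalize r.qp (-((n : ℂ) / 2) * r.hw α + (n : ℂ) * (n - 1) / 2) = a4 at *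
  generalize r.qp (-1 / 2) = a5 at *
  generalize r.qp (n - r.hw α) = a6 at *
  simp only [pow_succ, pow_zero, Nat.cast_zero, sub_zero, one_mul]
  field_simp
  linear_combination r.br ((n : ℂ) + 1) * r.qint (r.hw α + 1) * ((-a1 * a2 * a3) * hs - hexp)

theorem kappa_one (α : ℂ) : r.kappa α 1 = r.qp (-(r.hw α) / 2) * r.qint (r.hw α) := by
  have h := r.kappa_succ α 0
  rwa [zero_add, kappa_zero, one_mul, Nat.cast_zero, add_zero, sub_zero] at h

theorem coefDS_neg_zero {n : ℕ} (hn : n + 1 < r.N) (hα : ∀ t < r.N - 1, r.br (r.hw α - t) ≠ 0)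
    (hγ : ∀ t < r.N - 1, r.br (r.hw α - 1 - t) ≠ 0) :
    r.coefDS (-1) α (n + 1) 0 n = 1 / (r.qint (r.hw α) * r.kappaS 0) := by
  have hN := r.three_le
  have e1 := r.kappa_add α 1 n (by omega)
  rw [add_comm 1 n, kappa_one, Nat.cast_one] at e1
  rw [r.coefDS_eq (-1) (m := r.N - 1) (by rw [Nat.cast_sub (by omega)]; push_cast; ring) (by omega)
    (by omega), r.kappa_eq_qbin _ (by omega), e1, hw_add_int, if_pos (by omega),
    if_neg (by omega), Nat.add_sub_cancel_left, add_zero, add_zero, Nat.cast_sub (by omega),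
    Nat.cast_one, qbin_N_sub_one, Nat.sub_self, qbin_zero]
  have hb := r.brFact_ne_zero (d := n) (by omega)
  have hc := r.br_one_ne_zero
  have h0 := r.qint_ne_zero (hα 0 (by omega))
  have h1 := r.qbin_ne_zero (x := r.hw α - 1) (d := n) (by omega) fun t ht => hγ t (by omega)
  have h3 := r.kappaS_ne_zero (ν := 0) (by omega)
  have hs : (-1 : ℂ) ^ n * (-1) ^ n = 1 := by rw [← mul_pow]; norm_num
  have hexp : r.qp (-((n : ℂ) / 2) * (r.hw α - 1) + (n : ℂ) * (n - 1) / 2)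
      * r.qp ((-((r.N - 2 + (0 : ℕ)) * (0 : ℕ)) - (n + 1 : ℕ) * (r.hw α - r.N + 1 - (n + 1 : ℕ))) / 2)
      * r.qp (n * (r.hw α - 1 - r.N + 1 - n) / 2)
      = r.qp (-(r.hw α) / 2) * r.qp (-((n : ℂ) / 2) * r.hw α + (n : ℂ) * (n - 1) / 2 + 1 * n) := by
    simp only [← qp_add]
    refine r.qp_congr 1 ?_
    push_cast
    ring
  have q1 := r.qp_ne_zero (-((n : ℂ) / 2) * r.hw α + (n : ℂ) * (n - 1) / 2 + 1 * n)
  have q2 := r.qp_ne_zero (-(r.hw α) / 2)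
  simp only [Units.val_neg, Units.val_one, Int.cast_neg, Int.cast_one, Nat.cast_zero, sub_zero,
    pow_zero, ← sub_eq_add_neg] at *
  generalize r.qp (-((n : ℂ) / 2) * (r.hw α - 1) + (n : ℂ) * (n - 1) / 2) = a1 at *
  generalize r.qp ((-((r.N - 2 + 0) * 0) - (n + 1 : ℕ) * (r.hw α - r.N + 1 - (n + 1 : ℕ))) / 2) = a2 at *
  generalize r.qp (n * (r.hw α - 1 - r.N + 1 - n) / 2) = a3 at *
  generalize r.qp (-((n : ℂ) / 2) * r.hw α + (n : ℂ) * (n - 1) / 2 + 1 * n) = a4 at *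
  generalize r.qp (-(r.hw α) / 2) = a5 at *
  field_simp
  linear_combination (a1 * a2 * a3) * hs + hexp

theorem coefDS_neg_one {n : ℕ} (hn : n < r.N) (hα : ∀ t < r.N - 1, r.br (r.hw α - t) ≠ 0)
    (hγ : ∀ t < r.N - 1, r.br (r.hw α - 1 - t) ≠ 0) :
    r.coefDS (-1) α n 1 n = -(1 / (r.qint (r.hw α) * r.kappaS 0))
      * (r.qp (n + 1) * r.qint (r.hw α - n)) := by
  have hN := r.three_le
  rw [r.coefDS_eq (-1) (m := r.N - 1) (by rw [Nat.cast_sub (by omega)]; push_cast; ring) (by omega)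
    (by omega), r.kappa_eq_qbin _ hn, r.kappa_eq_qbin α hn, hw_add_int, if_pos (by omega),
    Nat.sub_self, Nat.sub_self, qbin_zero, show r.N - 2 + 1 = r.N - 1 by omega,
    r.qbin_self (d := r.N - 1) (by omega), kappaS_one, Nat.cast_sub (show 1 ≤ r.N by omega),
    Nat.cast_one, qbin_N_sub_one]
  have hb := r.brFact_ne_zero (d := n) (by omega)
  have hc := r.br_one_ne_zero
  have h0 : r.br (r.hw α) ≠ 0 := by simpa using hα 0 (by omega)
  have h1 := r.qbin_ne_zero (x := r.hw α - 1) (d := n) (by omega) fun t ht => hγ t (by omega)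
  have h2 := r.qbin_ne_zero (x := r.hw α) (d := n) (by omega) fun t ht => hα t (by omega)
  have h3 := r.kappaS_ne_zero (ν := 0) (by omega)
  have hs : (-1 : ℂ) ^ n * (-1) ^ n = 1 := by rw [← mul_pow]; norm_num
  -- The w = 1 term is written with the binomial of the w = 0 term; at n = 0 the factor {0} = 0
  -- takes over the role of the condition.
  have hT : (if 1 ≤ n ∧ n - 1 ≤ n ∧ 1 = 1 then
        (-1) ^ n * r.qp (((n : ℂ) - 2) * (r.hw α + (((-1 : ℤˣ) : ℤ) : ℂ) - r.N + 1 - n) / 2) * -1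
          * r.qbin (r.hw α - (n - (n - 1) : ℕ)) (n - 1) else 0)
      = -((-1) ^ n * r.qp (((n : ℂ) - 2) * (r.hw α + (((-1 : ℤˣ) : ℤ) : ℂ) - r.N + 1 - n) / 2)
          * (r.br n * r.qbin (r.hw α) n / r.br (r.hw α))) := by
    rcases n with _ | n
    · simp [br_zero]
    · have e := r.qbin_succ' (r.hw α) hn
      rw [if_pos (by omega), Nat.add_sub_cancel, Nat.add_sub_cancel_left, Nat.cast_one]
      push_cast at e ⊢
      rw [e, mul_div_cancel_left₀ _ h0]
      ring
  rw [hT]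
  simp only [Units.val_neg, Units.val_one, Int.cast_neg, Int.cast_one,
    ← sub_eq_add_neg, Nat.cast_zero, sub_zero] at *
  have hexp : r.qp (-((n : ℂ) / 2) * (r.hw α - 1) + (n : ℂ) * (n - 1) / 2)
      * r.qp ((-((r.N - 2 + 1) * 1) - n * (r.hw α - r.N + 1 - n)) / 2)
      * r.qp (n * (r.hw α - 1 - r.N + 1 - n) / 2)
      = r.qp (-((n : ℂ) / 2) * r.hw α + (n : ℂ) * (n - 1) / 2) * r.qp (-1 / 2)
        * r.qp 1 := by
    simp only [← qp_add]
    refine r.qp_congr (-1) ?_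
    push_cast
    ring
  have hexp' : r.qp (-((n : ℂ) / 2) * (r.hw α - 1) + (n : ℂ) * (n - 1) / 2)
      * r.qp ((-((r.N - 2 + 1) * 1) - n * (r.hw α - r.N + 1 - n)) / 2)
      * r.qp (((n : ℂ) - 2) * (r.hw α - 1 - r.N + 1 - n) / 2)
      = r.qp (-((n : ℂ) / 2) * r.hw α + (n : ℂ) * (n - 1) / 2) * r.qp (-1 / 2)
        * (r.qp 1 * r.qp (n - r.hw α)) := by
    simp only [← qp_add]
    refine r.qp_congr 1 ?_
    push_cast
    ring
  -- This identity merges the two surviving terms into the single factor {l − n}, with l = hw α.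
  have hfin : r.br (r.hw α) - r.qp (n - r.hw α) * r.br n = r.qp n * r.br (r.hw α - n) := by
    simp only [br, mul_sub, ← qp_add]
    ring_nf
  have hq : r.qp (n + 1) = r.qp n * r.qp 1 := qp_add _ _ _
  rw [hq, qint_eq, qint_eq]
  have q1 := r.qp_ne_zero (-((n : ℂ) / 2) * r.hw α + (n : ℂ) * (n - 1) / 2)
  have q2 := r.qp_ne_zero (-1 / 2)
  generalize r.qp (-((n : ℂ) / 2) * (r.hw α - 1) + (n : ℂ) * (n - 1) / 2) = a1 at *
  generalize r.qp ((-((r.N - 2 + 1) * 1) - n * (r.hw α - r.N + 1 - n)) / 2) = a2 at *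
  generalize r.qp (n * (r.hw α - 1 - r.N + 1 - n) / 2) = a3 at *
  generalize r.qp (((n : ℂ) - 2) * (r.hw α - 1 - r.N + 1 - n) / 2) = a4 at *
  generalize r.qp (-((n : ℂ) / 2) * r.hw α + (n : ℂ) * (n - 1) / 2) = a5 at *
  generalize r.qp (-1 / 2) = a6 at *
  generalize r.qp (n - r.hw α) = a7 at *
  generalize r.qp n = a8 at *
  generalize r.br (r.hw α - n) = b1 at *
  field_simp
  linear_combination (-a1 * a2 * (a3 * r.br (r.hw α) - a4 * r.br n)) * hs
    - r.br (r.hw α) * hexp + r.br n * hexp' - a5 * a6 * r.qp 1 * hfin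

theorem coefDS_eq_zero (ε : ℤˣ) {m i ν n : ℕ} (h2m : (2 * m : ℂ) = 2 * r.N - 3 - (ε : ℤ))
    (h : i + (r.N - 2 + ν) ≠ m + n) : r.coefDS ε α i ν n = 0 := by
  rw [coefDS, r.coefC_eq_zero (r.level_emit ε α h2m) h, mul_zero]

theorem emit_pos_vec {n : ℕ} (hn : n < r.N) (hα : ∀ t < r.N - 1, r.br (r.hw α - t) ≠ 0)
    (hγ : ∀ t < r.N - 1, r.br (r.hw α + 1 - t) ≠ 0) :
    r.emit 1 α (vec r.N n) = (-(r.qint (r.hw α + 1) / r.kappaS 0)) • (vec r.N n ⊗ₜ[ℂ] vec 2 0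
      + (r.qp (n - 1 - r.hw α) * r.qint n) • (vec r.N (n - 1) ⊗ₜ[ℂ] vec 2 1)) := by
  have hN := r.three_le
  have h2m : (2 * (r.N - 2 : ℕ) : ℂ) = 2 * r.N - 3 - ((1 : ℤˣ) : ℤ) := by
    rw [Nat.cast_sub (by omega)]; push_cast; ring
  rw [emit, lin_vec _ hn]
  refine coord_ext fun i hi ν hν => ?_
  rw [coord_sum hi hν, map_smul, map_add, map_smul, coord_vec _ _ hn (by omega),
    coord_vec _ _ (by omega) (by omega)]
  interval_cases ν
  · by_cases h : n = i
    · subst h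
      rw [r.coefDS_pos_zero hn hα hγ]
      simp
    · rw [r.coefDS_eq_zero 1 h2m (by omega)]
      simp [h]
  · by_cases h : n = i + 1
    · subst h
      rw [r.coefDS_pos_one hn hα hγ]
      simp
    · rw [r.coefDS_eq_zero 1 h2m (by omega)]
      rcases n with _ | n
      · simp [qint_zero]
      · rw [if_neg (by omega), if_neg (by omega)]
        simp

theorem emit_neg_vec {n : ℕ} (hn : n < r.N) (hα : ∀ t < r.N - 1, r.br (r.hw α - t) ≠ 0)
    (hγ : ∀ t < r.N - 1, r.br (r.hw α - 1 - t) ≠ 0) :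
    r.emit (-1) α (vec r.N n) = (1 / (r.qint (r.hw α) * r.kappaS 0)) •
      (vec r.N (n + 1) ⊗ₜ[ℂ] vec 2 0
        - (r.qp (n + 1) * r.qint (r.hw α - n)) • (vec r.N n ⊗ₜ[ℂ] vec 2 1)) := by
  have hN := r.three_le
  have h2m : (2 * (r.N - 1 : ℕ) : ℂ) = 2 * r.N - 3 - ((-1 : ℤˣ) : ℤ) := by
    rw [Nat.cast_sub (by omega)]; push_cast; ring
  rw [emit, lin_vec _ hn]
  refine coord_ext fun i hi ν hν => ?_
  rw [coord_sum hi hν, map_smul, map_sub, map_smul, coord_vec _ _ hn (by omega)]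
  have hc : coord r.N 2 i ν (vec r.N (n + 1) ⊗ₜ[ℂ] vec 2 0) = if n + 1 = i ∧ 0 = ν then 1 else 0 := by
    rcases Nat.lt_or_ge (n + 1) r.N with h | h
    · exact coord_vec _ _ h (by omega)
    · rw [vec_eq_zero h, TensorProduct.zero_tmul, map_zero, if_neg (by omega)]
  rw [hc]
  interval_cases ν
  · by_cases h : n + 1 = i
    · subst h
      rw [r.coefDS_neg_zero hi hα hγ]
      simp
    · rw [r.coefDS_eq_zero (-1) h2m (by omega)]
      simp [h]
  · by_cases h : n = i
    · subst h
      rw [r.coefDS_neg_one hn hα hγ]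
      simp
    · rw [r.coefDS_eq_zero (-1) h2m (by omega)]
      simp [h]

theorem S₁_E_zero : r.S₁ (UqH.gen r.q .E) (vec 2 0) = 0 := by
  rw [S₁, hwRep_E _ _ (by omega)]
  simp [qint_zero]

theorem S₁_E_one : r.S₁ (UqH.gen r.q .E) (vec 2 1) = vec 2 0 := by
  rw [S₁, hwRep_E _ _ (by omega)]
  simp [qint_one]

theorem S₁_F_zero : r.S₁ (UqH.gen r.q .F) (vec 2 0) = vec 2 1 := by
  rw [S₁, hwRep_F]

theorem S₁_F_one : r.S₁ (UqH.gen r.q .F) (vec 2 1) = 0 := by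
  rw [S₁, hwRep_F, vec_eq_zero (by omega)]

theorem V_E (α : ℂ) {n : ℕ} (hn : n < r.N) : r.V α (UqH.gen r.q .E) (vec r.N n)
    = (r.qint n * r.qint (r.hw α - n + 1)) • vec r.N (n - 1) := r.hwRep_E _ hn.le

theorem V_F (α : ℂ) (n : ℕ) : r.V α (UqH.gen r.q .F) (vec r.N n) = vec r.N (n + 1) := r.hwRep_F _ n

theorem V_K (α : ℂ) (n : ℕ) :
    r.V α (UqH.gen r.q .K) (vec r.N n) = r.qp (r.hw α - 2 * n) • vec r.N n := r.hwRep_K _ n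

theorem V_Kinv (α : ℂ) (n : ℕ) :
    r.V α (UqH.gen r.q .Kinv) (vec r.N n) = r.qp (-(r.hw α - 2 * n)) • vec r.N n :=
  r.hwRep_Kinv _ n

theorem V_H (α : ℂ) (n : ℕ) :
    r.V α (UqH.gen r.q .H) (vec r.N n) = (r.hw α - 2 * n) • vec r.N n := r.hwRep_H _ n

theorem S₁_K (n : ℕ) : r.S₁ (UqH.gen r.q .K) (vec 2 n) = r.qp (1 - 2 * n) • vec 2 n :=
  r.hwRep_K _ n

theorem S₁_Kinv (n : ℕ) : r.S₁ (UqH.gen r.q .Kinv) (vec 2 n) = r.qp (-(1 - 2 * n)) • vec 2 n :=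
  r.hwRep_Kinv _ n

theorem S₁_H (n : ℕ) : r.S₁ (UqH.gen r.q .H) (vec 2 n) = (1 - 2 * n : ℂ) • vec 2 n :=
  r.hwRep_H _ n

/-- v_0 ⊗ e_0 is a highest weight vector, and the formula of `emit_pos_vec` lists its images under
the powers of F, up to a common scalar. -/
theorem isHom_emit_pos (hα : ∀ t < r.N - 1, r.br (r.hw α - t) ≠ 0)
    (hγ : ∀ t < r.N - 1, r.br (r.hw α + 1 - t) ≠ 0) :
    IsHom (r.V (α + ((1 : ℤˣ) : ℤ) * r.k)) (Rep.tensor r.q_ne_zero (r.V α) r.S₁) (r.emit 1 α) := by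
  have hN := r.three_le
  set w : ℕ → (Fin r.N → ℂ) ⊗[ℂ] (Fin 2 → ℂ) := fun n =>
    (-(r.qint (r.hw α + 1) / r.kappaS 0)) • (vec r.N n ⊗ₜ[ℂ] vec 2 0
      + (r.qp (n - 1 - r.hw α) * r.qint n) • (vec r.N (n - 1) ⊗ₜ[ℂ] vec 2 1)) with hw
  have hlin : r.emit 1 α = lin r.N w := ext_vec fun n hn => by
    rw [lin_vec _ hn, r.emit_pos_vec hn hα hγ]
  have hl : r.hw (α + ((1 : ℤˣ) : ℤ) * r.k) = r.hw α + 1 := by rw [hw_add_int]; push_cast; ring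
  rw [hlin]
  refine r.isHom_lin_of_hw (l := r.hw (α + ((1 : ℤˣ) : ℤ) * r.k)) (by rw [qint_N, zero_mul])
    (fun n hn => ?_) ?_ ?_ ?_ ?_
  · simp only [hw, map_smul, map_add, Rep.tensor_F, V_Kinv, V_F, S₁_F_zero, S₁_F_one,
      TensorProduct.tmul_zero, zero_add, Nat.add_sub_cancel, ← TensorProduct.smul_tmul']
    congr 1
    have h1 : (r.qp (n - 1 - r.hw α) * r.qint n) • (vec r.N (n - 1 + 1) ⊗ₜ[ℂ] vec 2 1)
        = (r.qp (n - 1 - r.hw α) * r.qint n) • (vec r.N n ⊗ₜ[ℂ] vec 2 1) := by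
      rcases n with _ | n
      · simp [qint_zero]
      · rw [Nat.add_sub_cancel]
    rw [h1, add_comm, ← add_assoc, add_comm, add_comm _ (r.qp _ • _), ← add_smul]
    congr 2
    -- The coefficients of v_n ⊗ e_1 agree because {n + 1} = {n} q⁻¹ + {1} qⁿ.
    rw [Nat.cast_succ, qint_eq, qint_eq, br_add_eq, show (n : ℂ) + 1 - 1 - r.hw α = n - r.hw α by ring]
    have hb := r.br_one_ne_zero
    field_simp
    rw [mul_add, add_comm, mul_comm (r.qp (-(r.hw α - 2 * n)))]
    congr 1
    · rw [show (n : ℂ) - 1 - r.hw α = (n - r.hw α) + (-1) by ring, qp_add]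
      ring
    · rw [show -(r.hw α - 2 * n) = (n - r.hw α) + n by ring, qp_add]
      ring
  -- At n = N the component on v_N ⊗ e_0 is zero since v_N = 0, but the one on v_{N−1} ⊗ e_1
  -- vanishes only thanks to its coefficient [N] = 0.
  · simp only [hw, vec_eq_zero le_rfl, qint_N, mul_zero, zero_smul, TensorProduct.zero_tmul,
      add_zero, smul_zero]
  · simp [hw, Rep.tensor_E, S₁_E_zero, qint_zero, r.V_E α (n := 0) (by omega)]
  · simp only [hw, map_smul, Rep.tensor_K, V_K, S₁_K, Nat.cast_zero, qint_zero, mul_zero,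
      zero_smul, add_zero, ← TensorProduct.smul_tmul', TensorProduct.tmul_smul, smul_smul, sub_zero,
      hl, qp_add]
    congr 1
    ring
  · simp only [hw, map_smul, Rep.tensor_H, V_H, S₁_H, Nat.cast_zero, qint_zero, mul_zero,
      zero_smul, add_zero, ← TensorProduct.smul_tmul', TensorProduct.tmul_smul, sub_zero,
      hl, ← add_smul, smul_smul]
    congr 1
    ring

/-- The highest weight vector is now proportional to v_1 ⊗ e_0 − q [l] v_0 ⊗ e_1 with l = hw α: E
maps both terms to multiples of v_0 ⊗ e_0, and these cancel. -/
theorem isHom_emit_neg (hα : ∀ t < r.N - 1, r.br (r.hw α - t) ≠ 0)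
    (hγ : ∀ t < r.N - 1, r.br (r.hw α - 1 - t) ≠ 0) :
    IsHom (r.V (α + ((-1 : ℤˣ) : ℤ) * r.k)) (Rep.tensor r.q_ne_zero (r.V α) r.S₁)
      (r.emit (-1) α) := by
  have hN := r.three_le
  set w : ℕ → (Fin r.N → ℂ) ⊗[ℂ] (Fin 2 → ℂ) := fun n =>
    (1 / (r.qint (r.hw α) * r.kappaS 0)) •
      (vec r.N (n + 1) ⊗ₜ[ℂ] vec 2 0
        - (r.qp (n + 1) * r.qint (r.hw α - n)) • (vec r.N n ⊗ₜ[ℂ] vec 2 1)) with hw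
  have hlin : r.emit (-1) α = lin r.N w := ext_vec fun n hn => by
    rw [lin_vec _ hn, r.emit_neg_vec hn hα hγ]
  have hl : r.hw (α + ((-1 : ℤˣ) : ℤ) * r.k) = r.hw α + -1 := by rw [hw_add_int]; push_cast; ring
  rw [hlin]
  refine r.isHom_lin_of_hw (l := r.hw (α + ((-1 : ℤˣ) : ℤ) * r.k)) (by rw [qint_N, zero_mul])
    (fun n hn => ?_) ?_ ?_ ?_ ?_
  · simp only [hw, map_smul, map_sub, Rep.tensor_F, V_Kinv, V_F, S₁_F_zero, S₁_F_one,
      TensorProduct.tmul_zero, zero_add, ← TensorProduct.smul_tmul']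
    congr 1
    have hb := r.br_one_ne_zero
    have e : r.qp (-(r.hw α - 2 * (n + 1 : ℕ)))
        = r.qp (n + 1) * r.qint (r.hw α - n)
          - r.qp ((n + 1 : ℕ) + 1) * r.qint (r.hw α - (n + 1 : ℕ)) := by
      rw [qint_eq, qint_eq, mul_div_assoc', mul_div_assoc', ← sub_div, eq_div_iff hb]
      simp only [br, mul_sub, ← qp_add]
      push_cast
      ring_nf
    rw [e]
    module
  · simp only [hw, vec_eq_zero le_rfl, vec_eq_zero (Nat.le_succ _), TensorProduct.zero_tmul,
      smul_zero, sub_zero]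
  · simp only [hw, map_smul, map_sub, Rep.tensor_E, S₁_E_zero, S₁_E_one, S₁_K, zero_add,
      r.V_E α (n := 0) (by omega), r.V_E α (n := 1) (by omega), Nat.cast_zero, Nat.cast_one,
      qint_zero, qint_one, zero_mul, zero_smul, TensorProduct.zero_tmul, TensorProduct.tmul_zero,
      ← TensorProduct.smul_tmul', TensorProduct.tmul_smul, smul_smul]
    simp
  · simp only [hw, map_smul, map_sub, Rep.tensor_K, V_K, S₁_K, ← TensorProduct.smul_tmul',
      TensorProduct.tmul_smul, smul_smul, smul_sub, hl, ← qp_add]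
    congr 2
    · push_cast
      ring_nf
    · push_cast
      ring_nf
  · simp only [hw, map_smul, map_sub, Rep.tensor_H, V_H, S₁_H, ← TensorProduct.smul_tmul',
      TensorProduct.tmul_smul, hl, ← add_smul, smul_smul, smul_sub]
    congr 2
    · push_cast
      ring
    · push_cast
      ring

end emit

end RootData

/-! ### The vertex S₁ ⊗ V_{β+εk} → V_β -/

namespace RootData

variable (r : RootData)

theorem hw_neg (β : ℂ) : r.hw (-β) = 2 * r.N - 2 - r.hw β := by
  rw [hw, hw, neg_div]; ring

theorem level_absorb (ε : ℤ) (β : ℂ) {m : ℕ} (h : (2 * m : ℂ) = 1 - ε) :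
    (-(β + ε * r.k) + -(r.k * (r.N - 2)) - -β) / (2 * r.k) + ((r.N : ℂ) - 1) / 2 = m := by
  have hk := r.k_ne_zero
  field_simp
  linear_combination (-r.k) * h

section absorb

variable {β : ℂ}

theorem coefES_eq_zero (ε : ℤˣ) {m ν j n : ℕ} (h2m : (2 * m : ℂ) = 1 - (ε : ℤ)) (hν : ν < 2)
    (hj : j < r.N) (hn : n < r.N) (h : n + 1 ≠ j + ν + m) : r.coefES ε β ν j n = 0 := by
  rw [coefES, r.coefC_eq_zero (r.level_absorb ε β h2m) (by omega), mul_zero]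

/-- The dual coefficient uses complementary indices i = N − 1 − j, u = N − 1 − n, μ = 1 − ν, and the
colour −k(N − 2), of highest weight 1. As w ≤ μ ≤ 1, at most two terms are left. -/
theorem coefES_eq (ε : ℤˣ) {m ν j n i u μ : ℕ} (h2m : (2 * m : ℂ) = 1 - (ε : ℤ))
    (hi : i + j = r.N - 1) (hu : u + n = r.N - 1) (hμ : μ + ν = 1) (h : n + 1 = j + ν + m) :
    r.coefES ε β ν j n = r.kappaS ν * r.kappa (β + (ε : ℤ) * r.k) j / r.kappa β n
      * ((-1) ^ μ * (-1) ^ u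
        * r.qp ((μ * (-(r.N - 2) - μ) - i * (r.N - 1 - r.hw β - (ε : ℤ) - i)) / 2)
        * (r.qbin (2 * r.N - 2 - r.hw β) u)⁻¹ * r.qbin (2 * r.N - 2 - r.hw β) (r.N - 1 - m)
        * ((if u ≤ i then (-1) ^ u * r.qp (u * (r.N - 1 - r.hw β - u) / 2) * r.qbin m μ
              * r.qbin (2 * r.N - 2 - r.hw β - (ε : ℤ) - (i - u : ℕ)) u else 0)
          + if 1 ≤ u ∧ u - 1 ≤ i ∧ μ = 1 then
              -((-1) ^ u * r.qp (((u : ℂ) - 2) * (r.N - 1 - r.hw β - u) / 2)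
              * r.qbin (2 * r.N - 2 - r.hw β - (ε : ℤ) - (i - (u - 1) : ℕ)) (u - 1))
            else 0)) := by
  have hN := r.three_le
  have hk := r.k_ne_zero
  obtain rfl : i = r.N - 1 - j := by omega
  obtain rfl : u = r.N - 1 - n := by omega
  obtain rfl : μ = 1 - ν := by omega
  rw [coefES, r.coefC_eq (r.level_absorb ε β h2m) (by omega), sum_antidiagonal_of_small]
  swap
  · intro z w hzw hw2
    rw [if_neg (by simp only; omega)]
  have e1 : -β / r.k = r.N - 1 - r.hw β := by rw [hw]; ring
  have e2 : -(β + (ε : ℤ) * r.k) / r.k = r.N - 1 - r.hw β - (ε : ℤ) := by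
    rw [hw]; field_simp; ring
  have e3 : -(r.k * (r.N - 2)) / r.k = -((r.N : ℂ) - 2) := by field_simp
  have e4 : r.hw (-(β + (ε : ℤ) * r.k)) = 2 * r.N - 2 - r.hw β - (ε : ℤ) := by
    rw [hw_neg, hw_add_int]; ring
  have e5 : r.hw (-(r.k * (r.N - 2))) = 1 := by rw [hw_neg, hw_S]; ring
  rw [e1, e2, e3, e4, e5, hw_neg, pow_add]
  generalize r.N - 1 - n = u
  generalize r.N - 1 - j = i
  congr 2
  congr 1
  · dsimp only
    simp only [Nat.zero_le, and_true, Nat.sub_zero, qbin_zero, mul_one]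
    refine if_congr Iff.rfl ?_ rfl
    congr 4
    ring
  · by_cases h1 : 1 ≤ u
    · rw [if_pos h1]
      dsimp only
      refine if_ctx_congr ⟨fun hh => ⟨h1, hh.1, by omega⟩, fun hh => ⟨hh.2.1, by omega⟩⟩ ?_
        fun _ => rfl
      rintro ⟨_, _, hμ1⟩
      rw [hμ1, Nat.sub_self, qbin_zero, qbin_one, Nat.cast_zero, sub_zero, qint_one,
        Nat.cast_sub h1, Nat.cast_one, show (2 * ((u : ℂ) - 1) - u) = u - 2 by ring]
      obtain ⟨c, rfl⟩ : ∃ c, u = c + 1 := ⟨u - 1, by omega⟩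
      rw [Nat.add_sub_cancel, pow_succ]
      ring
    · rw [if_neg h1, if_neg (by omega)]

theorem neg_one_pow_mul_self (n : ℕ) : (-1 : ℂ) ^ n * (-1) ^ n = 1 := by
  rw [← mul_pow]; norm_num

theorem kappa_one_add (α : ℂ) {n : ℕ} (hn : n < r.N) : r.kappa α (n + 1)
    = r.qp (-(r.hw α) / 2) * r.qint (r.hw α)
      * (r.qp (-((n : ℂ) / 2) * r.hw α + (n : ℂ) * (n - 1) / 2 + n)
        * (r.brFact n * r.qbin (r.hw α - 1) n / r.br 1 ^ n)) := by
  have e1 := r.kappa_add α 1 n hn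
  rwa [add_comm 1 n, kappa_one, Nat.cast_one, one_mul] at e1

theorem qbin_shift (x : ℂ) (d : ℕ) : r.br x * r.qbin (x - 1) d = r.br (x - d) * r.qbin x d := by
  rw [qbin, qbin, mul_div_assoc', mul_div_assoc']
  congr 1
  have e : ∀ t ∈ Finset.range d, r.br (x - 1 - t) = r.br (x - (t + 1 : ℕ)) := fun t _ => by
    congr 1; push_cast; ring
  have h := Finset.prod_range_succ (fun t : ℕ => r.br (x - t)) d
  rw [Finset.prod_range_succ', Nat.cast_zero, sub_zero, ← Finset.prod_congr rfl e] at h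
  rw [mul_comm, h, mul_comm]

/-- Modulo N/2 the argument is −(hw β + 2 + t), so this is again, up to sign, a quantum number
attached to β. -/
theorem br_complement_ne_zero (hβ : ∀ t : ℤ, r.br (r.hw β + t) ≠ 0) (t : ℤ) :
    r.br (2 * r.N - 2 - r.hw β - t) ≠ 0 := by
  have h := hβ (2 + t)
  rw [r.br_congr (y := -(r.hw β + (2 + t : ℤ))) 4 (by push_cast; ring), br_neg]
  exact neg_ne_zero.2 h

theorem qbin_complement_ne_zero (hβ : ∀ t : ℤ, r.br (r.hw β + t) ≠ 0) {u : ℕ} (hu : u < r.N) :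
    r.qbin (2 * r.N - 2 - r.hw β) u ≠ 0 :=
  r.qbin_ne_zero hu fun t _ => by exact_mod_cast r.br_complement_ne_zero hβ t

/-- The level is 0 for ε = 1. The factor {hw β + 1 − j} coming from the κ's cancels the one coming
from the reflected binomials (`s1'`, `s2'`), which leaves a scalar independent of j and one power of
q. -/
theorem coefES_pos_one {j : ℕ} (hj : j < r.N) (hβ : ∀ t : ℤ, r.br (r.hw β + t) ≠ 0) :
    r.coefES 1 β 1 j j = -(r.kappaS 0 * r.qbin (2 * r.N - 2 - r.hw β) (r.N - 1)
      * r.br (r.hw β + 1) / r.br (r.hw β + 2)) * r.qp (-1 - j) := by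
  have hN := r.three_le
  obtain ⟨i, hi⟩ : ∃ i, i + j = r.N - 1 := ⟨r.N - 1 - j, by omega⟩
  have hiC : (i : ℂ) = r.N - 1 - j := by
    have : ((i + j : ℕ) : ℂ) = ((r.N - 1 : ℕ) : ℂ) := by rw [hi]
    rw [Nat.cast_sub (by omega)] at this
    push_cast at this
    linear_combination this
  rw [r.coefES_eq 1 (m := 0) (by simp) hi hi (zero_add 1) (by omega), if_pos le_rfl,
    if_neg (by omega), Nat.sub_self, add_zero, qbin_zero, r.kappa_eq_qbin _ hj,
    r.kappa_eq_qbin β hj, hw_add_int, kappaS_one, Nat.sub_zero]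
  simp only [Units.val_one, Int.cast_one, Nat.cast_zero, sub_zero, pow_zero, zero_mul, zero_sub,
    mul_one, one_mul]
  have hb := r.brFact_ne_zero (d := j) (by omega)
  have hc := r.br_one_ne_zero
  have h0 := hβ 2
  have h1 := hβ (1 - j)
  have h2 := r.qbin_ne_zero (x := r.hw β) hj fun t _ => by
    have := hβ (-t); push_cast at this; rwa [← sub_eq_add_neg] at this
  have h3 := r.qbin_complement_ne_zero hβ (u := i) (by omega)
  have hs := neg_one_pow_mul_self i
  have s1 := r.qbin_shift (r.hw β + 1) j
  have s2 := r.qbin_shift (2 * r.N - 2 - r.hw β) i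
  rw [add_sub_cancel_right] at s1
  rw [r.br_congr (x := 2 * r.N - 2 - r.hw β) (y := -(r.hw β + 2)) 4 (by push_cast; ring),
    r.br_congr (x := 2 * r.N - 2 - r.hw β - i) (y := -(r.hw β + 1 - j)) 2 (by
      rw [hiC]; push_cast; ring), br_neg, br_neg] at s2
  have hexp : r.qp (-1 / 2) * r.qp (-((j : ℂ) / 2) * (r.hw β + 1) + (j : ℂ) * (j - 1) / 2)
      * r.qp (-(i * (r.N - 1 - r.hw β - 1 - i)) / 2) * r.qp (i * (r.N - 1 - r.hw β - i) / 2)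
      = r.qp (-((j : ℂ) / 2) * r.hw β + (j : ℂ) * (j - 1) / 2) * r.qp (-1 - j) := by
    simp only [← qp_add]
    refine r.qp_congr 1 ?_
    rw [hiC]
    push_cast
    ring
  have q1 := r.qp_ne_zero (-((j : ℂ) / 2) * r.hw β + (j : ℂ) * (j - 1) / 2)
  push_cast at h0 h1
  rw [show r.hw β + (1 - (j : ℂ)) = r.hw β + 1 - j by ring] at h1
  generalize r.qp (-1 / 2) = a1 at *
  generalize r.qp (-((j : ℂ) / 2) * (r.hw β + 1) + (j : ℂ) * (j - 1) / 2) = a2 at *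
  generalize r.qp (-(i * (r.N - 1 - r.hw β - 1 - i)) / 2) = a3 at *
  generalize r.qp (i * (r.N - 1 - r.hw β - i) / 2) = a4 at *
  generalize r.qp (-((j : ℂ) / 2) * r.hw β + (j : ℂ) * (j - 1) / 2) = a5 at *
  generalize r.qp (-1 - (j : ℂ)) = a6 at *
  have s1' : r.qbin (r.hw β + 1) j
      = r.br (r.hw β + 1) * r.qbin (r.hw β) j / r.br (r.hw β + 1 - j) := by
    rw [eq_div_iff h1, mul_comm, ← s1]
  have s2' : r.qbin (2 * r.N - 2 - r.hw β - 1) i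
      = r.br (r.hw β + 1 - j) * r.qbin (2 * r.N - 2 - r.hw β) i / r.br (r.hw β + 2) := by
    rw [eq_div_iff h0]
    linear_combination -s2
  rw [s1', s2']
  clear s1 s2 s1' s2'
  generalize r.qbin (2 * r.N - 2 - r.hw β) i = Q1 at *
  generalize r.qbin (2 * r.N - 2 - r.hw β) (r.N - 1) = Q2 at *
  field_simp
  linear_combination r.kappaS 0 * r.br (r.hw β + 1) * Q2 * ((-a1 * a2 * a3 * a4) * hs - hexp)

theorem coefES_pos_zero {j : ℕ} (hj : j + 1 < r.N) (hβ : ∀ t : ℤ, r.br (r.hw β + t) ≠ 0) :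
    r.coefES 1 β 0 (j + 1) j = (r.kappaS 0 * r.qbin (2 * r.N - 2 - r.hw β) (r.N - 1)
      * r.br (r.hw β + 1) / r.br (r.hw β + 2)) * r.qint ((j : ℂ) + 1) := by
  have hN := r.three_le
  obtain ⟨i, hi⟩ : ∃ i, i + (j + 1) = r.N - 1 := ⟨r.N - 1 - (j + 1), by omega⟩
  have hiC : (i : ℂ) = r.N - 2 - j := by
    have : ((i + (j + 1) : ℕ) : ℂ) = ((r.N - 1 : ℕ) : ℂ) := by rw [hi]
    rw [Nat.cast_sub (by omega)] at this
    push_cast at this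
    linear_combination this
  rw [r.coefES_eq 1 (m := 0) (u := i + 1) (by simp) hi (by omega) (add_zero 1) (by omega),
    if_neg (by omega), if_pos ⟨by omega, by omega, rfl⟩, Nat.add_sub_cancel, Nat.sub_self, zero_add,
    r.kappa_one_add _ (by omega),
    r.kappa_eq_qbin β (n := j) (by omega), hw_add_int, Nat.sub_zero]
  simp only [Units.val_one, Int.cast_one, Nat.cast_zero, sub_zero, pow_one,
    add_sub_cancel_right]
  rw [qint_eq, qint_eq]
  have hb := r.brFact_ne_zero (d := j) (by omega)
  have hc := r.br_one_ne_zero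
  have h0 := hβ 2
  have h2 := r.qbin_ne_zero (x := r.hw β) (d := j) (by omega) fun t _ => by
    have := hβ (-t); push_cast at this; rwa [← sub_eq_add_neg] at this
  have h3 := r.qbin_complement_ne_zero hβ (u := i + 1) (by omega)
  have hs := neg_one_pow_mul_self (i + 1)
  have s2 := r.qbin_succ' (2 * r.N - 2 - r.hw β) (d := i) (by omega)
  rw [r.br_congr (x := 2 * r.N - 2 - r.hw β) (y := -(r.hw β + 2)) 4 (by push_cast; ring),
    r.br_congr (x := (i : ℂ) + 1) (y := -((j : ℂ) + 1)) 2 (by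
      rw [hiC]; push_cast; ring), br_neg, br_neg] at s2
  have hexp : r.qp (-(r.hw β + 1) / 2) * r.qp (-((j : ℂ) / 2) * (r.hw β + 1) + (j : ℂ) * (j - 1) / 2 + j)
      * r.qp ((((1 : ℕ) : ℂ) * (-(r.N - 2) - (1 : ℕ)) - i * (r.N - 1 - r.hw β - 1 - i)) / 2)
      * r.qp ((((i + 1 : ℕ) : ℂ) - 2) * (r.N - 1 - r.hw β - (i + 1 : ℕ)) / 2)
      = r.qp (-((j : ℂ) / 2) * r.hw β + (j : ℂ) * (j - 1) / 2) := by
    simp only [← qp_add]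
    refine r.qp_congr (-1) ?_
    push_cast
    rw [hiC]
    ring
  have q1 := r.qp_ne_zero (-((j : ℂ) / 2) * r.hw β + (j : ℂ) * (j - 1) / 2)
  push_cast at h0 hexp ⊢
  have s2' : r.qbin (2 * r.N - 2 - r.hw β - 1) i
      = r.br ((j : ℂ) + 1) * r.qbin (2 * r.N - 2 - r.hw β) (i + 1) / r.br (r.hw β + 2) := by
    rw [eq_div_iff h0]
    linear_combination s2
  rw [s2']
  generalize r.qp (-(r.hw β + 1) / 2) = a1 at *
  generalize r.qp (-((j : ℂ) / 2) * (r.hw β + 1) + (j : ℂ) * (j - 1) / 2 + j) = a2 at *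
  generalize r.qp ((1 * (-((r.N : ℂ) - 2) - 1) - i * (r.N - 1 - r.hw β - 1 - i)) / 2) = a3 at *
  generalize r.qp (((i : ℂ) + 1 - 2) * (r.N - 1 - r.hw β - (i + 1)) / 2) = a4 at *
  generalize r.qp (-((j : ℂ) / 2) * r.hw β + (j : ℂ) * (j - 1) / 2) = a5 at *
  clear s2 s2'
  generalize r.qbin (2 * r.N - 2 - r.hw β) (i + 1) = Q1 at *
  generalize r.qbin (2 * r.N - 2 - r.hw β) (r.N - 1) = Q2 at *
  field_simp
  linear_combination r.kappaS 0 * r.br (r.hw β + 1) * Q2 * r.br (j + 1)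
    * ((a1 * a2 * a3 * a4) * hs + hexp)

theorem coefES_neg_one {j : ℕ} (hj : j + 1 < r.N) (hβ : ∀ t : ℤ, r.br (r.hw β + t) ≠ 0) :
    r.coefES (-1) β 1 j (j + 1) = -(r.kappaS 0 * r.qbin (2 * r.N - 2 - r.hw β) (r.N - 2)
      / r.qint (r.hw β)) * r.qp (r.hw β - 1 - j) := by
  have hN := r.three_le
  obtain ⟨i, hi⟩ : ∃ i, i + (j + 1) = r.N - 1 := ⟨r.N - 1 - (j + 1), by omega⟩
  have hiC : (i : ℂ) = r.N - 2 - j := by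
    have : ((i + (j + 1) : ℕ) : ℂ) = ((r.N - 1 : ℕ) : ℂ) := by rw [hi]
    rw [Nat.cast_sub (by omega)] at this
    push_cast at this
    linear_combination this
  rw [r.coefES_eq (-1) (m := 1) (i := i + 1) (u := i) (by push_cast; norm_num) (by omega) hi
    (zero_add 1) (by omega),
    if_pos (by omega), if_neg (by omega), Nat.add_sub_cancel_left, qbin_zero, add_zero,
    r.kappa_one_add β (by omega),
    r.kappa_eq_qbin _ (n := j) (by omega), hw_add_int, kappaS_one, show r.N - 1 - 1 = r.N - 2 by omega]
  simp only [Units.val_neg, Units.val_one, Int.cast_neg, Int.cast_one, Nat.cast_zero, Nat.cast_one,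
    sub_zero, pow_zero, zero_mul, zero_sub, mul_one, one_mul, ← sub_eq_add_neg, sub_neg_eq_add,
    add_sub_cancel_right]
  have hb := r.brFact_ne_zero (d := j) (by omega)
  have hc := r.br_one_ne_zero
  have h0 := hβ 0
  rw [Int.cast_zero, add_zero] at h0
  have h0' := r.qint_ne_zero h0
  have h2 := r.qbin_ne_zero (x := r.hw β - 1) (d := j) (by omega) fun t _ => by
    have := hβ (-1 - t); push_cast at this; rwa [← add_sub_assoc, ← sub_eq_add_neg] at this
  have h3 := r.qbin_complement_ne_zero hβ (u := i) (by omega)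
  have hs := neg_one_pow_mul_self i
  have hexp : r.qp (-1 / 2) * r.qp (-((j : ℂ) / 2) * (r.hw β - 1) + (j : ℂ) * (j - 1) / 2)
      * r.qp (-((i + 1 : ℕ) * (r.N - 1 - r.hw β + 1 - (i + 1 : ℕ))) / 2)
      * r.qp (i * (r.N - 1 - r.hw β - i) / 2)
      = r.qp (-r.hw β / 2) * r.qp (-((j : ℂ) / 2) * r.hw β + (j : ℂ) * (j - 1) / 2 + j)
        * r.qp (r.hw β - 1 - j) := by
    simp only [← qp_add]
    refine r.qp_congr 0 ?_
    push_cast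
    rw [hiC]
    ring
  have q1 := r.qp_ne_zero (-((j : ℂ) / 2) * r.hw β + (j : ℂ) * (j - 1) / 2 + j)
  have q2 := r.qp_ne_zero (-r.hw β / 2)
  generalize r.qp (-1 / 2) = a1 at *
  generalize r.qp (-((j : ℂ) / 2) * (r.hw β - 1) + (j : ℂ) * (j - 1) / 2) = a2 at *
  generalize r.qp (-((i + 1 : ℕ) * (r.N - 1 - r.hw β + 1 - (i + 1 : ℕ))) / 2) = a3 at *
  generalize r.qp (i * (r.N - 1 - r.hw β - i) / 2) = a4 at *
  generalize r.qp (-((j : ℂ) / 2) * r.hw β + (j : ℂ) * (j - 1) / 2 + j) = a5 at *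
  generalize r.qp (-r.hw β / 2) = a6 at *
  generalize r.qp (r.hw β - 1 - j) = a7 at *
  generalize r.qbin (2 * r.N - 2 - r.hw β) i = Q1 at *
  generalize r.qbin (2 * r.N - 2 - r.hw β) (r.N - 2) = Q2 at *
  field_simp
  linear_combination r.kappaS 0 * Q2 * ((-a1 * a2 * a3 * a4) * hs - hexp)

theorem coefES_neg_zero {j : ℕ} (hj : j < r.N) (hβ : ∀ t : ℤ, r.br (r.hw β + t) ≠ 0) :
    r.coefES (-1) β 0 j j = -(r.kappaS 0 * r.qbin (2 * r.N - 2 - r.hw β) (r.N - 2)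
      / r.qint (r.hw β)) * r.qint (r.hw β - j) := by
  have hN := r.three_le
  obtain ⟨i, hi⟩ : ∃ i, i + j = r.N - 1 := ⟨r.N - 1 - j, by omega⟩
  have hiC : (i : ℂ) = r.N - 1 - j := by
    have : ((i + j : ℕ) : ℂ) = ((r.N - 1 : ℕ) : ℂ) := by rw [hi]
    rw [Nat.cast_sub (by omega)] at this
    push_cast at this
    linear_combination this
  rw [r.coefES_eq (-1) (m := 1) (i := i) (u := i) (by push_cast; norm_num) hi hi
    (add_zero 1) (by omega), if_pos le_rfl, r.qbin_self (d := 1) (by omega), Nat.sub_self,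
    r.kappa_eq_qbin β hj, r.kappa_eq_qbin _ hj, hw_add_int, show r.N - 1 - 1 = r.N - 2 by omega]
  simp only [Units.val_neg, Units.val_one, Int.cast_neg, Int.cast_one, Nat.cast_zero, Nat.cast_one,
    sub_zero, pow_one, one_mul, mul_one, ← sub_eq_add_neg, sub_neg_eq_add]
  have hb := r.brFact_ne_zero (d := j) (by omega)
  have hc := r.br_one_ne_zero
  have h0 := hβ 0
  rw [Int.cast_zero, add_zero] at h0
  have h1 := hβ (-j)
  push_cast at h1
  rw [← sub_eq_add_neg] at h1
  have h2 := r.qbin_ne_zero (x := r.hw β) (d := j) (by omega) fun t _ => by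
    have := hβ (-t); push_cast at this; rwa [← sub_eq_add_neg] at this
  have h3 := r.qbin_complement_ne_zero hβ (u := i) (by omega)
  have hs := neg_one_pow_mul_self i
  -- For i = 0, that is j = N − 1, the second term is absent; the right-hand side vanishes too,
  -- because {j + 1} = {N} = 0.
  have hT : (if 1 ≤ i ∧ i - 1 ≤ i ∧ True then
        -((-1) ^ i * r.qp (((i : ℂ) - 2) * (r.N - 1 - r.hw β - i) / 2)
          * r.qbin (2 * r.N - 2 - r.hw β + 1 - (i - (i - 1) : ℕ)) (i - 1)) else 0)
      = -((-1) ^ i * r.qp (((i : ℂ) - 2) * (r.N - 1 - r.hw β - i) / 2)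
          * (r.br (j + 1) * r.qbin (2 * r.N - 2 - r.hw β) i / r.br (r.hw β - j))) := by
    rcases i with _ | i
    · have : r.br ((j : ℂ) + 1) = 0 := by
        have : (j : ℂ) + 1 = r.N := by push_cast at hiC; linear_combination hiC
        rw [this, br_N]
      simp [this]
    · have e := r.qbin_succ (2 * r.N - 2 - r.hw β) (d := i) (by omega)
      rw [r.br_congr (x := (i : ℂ) + 1) (y := -((j : ℂ) + 1)) 2 (by
          push_cast at hiC ⊢; linear_combination hiC),
        r.br_congr (x := 2 * r.N - 2 - r.hw β - i) (y := -(r.hw β - j)) 2 (by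
          push_cast at hiC ⊢; linear_combination -hiC), br_neg, br_neg] at e
      rw [if_pos ⟨by omega, by omega, trivial⟩, Nat.add_sub_cancel, Nat.add_sub_cancel_left,
        Nat.cast_one, add_sub_cancel_right]
      congr 2
      rw [eq_div_iff h1]
      linear_combination e
  have s1 := r.qbin_shift (r.hw β) j
  have s2 := r.qbin_shift (2 * r.N - 2 - r.hw β + 1) i
  rw [r.br_congr (x := 2 * r.N - 2 - r.hw β + 1) (y := -(r.hw β + 1)) 4 (by push_cast; ring),
    r.br_congr (x := 2 * r.N - 2 - r.hw β + 1 - i) (y := -(r.hw β - j)) 2 (by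
      rw [hiC]; push_cast; ring), br_neg, br_neg, add_sub_cancel_right] at s2
  have s1' : r.qbin (r.hw β - 1) j
      = r.br (r.hw β - j) * r.qbin (r.hw β) j / r.br (r.hw β) := by
    rw [eq_div_iff h0, ← s1, mul_comm]
  have s2' : r.qbin (2 * r.N - 2 - r.hw β + 1) i
      = r.br (r.hw β + 1) * r.qbin (2 * r.N - 2 - r.hw β) i / r.br (r.hw β - j) := by
    rw [eq_div_iff h1]
    linear_combination s2
  rw [hT, s1', s2', qint_eq, qint_eq]
  have hexp : r.qp (-((j : ℂ) / 2) * (r.hw β - 1) + (j : ℂ) * (j - 1) / 2)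
      * r.qp ((-(r.N - 2) - 1 - i * (r.N - 1 - r.hw β + 1 - i)) / 2)
      * r.qp (i * (r.N - 1 - r.hw β - i) / 2)
      = r.qp (-((j : ℂ) / 2) * r.hw β + (j : ℂ) * (j - 1) / 2) * r.qp (j + 1) := by
    simp only [← qp_add]
    refine r.qp_congr (-2) ?_
    rw [hiC]
    push_cast
    ring
  have hexp' : r.qp (-((j : ℂ) / 2) * (r.hw β - 1) + (j : ℂ) * (j - 1) / 2)
      * r.qp ((-(r.N - 2) - 1 - i * (r.N - 1 - r.hw β + 1 - i)) / 2)
      * r.qp (((i : ℂ) - 2) * (r.N - 1 - r.hw β - i) / 2)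
      = r.qp (-((j : ℂ) / 2) * r.hw β + (j : ℂ) * (j - 1) / 2) * r.qp (r.hw β + 1) := by
    simp only [← qp_add]
    refine r.qp_congr (-2) ?_
    rw [hiC]
    push_cast
    ring
  -- The two terms add up to the single factor {hw β − j}.
  have hfin : r.qp (j + 1) * r.br (r.hw β + 1) - r.qp (r.hw β + 1) * r.br (j + 1)
      = r.br (r.hw β - j) := by
    simp only [br, mul_sub, ← qp_add]
    ring_nf
  have q1 := r.qp_ne_zero (-((j : ℂ) / 2) * r.hw β + (j : ℂ) * (j - 1) / 2)
  generalize r.qp (-((j : ℂ) / 2) * (r.hw β - 1) + (j : ℂ) * (j - 1) / 2) = a1 at *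
  generalize r.qp ((-((r.N : ℂ) - 2) - 1 - i * (r.N - 1 - r.hw β + 1 - i)) / 2) = a2 at *
  generalize r.qp (i * (r.N - 1 - r.hw β - i) / 2) = a3 at *
  generalize r.qp (((i : ℂ) - 2) * (r.N - 1 - r.hw β - i) / 2) = a4 at *
  generalize r.qp (-((j : ℂ) / 2) * r.hw β + (j : ℂ) * (j - 1) / 2) = a5 at *
  clear hT s1 s2 s1' s2'
  generalize r.qbin (2 * r.N - 2 - r.hw β) i = Q1 at *
  generalize r.qbin (2 * r.N - 2 - r.hw β) (r.N - 2) = Q2 at *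
  field_simp
  linear_combination r.kappaS 0 * Q2 * ((-a1 * a2 * (a3 * r.br (r.hw β + 1) - a4 * r.br (j + 1)))
    * hs - r.br (r.hw β + 1) * hexp + r.br (j + 1) * hexp' - a5 * hfin)

/-- The scalar in the vertex `S₁ ⊗ V_{β+k} → V_β`. -/
def absorbPos (β : ℂ) : ℂ :=
  r.kappaS 0 * r.qbin (2 * r.N - 2 - r.hw β) (r.N - 1) * r.br (r.hw β + 1) / r.br (r.hw β + 2)

/-- The scalar in the vertex `S₁ ⊗ V_{β-k} → V_β`. -/
def absorbNeg (β : ℂ) : ℂ :=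
  -(r.kappaS 0 * r.qbin (2 * r.N - 2 - r.hw β) (r.N - 2) / r.qint (r.hw β))

theorem absorb_vec_sum (ε : ℤˣ) {ν j : ℕ} (hν : ν < 2) (hj : j < r.N) :
    r.absorb ε β (vec 2 ν ⊗ₜ[ℂ] vec r.N j)
      = ∑ n ∈ Finset.range r.N, r.coefES ε β ν j n • vec r.N n := by
  rw [absorb, lin₂_vec _ hν hj]

theorem absorb_pos_one (hβ : ∀ t : ℤ, r.br (r.hw β + t) ≠ 0) (j : ℕ) :
    r.absorb 1 β (vec 2 1 ⊗ₜ[ℂ] vec r.N j) = -(r.absorbPos β * r.qp (-1 - j)) • vec r.N j := by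
  rcases Nat.lt_or_ge j r.N with hj | hj
  swap
  · rw [vec_eq_zero hj, TensorProduct.tmul_zero, map_zero, smul_zero]
  rw [r.absorb_vec_sum 1 (by omega) hj, Finset.sum_eq_single j, r.coefES_pos_one hj hβ, neg_mul]
  · rfl
  · intro n hn hnj
    rw [Finset.mem_range] at hn
    rw [r.coefES_eq_zero 1 (m := 0) (by simp) (by omega) hj hn (by omega), zero_smul]
  · intro h; exact absurd (Finset.mem_range.2 hj) h

/-- The case j = N is needed when F is applied to v_{N−1}: the left side is then zero because v_N =
0, the right side because [N] = 0, although v_{N−1} ≠ 0. -/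
theorem absorb_pos_zero (hβ : ∀ t : ℤ, r.br (r.hw β + t) ≠ 0) {j : ℕ} (hj : j ≤ r.N) :
    r.absorb 1 β (vec 2 0 ⊗ₜ[ℂ] vec r.N j)
      = (r.absorbPos β * r.qint j) • vec r.N (j - 1) := by
  rcases Nat.lt_or_ge j r.N with hj' | hj'
  swap
  · obtain rfl : j = r.N := le_antisymm hj hj'
    rw [vec_eq_zero le_rfl, TensorProduct.tmul_zero, map_zero, qint_N, mul_zero, zero_smul]
  rw [r.absorb_vec_sum 1 (by omega) hj']
  rcases j with _ | j
  · rw [Nat.cast_zero, qint_zero, mul_zero, zero_smul]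
    refine Finset.sum_eq_zero fun n hn => ?_
    rw [Finset.mem_range] at hn
    rw [r.coefES_eq_zero 1 (m := 0) (by simp) (by omega) hj' hn (by omega), zero_smul]
  · rw [Finset.sum_eq_single j, r.coefES_pos_zero hj' hβ, Nat.add_sub_cancel, Nat.cast_succ]
    · rfl
    · intro n hn hnj
      rw [Finset.mem_range] at hn
      rw [r.coefES_eq_zero 1 (m := 0) (by simp) (by omega) hj' hn (by omega), zero_smul]
    · intro h; exact absurd (Finset.mem_range.2 (by omega)) h

theorem absorb_neg_one (hβ : ∀ t : ℤ, r.br (r.hw β + t) ≠ 0) (j : ℕ) :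
    r.absorb (-1) β (vec 2 1 ⊗ₜ[ℂ] vec r.N j)
      = (r.absorbNeg β * r.qp (r.hw β - 1 - j)) • vec r.N (j + 1) := by
  have h2m : (2 * (1 : ℕ) : ℂ) = 1 - ((-1 : ℤˣ) : ℤ) := by push_cast; norm_num
  rcases Nat.lt_or_ge j r.N with hj | hj
  swap
  · rw [vec_eq_zero hj, vec_eq_zero (Nat.le_succ_of_le hj), TensorProduct.tmul_zero, map_zero,
      smul_zero]
  rw [r.absorb_vec_sum (-1) (by omega) hj]
  have h0 : ∀ n < r.N, n ≠ j + 1 → r.coefES (-1) β 1 j n • vec r.N n = 0 := fun n hn hnj => by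
    rw [r.coefES_eq_zero (-1) h2m (by omega) hj hn (by omega), zero_smul]
  rcases Nat.lt_or_ge (j + 1) r.N with hj' | hj'
  · rw [Finset.sum_eq_single (j + 1), r.coefES_neg_one hj' hβ]
    · rfl
    · exact fun n hn hnj => h0 n (Finset.mem_range.1 hn) hnj
    · intro h; exact absurd (Finset.mem_range.2 hj') h
  · rw [vec_eq_zero hj', smul_zero]
    exact Finset.sum_eq_zero fun n hn => h0 n (Finset.mem_range.1 hn) (by
      have := Finset.mem_range.1 hn; omega)

theorem absorb_neg_zero (hβ : ∀ t : ℤ, r.br (r.hw β + t) ≠ 0) (j : ℕ) :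
    r.absorb (-1) β (vec 2 0 ⊗ₜ[ℂ] vec r.N j)
      = (r.absorbNeg β * r.qint (r.hw β - j)) • vec r.N j := by
  have h2m : (2 * (1 : ℕ) : ℂ) = 1 - ((-1 : ℤˣ) : ℤ) := by push_cast; norm_num
  rcases Nat.lt_or_ge j r.N with hj | hj
  swap
  · rw [vec_eq_zero hj, TensorProduct.tmul_zero, map_zero, smul_zero]
  rw [r.absorb_vec_sum (-1) (by omega) hj, Finset.sum_eq_single j, r.coefES_neg_zero hj hβ]
  · rfl
  · intro n hn hnj
    rw [Finset.mem_range] at hn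
    rw [r.coefES_eq_zero (-1) h2m (by omega) hj hn (by omega), zero_smul]
  · intro h; exact absurd (Finset.mem_range.2 hj) h

theorem qint_add (z w : ℂ) : r.qint (z + w) = r.qint z * r.qp (-w) + r.qint w * r.qp z := by
  rw [qint_eq, qint_eq, qint_eq, br_add_eq]
  ring

/-- On basis vectors, two terms have to be combined only for E on e_1 ⊗ v_j and F on e_0 ⊗ v_j, and
there `qint_add` with one argument equal to 1 does it. The other cases compare exponents and factors
directly. The same holds for ε = −1. -/
theorem isHom_absorb_pos (hβ : ∀ t : ℤ, r.br (r.hw β + t) ≠ 0) :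
    IsHom (Rep.tensor r.q_ne_zero r.S₁ (r.V (β + ((1 : ℤˣ) : ℤ) * r.k))) (r.V β)
      (r.absorb 1 β) := by
  have hN := r.three_le
  have hl : r.hw (β + ((1 : ℤˣ) : ℤ) * r.k) = r.hw β + 1 := by rw [hw_add_int]; push_cast; ring
  refine IsHom.of_EFKH (ext_vec₂ fun ν hν j hj => ?_) (ext_vec₂ fun ν hν j hj => ?_)
    (ext_vec₂ fun ν hν j hj => ?_) (ext_vec₂ fun ν hν j hj => ?_) <;>
  rw [LinearMap.comp_apply, LinearMap.comp_apply]
  · rw [Rep.tensor_E, V_E _ _ hj, V_K, hl, TensorProduct.tmul_smul, TensorProduct.tmul_smul, map_add,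
      map_smul, map_smul]
    interval_cases ν
    · rw [S₁_E_zero, TensorProduct.zero_tmul, map_zero, smul_zero, add_zero,
        r.absorb_pos_zero hβ (by omega), r.absorb_pos_zero hβ (by omega), map_smul,
        V_E _ _ (by omega), smul_smul, smul_smul]
      congr 1
      rcases j with _ | j
      · simp [qint_zero]
      · rw [Nat.add_sub_cancel]
        push_cast
        rw [show r.hw β + 1 - ((j : ℂ) + 1) + 1 = r.hw β - j + 1 by ring]
        ring
    · rw [S₁_E_one, r.absorb_pos_zero hβ (by omega), r.absorb_pos_one hβ, r.absorb_pos_one hβ,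
        map_smul, V_E _ _ hj, smul_smul, smul_smul, smul_smul, ← add_smul]
      congr 1
      rcases j with _ | j
      · simp [qint_zero]
      · rw [Nat.add_sub_cancel]
        push_cast
        have e := r.qint_add (r.hw β - j) 1
        rw [qint_one, one_mul] at e
        rw [show r.hw β + 1 - ((j : ℂ) + 1) + 1 = r.hw β - j + 1 by ring, e,
          show r.hw β - ((j : ℂ) + 1) + 1 = r.hw β - j by ring,
          show r.hw β + 1 - 2 * ((j : ℂ) + 1) = (r.hw β - j) + (-1 - j) by ring,
          show -1 - ((j : ℂ) + 1) = -1 + (-1 - j) by ring, qp_add, qp_add]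
        ring
  · rw [Rep.tensor_F, V_F, S₁_Kinv, ← TensorProduct.smul_tmul', map_add, map_smul]
    interval_cases ν
    · rw [S₁_F_zero, r.absorb_pos_zero hβ (by omega), r.absorb_pos_zero hβ (by omega),
        r.absorb_pos_one hβ, map_smul, V_F, smul_smul, Nat.add_sub_cancel, ← add_smul]
      have h1 : (r.absorbPos β * r.qint j) • vec r.N (j - 1 + 1)
          = (r.absorbPos β * r.qint j) • vec r.N j := by
        rcases j with _ | j
        · simp [qint_zero]
        · rw [Nat.add_sub_cancel]
      rw [h1]
      congr 1
      have e := r.qint_add 1 j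
      rw [qint_one, one_mul] at e
      have e1 : r.qp (-1) * r.qp 1 = 1 := by rw [← qp_add, neg_add_cancel, qp_zero]
      push_cast
      rw [mul_zero, sub_zero, add_comm (j : ℂ) 1, e, sub_eq_add_neg (-1 : ℂ), qp_add]
      linear_combination r.absorbPos β * r.qint j * e1
    · rw [S₁_F_one, TensorProduct.zero_tmul, map_zero, add_zero, r.absorb_pos_one hβ,
        r.absorb_pos_one hβ, map_smul, V_F, smul_smul]
      congr 1
      rw [mul_neg, mul_left_comm, ← qp_add]
      push_cast
      ring_nf
  · rw [Rep.tensor_K, V_K, S₁_K, hl, TensorProduct.tmul_smul, ← TensorProduct.smul_tmul', map_smul,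
      map_smul, smul_smul, ← qp_add]
    interval_cases ν
    · rw [r.absorb_pos_zero hβ (by omega), map_smul, V_K, smul_smul, smul_smul]
      rcases j with _ | j
      · simp [qint_zero]
      · rw [mul_comm]
        congr 3
        push_cast [Nat.add_sub_cancel]
        ring
    · rw [r.absorb_pos_one hβ, map_smul, V_K, smul_smul, smul_smul, mul_comm]
      congr 3
      push_cast
      ring
  · rw [Rep.tensor_H, V_H, S₁_H, hl, TensorProduct.tmul_smul, ← TensorProduct.smul_tmul', map_add,
      map_smul, map_smul, ← add_smul]
    interval_cases ν
    · rw [r.absorb_pos_zero hβ (by omega), map_smul, V_H, smul_smul, smul_smul]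
      rcases j with _ | j
      · simp [qint_zero]
      · rw [mul_comm]
        congr 2
        push_cast [Nat.add_sub_cancel]
        ring
    · rw [r.absorb_pos_one hβ, map_smul, V_H, smul_smul, smul_smul, mul_comm]
      congr 2
      push_cast
      ring

theorem isHom_absorb_neg (hβ : ∀ t : ℤ, r.br (r.hw β + t) ≠ 0) :
    IsHom (Rep.tensor r.q_ne_zero r.S₁ (r.V (β + ((-1 : ℤˣ) : ℤ) * r.k))) (r.V β)
      (r.absorb (-1) β) := by
  have hN := r.three_le
  have hl : r.hw (β + ((-1 : ℤˣ) : ℤ) * r.k) = r.hw β - 1 := by rw [hw_add_int]; push_cast; ring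
  refine IsHom.of_EFKH (ext_vec₂ fun ν hν j hj => ?_) (ext_vec₂ fun ν hν j hj => ?_)
    (ext_vec₂ fun ν hν j hj => ?_) (ext_vec₂ fun ν hν j hj => ?_) <;>
  rw [LinearMap.comp_apply, LinearMap.comp_apply]
  · rw [Rep.tensor_E, V_E _ _ hj, V_K, hl, TensorProduct.tmul_smul, TensorProduct.tmul_smul, map_add,
      map_smul, map_smul]
    interval_cases ν
    · rw [S₁_E_zero, TensorProduct.zero_tmul, map_zero, smul_zero, add_zero,
        r.absorb_neg_zero hβ, r.absorb_neg_zero hβ, map_smul,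
        V_E _ _ (by omega), smul_smul, smul_smul]
      congr 1
      rcases j with _ | j
      · simp [qint_zero]
      · rw [Nat.add_sub_cancel]
        push_cast
        rw [show r.hw β - 1 - ((j : ℂ) + 1) + 1 = r.hw β - (j + 1) by ring,
          show r.hw β - ((j : ℂ) + 1) + 1 = r.hw β - j by ring]
        ring
    -- `hwRep_E` is used in place of `V_E` to include j + 1 = N, where v_N = 0 and [N] = 0.
    · have hE : r.V β (UqH.gen r.q .E) (vec r.N (j + 1))
          = (r.qint (j + 1 : ℕ) * r.qint (r.hw β - (j + 1 : ℕ) + 1)) • vec r.N j :=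
        r.hwRep_E _ (by omega)
      have h1 : (r.qint j * r.qint (r.hw β - 1 - j + 1)) •
            ((r.absorbNeg β * r.qp (r.hw β - 1 - (j - 1 : ℕ))) • vec r.N (j - 1 + 1))
          = (r.qint j * r.qint (r.hw β - 1 - j + 1)) •
            ((r.absorbNeg β * r.qp (r.hw β - j)) • vec r.N j) := by
        rcases j with _ | j
        · simp [qint_zero]
        · rw [Nat.add_sub_cancel, show r.hw β - 1 - j = r.hw β - (j + 1 : ℕ) by push_cast; ring]
      rw [S₁_E_one, r.absorb_neg_zero hβ, r.absorb_neg_one hβ, r.absorb_neg_one hβ,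
        map_smul, hE, h1, smul_smul, smul_smul, smul_smul, ← add_smul]
      congr 1
      have e := r.qint_add 1 j
      rw [qint_one, one_mul] at e
      push_cast
      rw [add_comm (j : ℂ) 1, e, show r.hw β - 1 - (j : ℂ) + 1 = r.hw β - j by ring,
        show r.hw β - (1 + (j : ℂ)) + 1 = r.hw β - j by ring,
        show r.hw β - 1 - 2 * (j : ℂ) = (r.hw β - 1 - j) + -j by ring,
        show r.hw β - j = (r.hw β - 1 - j) + 1 by ring, qp_add, qp_add]
      ring
  · rw [Rep.tensor_F, V_F, S₁_Kinv, ← TensorProduct.smul_tmul', map_add, map_smul]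
    interval_cases ν
    · rw [S₁_F_zero, r.absorb_neg_zero hβ, r.absorb_neg_zero hβ,
        r.absorb_neg_one hβ, map_smul, V_F, smul_smul, ← add_smul]
      congr 1
      have e := r.qint_add (r.hw β - (j + 1)) 1
      rw [qint_one, one_mul] at e
      push_cast
      rw [show r.hw β - j = r.hw β - (j + 1) + 1 by ring, e,
        show -(1 - 2 * (0 : ℂ)) = -1 by ring, show r.hw β - 1 - j = r.hw β - (j + 1) by ring]
      ring
    · rw [S₁_F_one, TensorProduct.zero_tmul, map_zero, add_zero, r.absorb_neg_one hβ,
        r.absorb_neg_one hβ, map_smul, V_F, smul_smul]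
      congr 1
      rw [mul_left_comm, ← qp_add]
      push_cast
      ring_nf
  · rw [Rep.tensor_K, V_K, S₁_K, hl, TensorProduct.tmul_smul, ← TensorProduct.smul_tmul', map_smul,
      map_smul, smul_smul, ← qp_add]
    interval_cases ν
    · rw [r.absorb_neg_zero hβ, map_smul, V_K, smul_smul, smul_smul, mul_comm]
      congr 3
      push_cast
      ring
    · rw [r.absorb_neg_one hβ, map_smul, V_K, smul_smul, smul_smul, mul_comm]
      congr 3
      push_cast
      ring
  · rw [Rep.tensor_H, V_H, S₁_H, hl, TensorProduct.tmul_smul, ← TensorProduct.smul_tmul', map_add,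
      map_smul, map_smul, ← add_smul]
    interval_cases ν
    · rw [r.absorb_neg_zero hβ, map_smul, V_H, smul_smul, smul_smul, mul_comm]
      congr 2
      push_cast
      ring
    · rw [r.absorb_neg_one hβ, map_smul, V_H, smul_smul, smul_smul, mul_comm]
      congr 2
      push_cast
      ring

end absorb

end RootData

namespace RootData

variable (r : RootData)

/-! ### Levels -/

section level

variable {r}
variable {α β γ : ℂ}

theorem br_hw_ne_zero (h : ∀ j : ℤ, α ≠ j / 2) (t : ℤ) : r.br (r.hw α + t) ≠ 0 := by
  have := r.br_ne_zero_of_not_half_int h (r.N - 1 + t)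
  rw [hw]
  push_cast at this
  convert this using 2
  ring

theorem br_hw_sub_nat_ne_zero (h : ∀ t : ℤ, r.br (r.hw α + t) ≠ 0) (t : ℕ) :
    r.br (r.hw α - t) ≠ 0 := by
  have := h (-t)
  push_cast at this
  rwa [← sub_eq_add_neg] at this

theorem br_hw_shift_ne_zero (h : ∀ t : ℤ, r.br (r.hw α + t) ≠ 0) (ε : ℤ) (t : ℤ) :
    r.br (r.hw (α + ε * r.k) + t) ≠ 0 := by
  have := h (ε + t)
  rw [hw_add_int]
  push_cast at this
  rwa [← add_assoc] at this

/-- Shifting a simple colour by a multiple of `k N / 2` keeps the quantum numbers below the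
highest weight non-zero. -/
theorem br_hw_ne_zero_of_simple (h : γ ∈ r.simpleColours) (n : ℤ) {t : ℕ} (ht : t < r.N - 1) :
    r.br (r.hw (γ + n * (r.k * r.N / 2)) - t) ≠ 0 := by
  have hk := r.k_ne_zero
  rw [r.br_congr (y := γ / r.k + ((r.N - 1 - t : ℤ) : ℂ)) n
    (by rw [hw]; push_cast; field_simp; ring)]
  refine r.br_ne_zero_of_simple h fun hd => ?_
  have := Int.le_of_dvd (by omega) hd
  omega

/-- Division by k/2 turns the equation into Nn + 4m = Nn' + 4m', and 4 is invertible modulo the odd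
number N. -/
theorem level_unique {m m' : ℕ} {n n' : ℤ} (hm : m < r.N) (hm' : m' < r.N)
    (h : (n * (r.k * r.N / 2) + r.k * (2 * m - (r.N - 1)) : ℂ)
      = n' * (r.k * r.N / 2) + r.k * (2 * m' - (r.N - 1))) : m = m' ∧ n = n' := by
  have h1 : (r.N : ℂ) * n + 4 * m = r.N * n' + 4 * m' := by
    refine mul_left_cancel₀ r.k_ne_zero ?_
    linear_combination 2 * h
  have h2 : (r.N : ℤ) * n + 4 * m = r.N * n' + 4 * m' := by exact_mod_cast h1
  have h3 : (r.N : ℤ) ∣ (m : ℤ) - m' :=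
    r.dvd_of_dvd_four_mul ⟨r.k' * (n' - n), by linear_combination r.k' * h2⟩
  have h4 : (m : ℤ) = m' := by
    have := Int.eq_zero_of_abs_lt_dvd h3 (by rw [abs_lt]; omega)
    omega
  refine ⟨by exact_mod_cast h4, ?_⟩
  rw [h4] at h2
  exact mul_left_cancel₀ (show (r.N : ℤ) ≠ 0 by have := r.three_le; omega) (by linarith)

/-- The equation to solve is s = Nn + 4m with s = j + 2(N − 1). A Bézout relation aN + 4b = 1
provides m as the residue of bs modulo N. -/
theorem exists_level (h : ∃ j : ℤ, α + β - γ = j * (r.k / 2)) : ∃ (m : ℕ) (n : ℤ), m < r.N ∧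
    α + β - γ = n * (r.k * r.N / 2) + r.k * (2 * m - (r.N - 1)) := by
  obtain ⟨j, hj⟩ := h
  have h3 := r.three_le
  have hN : (r.N : ℤ) ≠ 0 := by omega
  obtain ⟨a, b, hab⟩ : IsCoprime (r.N : ℤ) 4 := by
    have h2 : IsCoprime (r.N : ℤ) 2 := by
      rw [Int.isCoprime_iff_gcd_eq_one]
      have := r.odd.coprime_two_right
      exact_mod_cast this
    exact (IsCoprime.mul_right h2 h2 : IsCoprime (r.N : ℤ) (2 * 2))
  set s : ℤ := j + 2 * (r.N - 1) with hs
  have e1 := Int.emod_add_mul_ediv (b * s) r.N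
  have e2 := Int.emod_nonneg (b * s) hN
  have e3 := Int.emod_lt_of_pos (b * s) (show (0 : ℤ) < r.N by omega)
  obtain ⟨m, hm⟩ := Int.eq_ofNat_of_zero_le e2
  refine ⟨m, a * s + 4 * (b * s / r.N), by omega, ?_⟩
  have e4 : j = (a * s + 4 * (b * s / r.N)) * r.N + 2 * (2 * m - (r.N - 1)) := by
    rw [hm] at e1
    linear_combination -4 * e1 - s * hab - hs
  have e5 : (j : ℂ) = ((a * s + 4 * (b * s / r.N) : ℤ) : ℂ) * r.N + 2 * (2 * m - (r.N - 1)) := by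
    exact_mod_cast e4
  rw [hj]
  linear_combination r.k / 2 * e5

theorem shift_eq {m : ℕ} {n : ℤ} (hm : m < r.N)
    (h : α + β - γ = n * (r.k * r.N / 2) + r.k * (2 * m - (r.N - 1))) :
    r.shift α β γ = γ + n * (r.k * r.N / 2) := by
  have h3 := r.three_le
  have hex : ∃ n : ℤ, α + β - (γ + n * (r.k * r.N / 2)) ∈ r.HN := by
    -- H_N is indexed from the other end: t = N − 1 − m.
    refine ⟨n, r.N - 1 - m, by omega, ?_⟩
    rw [show r.N - 1 - m = r.N - (1 + m) by omega, Nat.cast_sub (by omega)]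
    push_cast
    linear_combination h
  obtain ⟨t, ht, he⟩ := hex.choose_spec
  have := (level_unique (r := r) (m := m) (m' := r.N - 1 - t) (n := n) (n' := hex.choose) hm
    (by omega) (by
      rw [← h, show r.N - 1 - t = r.N - (1 + t) by omega, Nat.cast_sub (by omega)]
      push_cast
      linear_combination he)).2
  rw [shift, dif_pos hex, ← this]

theorem level_of_eq {m : ℕ} (h : α + β - γ = r.k * (2 * m - (r.N - 1))) :
    (α + β - γ) / (2 * r.k) + ((r.N : ℂ) - 1) / 2 = m := by
  have hk := r.k_ne_zero
  rw [h]
  field_simp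
  ring

end level

/-! ### Highest weight vectors in a tensor product -/

/-- A highest weight vector in `V_α ⊗ V_β` is determined by its coordinate along `v_0 ⊗ v_m`. -/
theorem eq_zero_of_highest {α β l : ℂ} (hα : ∀ t : ℤ, r.br (r.hw α + t) ≠ 0)
    {t : (Fin r.N → ℂ) ⊗[ℂ] (Fin r.N → ℂ)}
    (hE : Rep.tensor r.q_ne_zero (r.V α) (r.V β) (UqH.gen r.q .E) t = 0)
    (hH : Rep.tensor r.q_ne_zero (r.V α) (r.V β) (UqH.gen r.q .H) t = l • t)
    (h0 : ∀ j < r.N, l = r.hw α + r.hw β - 2 * j → coord r.N r.N 0 j t = 0) : t = 0 := by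
  have h3 := r.three_le
  have key : ∀ i j : ℕ, coord r.N r.N i j t = 0 := by
    intro i
    induction i with
    | zero =>
      intro j
      rcases lt_or_ge j r.N with hj | hj
      · by_cases hl : l = r.hw α + r.hw β - 2 * j
        · exact h0 j hj hl
        · have := congrArg (coord r.N r.N 0 j) hH
          rw [V, V, coord_H, map_smul, smul_eq_mul] at this
          by_contra hc
          have h5 := mul_right_cancel₀ hc this
          apply hl
          rw [← h5, hw, hw]
          push_cast
          ring
      · exact coord_eq_zero (Or.inr hj) t
    | succ i ih =>
      intro j
      by_cases hij : r.N ≤ i + 1 ∨ r.N ≤ j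
      · exact coord_eq_zero hij t
      · push Not at hij
        -- The coordinate (i, j) of E t = 0 has two terms: the one at (i, j + 1) is zero by
        -- induction, and the one at (i + 1, j) has a non-zero coefficient.
        have := congrArg (coord r.N r.N i j) hE
        rw [V, V, coord_E _ _ _ _ _ _ (by omega) hij.2, ih, mul_zero, zero_add, map_zero] at this
        refine (mul_eq_zero.1 this).resolve_left (mul_ne_zero (mul_ne_zero ?_ ?_)
          (r.qp_ne_zero _))
        · have := r.qint_ne_zero (r.br_nat_ne_zero (n := i + 1) (by omega) (by omega))
          exact_mod_cast this
        · exact r.qint_ne_zero (br_hw_sub_nat_ne_zero hα i)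
  refine coord_ext fun i _ j _ => ?_
  rw [key, map_zero]

end RootData

namespace RootData

variable (r : RootData)

/-! ### The leading coefficient of a vertex -/

/-- The quantum falling factorial `[x] [x - 1] ⋯ [x - m + 1]`. -/
def qfall (x : ℂ) (m : ℕ) : ℂ := ∏ t ∈ Finset.range m, r.qint (x - t)

theorem qfall_succ (x : ℂ) (m : ℕ) : r.qfall x (m + 1) = r.qfall x m * r.qint (x - m) := by
  rw [qfall, Finset.prod_range_succ, qfall]

theorem qfall_succ' (x : ℂ) (m : ℕ) : r.qfall (x + 1) (m + 1) = r.qint (x + 1) * r.qfall x m := by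
  rw [qfall, Finset.prod_range_succ', qfall, mul_comm]
  congr 1
  · simp
  · refine Finset.prod_congr rfl fun t _ => ?_
    congr 1
    push_cast
    ring

theorem qfall_ne_zero {x : ℂ} {m : ℕ} (h : ∀ t < m, r.br (x - t) ≠ 0) : r.qfall x m ≠ 0 :=
  Finset.prod_ne_zero_iff.2 fun t ht => r.qint_ne_zero (h t (Finset.mem_range.1 ht))

variable {r}

/-- Beyond the level, α does not enter; hence the comparisons of leading coefficients below allow an
arbitrary α'. -/
theorem coefD_leading {α β γ : ℂ} {m : ℕ}
    (hm : (α + β - γ) / (2 * r.k) + ((r.N : ℂ) - 1) / 2 = m) (hmN : m < r.N) :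
    r.coefD α β γ 0 m 0 = (-1) ^ m * r.qp (m * (r.hw β - m + 1))
      * r.qbin (r.hw γ) (r.N - 1 - m) / r.qfall (r.hw β) m := by
  rw [coefD_base r hm (zero_add m), qbin_self r hmN, kappa_zero, kappa_eq, ← qfall, one_mul,
    mul_one]
  have h := r.qp_ne_zero (-((m : ℂ) / 2) * r.hw β + (m : ℂ) * (m - 1) / 2)
  have e : r.qp (m * (r.hw β - m + 1)) * r.qp (-((m : ℂ) / 2) * r.hw β + (m : ℂ) * (m - 1) / 2)
      = r.qp (((m : ℂ) * (β / r.k - m) - ((0 : ℕ) : ℂ) * (α / r.k - (0 : ℕ))) / 2) := by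
    rw [← qp_add]
    refine r.qp_congr m ?_
    rw [div_k]
    push_cast
    ring
  rw [← e]
  generalize r.qp (-((m : ℂ) / 2) * r.hw β + (m : ℂ) * (m - 1) / 2) = x at h ⊢
  field_simp

/-! ### The triangle at a given colour of the bottom edge -/

/-- The vertex `V_γ → V_α ⊗ V_β` for `α + β - γ ∈ H_N`. -/
def vertexAt (r : RootData) (α β γ : ℂ) :
    (Fin r.N → ℂ) →ₗ[ℂ] (Fin r.N → ℂ) ⊗[ℂ] (Fin r.N → ℂ) :=
  lin r.N fun n => ∑ i ∈ Finset.range r.N, ∑ j ∈ Finset.range r.N,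
    r.coefD α β γ i j n • (vec r.N i ⊗ₜ[ℂ] vec r.N j)

/-- The morphism `V_{α+ε₁k} ⊗ V_{β+ε₂k} → V_α ⊗ V_β` of the triangle. -/
def exchange (r : RootData) (ε₁ ε₂ : ℤˣ) (α β : ℂ) :
    (Fin r.N → ℂ) ⊗[ℂ] (Fin r.N → ℂ) →ₗ[ℂ] (Fin r.N → ℂ) ⊗[ℂ] (Fin r.N → ℂ) :=
  (r.absorb ε₂ β).lTensor (Fin r.N → ℂ)
    ∘ₗ (TensorProduct.assoc ℂ (Fin r.N → ℂ) (Fin 2 → ℂ) (Fin r.N → ℂ)).toLinearMap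
    ∘ₗ (r.emit ε₁ α).rTensor (Fin r.N → ℂ)

theorem triangle_eq {ε₁ ε₂ : ℤˣ} {α β γ γ' : ℂ}
    (h : r.shift (α + (ε₁ : ℤ) * r.k) (β + (ε₂ : ℤ) * r.k) γ = γ') :
    r.triangle ε₁ ε₂ α β γ = r.exchange ε₁ ε₂ α β
      ∘ₗ r.vertexAt (α + (ε₁ : ℤ) * r.k) (β + (ε₂ : ℤ) * r.k) γ' := by
  rw [triangle, vertex, h, exchange, vertexAt]
  rfl

section generic

variable {α β γ : ℂ} (hα : ∀ t : ℤ, r.br (r.hw α + t) ≠ 0) (hβ : ∀ t : ℤ, r.br (r.hw β + t) ≠ 0)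

include hα in
theorem isHom_emit (ε : ℤˣ) : IsHom (r.V (α + (ε : ℤ) * r.k))
    (Rep.tensor r.q_ne_zero (r.V α) r.S₁) (r.emit ε α) := by
  rcases Int.units_eq_one_or ε with rfl | rfl
  · exact r.isHom_emit_pos (fun t _ => br_hw_sub_nat_ne_zero hα t) (fun t _ => by
      have := hα (1 - t)
      push_cast at this
      rwa [← add_sub_assoc] at this)
  · exact r.isHom_emit_neg (fun t _ => br_hw_sub_nat_ne_zero hα t) (fun t _ => by
      have := hα (-1 - t)
      push_cast at this
      rwa [← add_sub_assoc, ← sub_eq_add_neg] at this)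

include hβ in
theorem isHom_absorb (ε : ℤˣ) : IsHom (Rep.tensor r.q_ne_zero r.S₁ (r.V (β + (ε : ℤ) * r.k)))
    (r.V β) (r.absorb ε β) := by
  rcases Int.units_eq_one_or ε with rfl | rfl
  · exact r.isHom_absorb_pos hβ
  · exact r.isHom_absorb_neg hβ

include hα hβ in
theorem isHom_exchange (ε₁ ε₂ : ℤˣ) : IsHom
    (Rep.tensor r.q_ne_zero (r.V (α + (ε₁ : ℤ) * r.k)) (r.V (β + (ε₂ : ℤ) * r.k)))
    (Rep.tensor r.q_ne_zero (r.V α) (r.V β)) (r.exchange ε₁ ε₂ α β) :=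
  ((IsHom.lTensor r.q_ne_zero (isHom_absorb hβ ε₂)).comp
    (IsHom.assoc r.q_ne_zero _ _ _)).comp (IsHom.rTensor r.q_ne_zero (isHom_emit hα ε₁))

include hα hβ in
theorem isHom_vertexAt {m : ℕ} (hm : (α + β - γ) / (2 * r.k) + ((r.N : ℂ) - 1) / 2 = m)
    (hmN : m < r.N) (hγ : ∀ t < r.N - 1, r.br (r.hw γ - t) ≠ 0) :
    IsHom (r.V γ) (Rep.tensor r.q_ne_zero (r.V α) (r.V β)) (r.vertexAt α β γ) :=
  isHom_lin_coefD r hm hmN (fun t _ => br_hw_sub_nat_ne_zero hα t)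
    (fun t _ => br_hw_sub_nat_ne_zero hβ t) hγ

theorem coord_vertexAt_zero {i j : ℕ} (hi : i < r.N) (hj : j < r.N) :
    coord r.N r.N i j (r.vertexAt α β γ (vec r.N 0)) = r.coefD α β γ i j 0 := by
  have := r.three_le
  rw [vertexAt, lin_vec _ (by omega), coord_sum hi hj]

include hβ in
-- The binomial in γ has N − 1 − m ≤ N − 1 factors, all among those that `hγ` keeps away from zero.
theorem coefD_leading_ne_zero {m : ℕ} (hm : (α + β - γ) / (2 * r.k) + ((r.N : ℂ) - 1) / 2 = m)
    (hmN : m < r.N) (hγ : ∀ t < r.N - 1, r.br (r.hw γ - t) ≠ 0) :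
    r.coefD α β γ 0 m 0 ≠ 0 := by
  have := r.three_le
  rw [coefD_leading hm hmN]
  refine div_ne_zero (mul_ne_zero (mul_ne_zero (pow_ne_zero _ (by norm_num)) (r.qp_ne_zero _))
    (r.qbin_ne_zero (by omega) fun t ht => hγ t (by omega)))
    (r.qfall_ne_zero fun t _ => br_hw_sub_nat_ne_zero hβ t)

include hα hβ in
/-- A morphism `V_γ → V_α ⊗ V_β` is a multiple of the vertex. -/
theorem eq_smul_vertexAt {m : ℕ} (hm : (α + β - γ) / (2 * r.k) + ((r.N : ℂ) - 1) / 2 = m)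
    (hmN : m < r.N) (hγ : ∀ t < r.N - 1, r.br (r.hw γ - t) ≠ 0)
    {f : (Fin r.N → ℂ) →ₗ[ℂ] (Fin r.N → ℂ) ⊗[ℂ] (Fin r.N → ℂ)}
    (hf : IsHom (r.V γ) (Rep.tensor r.q_ne_zero (r.V α) (r.V β)) f) :
    f = (coord r.N r.N 0 m (f (vec r.N 0)) / r.coefD α β γ 0 m 0) • r.vertexAt α β γ := by
  have h3 := r.three_le
  have hv := isHom_vertexAt hα hβ hm hmN hγ
  have hD := coefD_leading_ne_zero hβ hm hmN hγ
  set s := coord r.N r.N 0 m (f (vec r.N 0)) / r.coefD α β γ 0 m 0 with hs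
  have hg : IsHom (r.V γ) (Rep.tensor r.q_ne_zero (r.V α) (r.V β)) (f - s • r.vertexAt α β γ) :=
    fun u => by
      rw [LinearMap.sub_comp, LinearMap.comp_sub, hf u, LinearMap.smul_comp, LinearMap.comp_smul,
        hv u]
  have h0 : (f - s • r.vertexAt α β γ) (vec r.N 0) = 0 := by
    refine r.eq_zero_of_highest hα (β := β) (l := r.hw γ) ?_ ?_ ?_
    · rw [← hg.apply, V_E _ _ (by omega)]
      simp [qint_zero]
    · rw [← hg.apply, V_H, map_smul]
      simp
    · intro j hj hl
      -- The weight hw γ forces j = m, the coordinate that s was chosen to cancel.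
      have hjm : j = m := by
        have := hw_level r hm
        have h2 : (j : ℂ) = m := by linear_combination (hl - this) / 2
        exact_mod_cast h2
      subst hjm
      rw [LinearMap.sub_apply, LinearMap.smul_apply, map_sub, map_smul,
        coord_vertexAt_zero (by omega) hj, hs, smul_eq_mul, div_mul_cancel₀ _ hD, sub_self]
  have h1 : f - s • r.vertexAt α β γ = 0 := r.hom_ext_of_hw _ hg (fun u => by simp) (by
    rw [h0, LinearMap.zero_apply])
  exact sub_eq_zero.1 h1

include hα in
/-- There is no non-zero morphism `V_γ → V_α ⊗ V_β` unless the colours are at a level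
`0, …, N - 1`. -/
theorem eq_zero_of_no_level
    (hm : ∀ j < r.N, r.hw γ ≠ r.hw α + r.hw β - 2 * j)
    {f : (Fin r.N → ℂ) →ₗ[ℂ] (Fin r.N → ℂ) ⊗[ℂ] (Fin r.N → ℂ)}
    (hf : IsHom (r.V γ) (Rep.tensor r.q_ne_zero (r.V α) (r.V β)) f) : f = 0 := by
  have h3 := r.three_le
  refine r.hom_ext_of_hw _ hf (fun u => by simp) ?_
  rw [LinearMap.zero_apply]
  refine r.eq_zero_of_highest hα (β := β) (l := r.hw γ) ?_ ?_ fun j hj h => absurd h (hm j hj)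
  · rw [← hf.apply, V_E _ _ (by omega)]
    simp [qint_zero]
  · rw [← hf.apply, V_H, map_smul]
    simp

end generic

end RootData

namespace RootData

variable {r : RootData}

/-! ### The leading coefficient of the triangle -/

theorem coord_vec_of_lt {d e i j : ℕ} (a b : ℕ) (hi : i < d) (hj : j < e) :
    coord d e i j (vec d a ⊗ₜ vec e b) = if a = i ∧ b = j then 1 else 0 := by
  rcases lt_or_ge a d with ha | ha
  · rcases lt_or_ge b e with hb | hb
    · exact coord_vec i j ha hb
    · rw [vec_eq_zero hb, TensorProduct.tmul_zero, map_zero, if_neg (by omega)]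
  · rw [vec_eq_zero ha, TensorProduct.zero_tmul, map_zero, if_neg (by omega)]

theorem coord_tmul_eq_zero {d e i j a : ℕ} (h : a ≠ i) (w : Fin e → ℂ) :
    coord d e i j (vec d a ⊗ₜ w) = 0 := by
  have : coord d e i j ∘ₗ TensorProduct.mk ℂ (Fin d → ℂ) (Fin e → ℂ) (vec d a) = 0 :=
    ext_vec fun b hb => by
      rcases lt_or_ge a d with ha | ha
      · simp [coord_vec i j ha hb, h]
      · simp [vec_eq_zero ha]
  exact LinearMap.congr_fun this w

/-- At level m, row i has the single entry j = m − i. The condition on L is met by the coordinate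
along v_0 ⊗ v_m after `exchange`, which lowers the first index by at most one. -/
theorem apply_vertexAt_zero {α β γ : ℂ} {m : ℕ}
    (hm : (α + β - γ) / (2 * r.k) + ((r.N : ℂ) - 1) / 2 = m) (hmN : m < r.N)
    {L : (Fin r.N → ℂ) ⊗[ℂ] (Fin r.N → ℂ) →ₗ[ℂ] ℂ}
    (hL : ∀ i < r.N, ∀ j < r.N, 2 ≤ i → L (vec r.N i ⊗ₜ vec r.N j) = 0) :
    L (r.vertexAt α β γ (vec r.N 0)) = r.coefD α β γ 0 m 0 * L (vec r.N 0 ⊗ₜ vec r.N m)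
      + if 1 ≤ m then r.coefD α β γ 1 (m - 1) 0 * L (vec r.N 1 ⊗ₜ vec r.N (m - 1)) else 0 := by
  have h3 := r.three_le
  have hrow : ∀ i < r.N, ∑ j ∈ Finset.range r.N,
      r.coefD α β γ i j 0 * L (vec r.N i ⊗ₜ vec r.N j)
      = if i ≤ m then r.coefD α β γ i (m - i) 0 * L (vec r.N i ⊗ₜ vec r.N (m - i)) else 0 := by
    intro i hi
    split_ifs with him
    · refine Finset.sum_eq_single (m - i) (fun j _ hj => ?_) fun h => ?_
      · rw [coefD_eq_zero r hm (by omega), zero_mul]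
      · exact absurd (Finset.mem_range.2 (by omega)) h
    · refine Finset.sum_eq_zero fun j _ => ?_
      rw [coefD_eq_zero r hm (by omega), zero_mul]
  rw [vertexAt, lin_vec _ (by omega)]
  simp only [map_sum, map_smul, smul_eq_mul]
  have hsum : ∀ g : ℕ → ℂ, (∀ i < r.N, 2 ≤ i → g i = 0) →
      ∑ i ∈ Finset.range r.N, g i = g 0 + g 1 := by
    intro g hg
    rw [show r.N = (r.N - 2) + 1 + 1 by omega, Finset.sum_range_succ', Finset.sum_range_succ',
      Finset.sum_eq_zero, zero_add, zero_add, add_comm]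
    intro i hi
    rw [Finset.mem_range] at hi
    exact hg _ (by omega) (by omega)
  rw [Finset.sum_congr rfl fun i hi => hrow i (Finset.mem_range.1 hi), hsum]
  · rw [if_pos (Nat.zero_le m), Nat.sub_zero]
  · intro i hi h2
    split_ifs
    · rw [hL _ hi _ (by omega) h2, mul_zero]
    · rfl

section generic

variable {α β : ℂ} (hα : ∀ t : ℤ, r.br (r.hw α + t) ≠ 0) (hβ : ∀ t : ℤ, r.br (r.hw β + t) ≠ 0)

include hα in
theorem exchange_pos_vec (ε : ℤˣ) {i : ℕ} (hi : i < r.N) (j : ℕ) :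
    r.exchange 1 ε α β (vec r.N i ⊗ₜ vec r.N j) = (-(r.qint (r.hw α + 1) / r.kappaS 0)) •
      (vec r.N i ⊗ₜ[ℂ] r.absorb ε β (vec 2 0 ⊗ₜ vec r.N j) + (r.qp (i - 1 - r.hw α) * r.qint i) •
        (vec r.N (i - 1) ⊗ₜ[ℂ] r.absorb ε β (vec 2 1 ⊗ₜ vec r.N j))) := by
  simp only [exchange, LinearMap.comp_apply, LinearMap.rTensor_tmul]
  rw [r.emit_pos_vec hi (fun t _ => br_hw_sub_nat_ne_zero hα t) (fun t _ => by
      have := hα (1 - t)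
      push_cast at this
      rwa [← add_sub_assoc] at this)]
  simp only [TensorProduct.add_tmul, ← TensorProduct.smul_tmul', map_smul, map_add,
    LinearEquiv.coe_coe, TensorProduct.assoc_tmul, LinearMap.lTensor_tmul]

include hα in
theorem exchange_neg_vec (ε : ℤˣ) {i : ℕ} (hi : i < r.N) (j : ℕ) :
    r.exchange (-1) ε α β (vec r.N i ⊗ₜ vec r.N j) = (1 / (r.qint (r.hw α) * r.kappaS 0)) •
      (vec r.N (i + 1) ⊗ₜ[ℂ] r.absorb ε β (vec 2 0 ⊗ₜ vec r.N j)
        - (r.qp (i + 1) * r.qint (r.hw α - i)) •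
        (vec r.N i ⊗ₜ[ℂ] r.absorb ε β (vec 2 1 ⊗ₜ vec r.N j))) := by
  simp only [exchange, LinearMap.comp_apply, LinearMap.rTensor_tmul]
  rw [r.emit_neg_vec hi (fun t _ => br_hw_sub_nat_ne_zero hα t) (fun t _ => by
      have := hα (-1 - t)
      push_cast at this
      rwa [← add_sub_assoc, ← sub_eq_add_neg] at this)]
  simp only [TensorProduct.sub_tmul, ← TensorProduct.smul_tmul', map_smul, map_sub,
    LinearEquiv.coe_coe, TensorProduct.assoc_tmul, LinearMap.lTensor_tmul]

/-- The coefficient of the triangle along `v_0 ⊗ v_m`, over that of the vertex. -/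
def ratioAt (r : RootData) (ε₁ ε₂ : ℤˣ) (α β γ : ℂ) (m : ℕ) : ℂ :=
  coord r.N r.N 0 m (r.exchange ε₁ ε₂ α β
    (r.vertexAt (α + (ε₁ : ℤ) * r.k) (β + (ε₂ : ℤ) * r.k) γ (vec r.N 0))) / r.coefD α β γ 0 m 0

variable {γ : ℂ} {m : ℕ}

theorem level_add {m m' : ℕ} {ε₁ ε₂ : ℤ} (h : (2 * m' : ℤ) = 2 * m + ε₁ + ε₂)
    (hm : (α + β - γ) / (2 * r.k) + ((r.N : ℂ) - 1) / 2 = m) :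
    (α + ε₁ * r.k + (β + ε₂ * r.k) - γ) / (2 * r.k) + ((r.N : ℂ) - 1) / 2 = m' := by
  have hk := r.k_ne_zero
  have h' : (2 * m' : ℂ) = 2 * m + ε₁ + ε₂ := by exact_mod_cast h
  field_simp at hm ⊢
  linear_combination hm - r.k * h'

/-- This compares the binomials in γ that occur in `coefD_leading` at levels m − 1 and m. Reducing
{N − m} modulo N/2 produces the sign. -/
theorem qbin_N_sub (x : ℂ) {m : ℕ} (h1 : 1 ≤ m) (hm : m < r.N) :
    r.br m * r.qbin x (r.N - m) = -(r.br (x + m + 1) * r.qbin x (r.N - 1 - m)) := by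
  have h := r.qbin_succ x (d := r.N - 1 - m) (by omega)
  rw [show r.N - 1 - m + 1 = r.N - m by omega,
    show ((r.N - 1 - m : ℕ) : ℂ) = r.N - 1 - m by
      rw [show r.N - 1 - m = r.N - (1 + m) by omega, Nat.cast_sub (by omega)]; push_cast; ring,
    r.br_congr (x := (r.N : ℂ) - 1 - m + 1) (y := -m) 2 (by push_cast; ring), br_neg,
    r.br_congr (x := x - (r.N - 1 - m)) (y := x + m + 1) (-2) (by push_cast; ring)] at h
  linear_combination -h

/-! ### Leading coefficients after replacing β by β ± k -/

section leading

variable {γ : ℂ} {m : ℕ} (hm : (α + β - γ) / (2 * r.k) + ((r.N : ℂ) - 1) / 2 = m) (hmN : m < r.N)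

include hβ hm hmN

/-- γ and the level are unchanged, so only a power of q and the falling factorial in β move; the old
and new falling factorials share all but one factor. -/
theorem coefD_leading_pos {α' : ℂ}
    (hm' : (α' + (β + ((1 : ℤˣ) : ℤ) * r.k) - γ) / (2 * r.k) + ((r.N : ℂ) - 1) / 2 = m) :
    r.coefD α' (β + ((1 : ℤˣ) : ℤ) * r.k) γ 0 m 0
      = r.qp m * r.qint (r.hw β - m + 1) / r.qint (r.hw β + 1) * r.coefD α β γ 0 m 0 := by
  have e1 := r.qfall_succ' (r.hw β) m
  rw [qfall_succ, show r.hw β + 1 - m = r.hw β - m + 1 by ring] at e1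
  have h5 : r.qint (r.hw β + 1) ≠ 0 := r.qint_ne_zero (by simpa using hβ 1)
  have h6 : r.qfall (r.hw β) m ≠ 0 := r.qfall_ne_zero fun t _ => br_hw_sub_nat_ne_zero hβ t
  have h7 : r.qfall (r.hw β + 1) m ≠ 0 := by
    intro h
    rw [h, zero_mul] at e1
    exact mul_ne_zero h5 h6 e1.symm
  rw [coefD_leading hm hmN, coefD_leading hm' hmN, hw_add_int]
  simp only [Units.val_one, Int.cast_one]
  rw [show (m : ℂ) * (r.hw β + 1 - m + 1) = m + m * (r.hw β - m + 1) by ring, qp_add]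
  rw [div_mul_div_comm, div_eq_div_iff h7 (mul_ne_zero h5 h6)]
  linear_combination -((-1) ^ m * (r.qp m * r.qp (m * (r.hw β - m + 1)))
    * r.qbin (r.hw γ) (r.N - 1 - m)) * e1

theorem coefD_leading_neg {α' : ℂ}
    (hm' : (α' + (β + ((-1 : ℤˣ) : ℤ) * r.k) - γ) / (2 * r.k) + ((r.N : ℂ) - 1) / 2 = m) :
    r.coefD α' (β + ((-1 : ℤˣ) : ℤ) * r.k) γ 0 m 0
      = r.qp (-m) * r.qint (r.hw β) / r.qint (r.hw β - m) * r.coefD α β γ 0 m 0 := by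
  have e1 := r.qfall_succ' (r.hw β - 1) m
  rw [sub_add_cancel, qfall_succ] at e1
  have h5 : r.qint (r.hw β - m) ≠ 0 := r.qint_ne_zero (br_hw_sub_nat_ne_zero hβ m)
  have h6 : r.qfall (r.hw β) m ≠ 0 := r.qfall_ne_zero fun t _ => br_hw_sub_nat_ne_zero hβ t
  have h7 : r.qfall (r.hw β - 1) m ≠ 0 := by
    intro h
    rw [h, mul_zero] at e1
    exact mul_ne_zero h6 h5 e1
  rw [coefD_leading hm hmN, coefD_leading hm' hmN, hw_add_int]
  simp only [Units.val_neg, Units.val_one, Int.cast_neg, Int.cast_one, ← sub_eq_add_neg]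
  rw [show (m : ℂ) * (r.hw β - 1 - m + 1) = -m + m * (r.hw β - m + 1) by ring, qp_add]
  rw [div_mul_div_comm, div_eq_div_iff h7 (mul_ne_zero h5 h6)]
  linear_combination ((-1) ^ m * (r.qp (-m) * r.qp (m * (r.hw β - m + 1)))
    * r.qbin (r.hw γ) (r.N - 1 - m)) * e1

/-- The level rises to m + 1, so the binomial in γ changes as well and contributes through
`qbin_N_sub`. -/
theorem coefD_leading_pos_succ {α' : ℂ} (hmN' : m + 1 < r.N)
    (hc : r.qint (r.hw α + r.hw β - m + 2) ≠ 0)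
    (hm' : (α' + (β + ((1 : ℤˣ) : ℤ) * r.k) - γ) / (2 * r.k) + ((r.N : ℂ) - 1) / 2
      = (m + 1 : ℕ)) :
    r.coefD α' (β + ((1 : ℤˣ) : ℤ) * r.k) γ 0 (m + 1) 0
      = r.qp (r.hw β + 1 - m) * r.qint (m + 1)
        / (r.qint (r.hw α + r.hw β - m + 2) * r.qint (r.hw β + 1)) * r.coefD α β γ 0 m 0 := by
  have h5 : r.qint (r.hw β + 1) ≠ 0 := r.qint_ne_zero (by simpa using hβ 1)
  have h6 : r.qfall (r.hw β) m ≠ 0 := r.qfall_ne_zero fun t _ => br_hw_sub_nat_ne_zero hβ t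
  have hq := r.qbin_N_sub (r.hw γ) (m := m + 1) (by omega) hmN'
  rw [show r.N - (m + 1) = r.N - 1 - m by omega, hw_level r hm] at hq
  rw [coefD_leading hm hmN, coefD_leading hm' hmN', hw_add_int, hw_level r hm]
  simp only [Units.val_one, Int.cast_one, qfall_succ']
  push_cast at hq ⊢
  rw [show r.hw α + r.hw β - 2 * m + (m + 1) + 1 = r.hw α + r.hw β - m + 2 by ring] at hq
  rw [show ((m : ℂ) + 1) * (r.hw β + 1 - (m + 1) + 1)
    = (r.hw β + 1 - m) + m * (r.hw β - m + 1) by ring, qp_add, pow_succ]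
  have h1 := r.br_one_ne_zero
  have hc' := hc
  rw [qint_eq] at hc'
  rw [r.qint_eq (r.hw α + r.hw β - m + 2), r.qint_eq (m + 1)]
  have hc2 : r.br (r.hw α + r.hw β - m + 2) ≠ 0 := fun h => hc' (by rw [h, zero_div])
  generalize r.qp (r.hw β + 1 - m) = x
  generalize r.qp (m * (r.hw β - m + 1)) = y
  generalize r.hw α + r.hw β - 2 * m = c at hq ⊢
  field_simp
  linear_combination -(x * y) * hq

theorem coefD_leading_neg_pred {α' : ℂ} {p : ℕ} (hp : m = p + 1)
    (hm' : (α' + (β + ((-1 : ℤˣ) : ℤ) * r.k) - γ) / (2 * r.k) + ((r.N : ℂ) - 1) / 2 = p) :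
    r.coefD α' (β + ((-1 : ℤˣ) : ℤ) * r.k) γ 0 p 0
      = r.qp (-(r.hw β - m + 1)) * r.qint (r.hw α + r.hw β - m + 1) * r.qint (r.hw β)
        / r.qint m * r.coefD α β γ 0 m 0 := by
  have h5 : r.qint (r.hw β) ≠ 0 := r.qint_ne_zero (by simpa using hβ 0)
  have h6 : r.qfall (r.hw β) m ≠ 0 := r.qfall_ne_zero fun t _ => br_hw_sub_nat_ne_zero hβ t
  have hq := r.qbin_N_sub (r.hw γ) (m := m) (by omega) hmN
  have e1 := r.qfall_succ' (r.hw β - 1) p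
  rw [sub_add_cancel, ← hp] at e1
  have h7 : r.qfall (r.hw β - 1) p ≠ 0 := by
    intro h
    rw [h, mul_zero] at e1
    exact h6 e1
  have h8 : r.br m ≠ 0 := r.br_nat_ne_zero (by omega) hmN
  rw [hw_level r hm, show r.hw α + r.hw β - 2 * m + m + 1 = r.hw α + r.hw β - m + 1 by ring] at hq
  rw [coefD_leading hm hmN, coefD_leading hm' (by omega), hw_add_int, hw_level r hm]
  simp only [Units.val_neg, Units.val_one, Int.cast_neg, Int.cast_one, ← sub_eq_add_neg]
  rw [e1, show r.N - 1 - p = r.N - m by omega]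
  have hpc : (p : ℂ) = m - 1 := by rw [hp]; push_cast; ring
  have hpow : (-1 : ℂ) ^ m = -(-1) ^ p := by rw [hp, pow_succ]; ring
  rw [hpc, hpow, show ((m : ℂ) - 1) * (r.hw β - 1 - (m - 1) + 1)
    = -(r.hw β - m + 1) + m * (r.hw β - m + 1) by ring, qp_add]
  have h1 := r.br_one_ne_zero
  rw [r.qint_eq (r.hw α + r.hw β - m + 1), r.qint_eq m]
  generalize r.qp (-(r.hw β - m + 1)) = x
  generalize r.qp (m * (r.hw β - m + 1)) = y
  field_simp
  linear_combination x * y * hq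

end leading

/-! ### Closed forms of the ratio for the four sign choices -/

section values

variable {γ : ℂ} {m : ℕ} (hm : (α + β - γ) / (2 * r.k) + ((r.N : ℂ) - 1) / 2 = m) (hmN : m < r.N)
  (hγ : ∀ t < r.N - 1, r.br (r.hw γ - t) ≠ 0)

include hα in
-- For ε₁ = −1 emission never lowers the first index, so v_0 ⊗ v_m is reached only from v_0 ⊗
-- v_{m'}, through the e_1 term.
theorem ratioAt_neg (ε : ℤˣ) {m' : ℕ} (hmN' : m' < r.N)
    (hm' : (α + ((-1 : ℤˣ) : ℤ) * r.k + (β + (ε : ℤ) * r.k) - γ) / (2 * r.k)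
      + ((r.N : ℂ) - 1) / 2 = m') :
    r.ratioAt (-1) ε α β γ m
      = r.coefD (α + ((-1 : ℤˣ) : ℤ) * r.k) (β + (ε : ℤ) * r.k) γ 0 m' 0
        * (-(r.qp 1 / r.kappaS 0)
          * coord r.N r.N 0 m (vec r.N 0 ⊗ₜ r.absorb ε β (vec 2 1 ⊗ₜ vec r.N m')))
        / r.coefD α β γ 0 m 0 := by
  have h3 := r.three_le
  have h1 := r.kappaS_ne_zero (ν := 0) (by omega)
  have h2 : r.qint (r.hw α) ≠ 0 := r.qint_ne_zero (by simpa using hα 0)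
  have hL : ∀ i < r.N, i ≠ 0 → ∀ j, (coord r.N r.N 0 m ∘ₗ r.exchange (-1) ε α β)
      (vec r.N i ⊗ₜ vec r.N j) = 0 := fun i hi h0 j => by
    rw [LinearMap.comp_apply, exchange_neg_vec hα ε hi, map_smul, map_sub, map_smul,
      coord_tmul_eq_zero (by omega), coord_tmul_eq_zero h0, smul_zero, sub_zero, smul_zero]
  rw [ratioAt, ← LinearMap.comp_apply, apply_vertexAt_zero hm' hmN'
    (fun i hi j _ h => hL i hi (by omega) j), hL 1 (by omega) (by omega), mul_zero, ite_self,
    add_zero, LinearMap.comp_apply, exchange_neg_vec hα ε (by omega), map_smul, map_sub, map_smul,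
    coord_tmul_eq_zero (by omega)]
  congr 2
  simp only [smul_eq_mul, Nat.cast_zero, zero_add, sub_zero]
  field_simp
  ring

include hα in
-- For ε₁ = 1 there are two paths to v_0 ⊗ v_m: from v_0 through e_0, and from v_1 through e_1.
theorem ratioAt_pos (ε : ℤˣ) {m' : ℕ} (hmN' : m' < r.N)
    (hm' : (α + ((1 : ℤˣ) : ℤ) * r.k + (β + (ε : ℤ) * r.k) - γ) / (2 * r.k)
      + ((r.N : ℂ) - 1) / 2 = m') :
    r.ratioAt 1 ε α β γ m = -(r.qint (r.hw α + 1) / r.kappaS 0) *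
      (r.coefD (α + ((1 : ℤˣ) : ℤ) * r.k) (β + (ε : ℤ) * r.k) γ 0 m' 0
        * coord r.N r.N 0 m (vec r.N 0 ⊗ₜ r.absorb ε β (vec 2 0 ⊗ₜ vec r.N m'))
      + if 1 ≤ m' then r.coefD (α + ((1 : ℤˣ) : ℤ) * r.k) (β + (ε : ℤ) * r.k) γ 1 (m' - 1) 0
        * (r.qp (-(r.hw α))
          * coord r.N r.N 0 m (vec r.N 0 ⊗ₜ r.absorb ε β (vec 2 1 ⊗ₜ vec r.N (m' - 1)))) else 0)
        / r.coefD α β γ 0 m 0 := by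
  have h3 := r.three_le
  have hL : ∀ i < r.N, 2 ≤ i → ∀ j, (coord r.N r.N 0 m ∘ₗ r.exchange 1 ε α β)
      (vec r.N i ⊗ₜ vec r.N j) = 0 := fun i hi h0 j => by
    rw [LinearMap.comp_apply, exchange_pos_vec hα ε hi, map_smul, map_add, map_smul,
      coord_tmul_eq_zero (by omega), coord_tmul_eq_zero (by omega), smul_zero, add_zero, smul_zero]
  rw [ratioAt, ← LinearMap.comp_apply, apply_vertexAt_zero hm' hmN'
    (fun i hi j _ h => hL i hi (by omega) j), LinearMap.comp_apply, LinearMap.comp_apply,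
    exchange_pos_vec hα ε (by omega), exchange_pos_vec hα ε (by omega)]
  congr 1
  simp only [map_smul, map_add, smul_eq_mul, Nat.cast_zero, qint_zero, mul_zero, zero_mul,
    add_zero, Nat.cast_one, qint_one, mul_one, sub_self, zero_sub, coord_tmul_eq_zero one_ne_zero,
    zero_add]
  split_ifs <;> ring

include hα hβ hm hmN hγ

theorem ratioAt_neg_pos : r.ratioAt (-1) 1 α β γ m
    = r.qbin (2 * r.N - 2 - r.hw β) (r.N - 1) * r.qint (r.hw β - m + 1)
      / r.qint (r.hw β + 2) := by
  have h3 := r.three_le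
  have hm' := level_add (r := r) (m' := m) (ε₁ := ((-1 : ℤˣ) : ℤ)) (ε₂ := ((1 : ℤˣ) : ℤ))
    (by push_cast; ring) hm
  have h1 := r.kappaS_ne_zero (ν := 0) (by omega)
  have h4 : r.br (r.hw β + 2) ≠ 0 := by simpa using hβ 2
  have h5 : r.br (r.hw β + 1) ≠ 0 := by simpa using hβ 1
  have hD := coefD_leading_ne_zero hβ hm hmN hγ
  rw [ratioAt_neg hα 1 hmN hm', r.absorb_pos_one hβ, coefD_leading_pos hβ hm hmN hm',
    TensorProduct.tmul_smul, map_smul, coord_vec_of_lt 0 m (by omega) hmN,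
    if_pos ⟨rfl, rfl⟩, smul_eq_mul, absorbPos, r.qint_eq (r.hw β + 1), r.qint_eq (r.hw β + 2)]
  have hb := r.br_one_ne_zero
  have e : r.qp m * r.qp 1 * r.qp (-1 - m) = 1 := by
    rw [← qp_add, ← qp_add, show (m : ℂ) + 1 + (-1 - m) = 0 by ring, qp_zero]
  generalize r.qbin (2 * r.N - 2 - r.hw β) (r.N - 1) = Q
  field_simp
  linear_combination Q * r.qint (r.hw β - m + 1) * e

theorem ratioAt_neg_neg (h1m : 1 ≤ m) : r.ratioAt (-1) (-1) α β γ m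
    = r.qbin (2 * r.N - 2 - r.hw β) (r.N - 2) * r.qint (r.hw α + r.hw β - m + 1)
      / r.qint m := by
  have h3 := r.three_le
  obtain ⟨p, rfl⟩ : ∃ p, m = p + 1 := ⟨m - 1, by omega⟩
  have hm' := level_add (r := r) (m' := p) (ε₁ := ((-1 : ℤˣ) : ℤ)) (ε₂ := ((-1 : ℤˣ) : ℤ))
    (by push_cast; ring) hm
  have h1 := r.kappaS_ne_zero (ν := 0) (by omega)
  have h4 : r.qint (r.hw β) ≠ 0 := r.qint_ne_zero (by simpa using hβ 0)
  have hD := coefD_leading_ne_zero hβ hm hmN hγ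
  rw [ratioAt_neg hα _ (by omega) hm', r.absorb_neg_one hβ,
    coefD_leading_neg_pred hβ hm hmN rfl hm',
    TensorProduct.tmul_smul, map_smul, coord_vec_of_lt 0 (p + 1) (by omega) hmN,
    if_pos ⟨rfl, rfl⟩, smul_eq_mul, absorbNeg]
  have e : r.qp (-(r.hw β - (p + 1 : ℕ) + 1)) * r.qp 1 * r.qp (r.hw β - 1 - p) = 1 := by
    rw [← qp_add, ← qp_add]
    refine Eq.trans (congrArg r.qp ?_) r.qp_zero
    push_cast
    ring
  generalize r.qp (-(r.hw β - (p + 1 : ℕ) + 1)) = x at e ⊢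
  generalize r.qbin (2 * r.N - 2 - r.hw β) (r.N - 2) = Q
  have h5 : r.qint (p + 1 : ℕ) ≠ 0 := r.qint_ne_zero (r.br_nat_ne_zero (by omega) hmN)
  field_simp
  linear_combination Q * r.qint (r.hw α + r.hw β - (p + 1 : ℕ) + 1) * e

theorem ratioAt_pos_neg : r.ratioAt 1 (-1) α β γ m
    = r.qbin (2 * r.N - 2 - r.hw β) (r.N - 2) * r.qint (r.hw α - m + 1) := by
  have h3 := r.three_le
  have hm' := level_add (r := r) (m' := m) (ε₁ := ((1 : ℤˣ) : ℤ)) (ε₂ := ((-1 : ℤˣ) : ℤ))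
    (by push_cast; ring) hm
  have h1 := r.kappaS_ne_zero (ν := 0) (by omega)
  have h4 : r.qint (r.hw β) ≠ 0 := r.qint_ne_zero (by simpa using hβ 0)
  have h5 : r.qint (r.hw β - m) ≠ 0 := r.qint_ne_zero (br_hw_sub_nat_ne_zero hβ m)
  have h6 : r.qint (r.hw α + 1) ≠ 0 := r.qint_ne_zero (by simpa using hα 1)
  have hD := coefD_leading_ne_zero hβ hm hmN hγ
  -- The highest weight relation `coefD_hw` trades D_{1,m−1,0} for D_{0,m,0}. At m = 0 the path
  -- through v_1 does not exist, in agreement with [0] = 0.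
  have e1 : (if 1 ≤ m then r.coefD (α + ((1 : ℤˣ) : ℤ) * r.k) (β + ((-1 : ℤˣ) : ℤ) * r.k) γ 1
        (m - 1) 0 * (r.qp (-(r.hw α)) * coord r.N r.N 0 m
          (vec r.N 0 ⊗ₜ r.absorb (-1) β (vec 2 1 ⊗ₜ vec r.N (m - 1)))) else 0)
      = -(r.qint m * r.qint (r.hw β - m) / r.qint (r.hw α + 1) * r.qp (m - 1 - r.hw α)
        * r.absorbNeg β * r.coefD (α + ((1 : ℤˣ) : ℤ) * r.k) (β + ((-1 : ℤˣ) : ℤ) * r.k) γ 0 m 0) := by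
    split_ifs with h
    · obtain ⟨p, rfl⟩ : ∃ p, m = p + 1 := ⟨m - 1, by omega⟩
      have := coefD_hw r hm' (i := 0) (j := p) hmN (by omega)
        (fun t _ => br_hw_sub_nat_ne_zero (br_hw_shift_ne_zero hα _) t)
        (fun t _ => br_hw_sub_nat_ne_zero (br_hw_shift_ne_zero hβ _) t)
      rw [hw_add_int, hw_add_int] at this
      generalize α + ((1 : ℤˣ) : ℤ) * r.k = α' at this ⊢
      generalize β + ((-1 : ℤˣ) : ℤ) * r.k = β' at this ⊢
      rw [Nat.add_sub_cancel, r.absorb_neg_one hβ, TensorProduct.tmul_smul, map_smul,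
        coord_vec_of_lt 0 (p + 1) (by omega) hmN, if_pos ⟨rfl, rfl⟩, smul_eq_mul]
      simp only [Units.val_neg, Units.val_one, Int.cast_neg, Int.cast_one, Nat.cast_zero, zero_add,
        qint_one, one_mul, sub_zero, ← sub_eq_add_neg, mul_one] at this ⊢
      push_cast
      rw [show r.hw β - 1 - p = r.hw β - (p + 1) by ring] at this
      have e : r.qp (-(r.hw α)) * r.qp (r.hw β - 1 - p)
          = r.qp (r.hw β - 1 - 2 * p) * r.qp ((p : ℂ) + 1 - 1 - r.hw α) := by
        rw [← qp_add, ← qp_add]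
        congr 1
        ring
      field_simp
      linear_combination r.absorbNeg β * r.qp ((p : ℂ) + 1 - 1 - r.hw α) * this
        + r.absorbNeg β * r.qint (r.hw α + 1) * r.coefD α' β' γ 1 p 0 * e
    · obtain rfl : m = 0 := by omega
      simp [qint_zero]
  rw [ratioAt_pos hα _ hmN hm', e1, r.absorb_neg_zero hβ, TensorProduct.tmul_smul, map_smul,
    coord_vec_of_lt 0 m (by omega) hmN, if_pos ⟨rfl, rfl⟩, smul_eq_mul,
    coefD_leading_neg hβ hm hmN hm', absorbNeg]
  -- This splitting of [l + 1], with l = hw α, is what collapses the sum over the two paths.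
  have e2 := r.qint_add m (r.hw α - m + 1)
  rw [show (m : ℂ) + (r.hw α - m + 1) = r.hw α + 1 by ring,
    show -(r.hw α - m + 1) = m - 1 - r.hw α by ring] at e2
  have e3 : r.qp m * r.qp (-m) = 1 := by rw [← qp_add, add_neg_cancel, qp_zero]
  generalize r.qbin (2 * r.N - 2 - r.hw β) (r.N - 2) = Q
  field_simp
  linear_combination Q * r.qp (-m) * e2 + Q * r.qint (r.hw α - m + 1) * e3

theorem ratioAt_pos_pos (hmN' : m + 1 < r.N) : r.ratioAt 1 1 α β γ m
    = -(r.qbin (2 * r.N - 2 - r.hw β) (r.N - 1) * r.qint (m + 1) ^ 2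
      / r.qint (r.hw β + 2)) := by
  have h3 := r.three_le
  have hm' := level_add (r := r) (m' := m + 1) (ε₁ := ((1 : ℤˣ) : ℤ)) (ε₂ := ((1 : ℤˣ) : ℤ))
    (by push_cast; ring) hm
  have h1 := r.kappaS_ne_zero (ν := 0) (by omega)
  have h4 : r.br (r.hw β + 2) ≠ 0 := by simpa using hβ 2
  have h5 : r.br (r.hw β + 1) ≠ 0 := by simpa using hβ 1
  have h6 : r.qint (r.hw α + 1) ≠ 0 := r.qint_ne_zero (by simpa using hα 1)
  have hD := coefD_leading_ne_zero hβ hm hmN hγ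
  -- Modulo N/2 the argument is hw γ − (N − 2 − m), which `hγ` covers.
  have hc : r.qint (r.hw α + r.hw β - m + 2) ≠ 0 := by
    have := hγ (r.N - 2 - m) (by omega)
    rw [show r.N - 2 - m = r.N - (2 + m) by omega, Nat.cast_sub (by omega), hw_level r hm,
      r.br_congr (y := r.hw α + r.hw β - m + 2) (-2) (by push_cast; ring)] at this
    exact r.qint_ne_zero this
  have e0 := coefD_hw r hm' (i := 0) (j := m) hmN' (by omega)
    (fun t _ => br_hw_sub_nat_ne_zero (br_hw_shift_ne_zero hα _) t)
    (fun t _ => br_hw_sub_nat_ne_zero (br_hw_shift_ne_zero hβ _) t)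
  rw [hw_add_int, hw_add_int, coefD_leading_pos_succ hβ hm hmN hmN' hc hm'] at e0
  rw [ratioAt_pos hα _ hmN' hm', if_pos (by omega), r.absorb_pos_zero hβ (by omega),
    Nat.add_sub_cancel, r.absorb_pos_one hβ, TensorProduct.tmul_smul, map_smul,
    TensorProduct.tmul_smul, map_smul,
    coord_vec_of_lt 0 m (by omega) hmN, if_pos ⟨rfl, rfl⟩, smul_eq_mul, smul_eq_mul,
    coefD_leading_pos_succ hβ hm hmN hmN' hc hm', absorbPos]
  generalize α + ((1 : ℤˣ) : ℤ) * r.k = α' at e0 ⊢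
  generalize β + ((1 : ℤˣ) : ℤ) * r.k = β' at e0 ⊢
  simp only [Units.val_one, Int.cast_one, Nat.cast_zero, zero_add, qint_one, one_mul, sub_zero,
    mul_one] at e0 ⊢
  push_cast
  have e1 : r.qp (-(r.hw α)) * r.qp (-1 - m)
      = r.qp (r.hw β + 1 - 2 * m) * r.qp (-(r.hw α + r.hw β - m + 2)) := by
    rw [← qp_add, ← qp_add]
    congr 1
    ring
  have e2 := r.qint_add (r.hw β + 1 - m) (r.hw α + 1)
  rw [show r.hw β + 1 - m + (r.hw α + 1) = r.hw α + r.hw β - m + 2 by ring] at e2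
  have e3 : r.qp (r.hw β + 1 - m) * r.qp (-(r.hw β + 1 - m)) = 1 := by
    rw [← qp_add, add_neg_cancel, qp_zero]
  have e4 : r.qp (-(r.hw α + 1)) * r.qp (-(r.hw β + 1 - m))
      = r.qp (-(r.hw α + r.hw β - m + 2)) := by
    rw [← qp_add]
    congr 1
    ring
  generalize r.coefD α' β' γ 1 m 0 = y at e0 ⊢
  generalize r.coefD α β γ 0 m 0 = x at e0 hD ⊢
  have hb := r.br_one_ne_zero
  have h7 : r.qint (r.hw β + 1) ≠ 0 := r.qint_ne_zero h5
  -- ρ is the ratio of the leading coefficient at level m + 1 to the one at level m, kept as a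
  -- letter while `e0` eliminates the coefficient y along v_1 ⊗ v_m.
  obtain ⟨ρ, hρ⟩ : ∃ ρ, ρ = r.qp (r.hw β + 1 - m) * r.qint (m + 1)
        / (r.qint (r.hw α + r.hw β - m + 2) * r.qint (r.hw β + 1)) := ⟨_, rfl⟩
  rw [← hρ] at e0 ⊢
  rw [eq_div_iff (mul_ne_zero hc h7)] at hρ
  have key : r.qint (r.hw α + 1) * (ρ * x * r.qint (m + 1)
        - y * (r.qp (-(r.hw α)) * r.qp (-1 - m))) * r.qint (r.hw β + 1)
      = x * r.qint (m + 1) ^ 2 := by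
    rw [e1]
    linear_combination -(r.qp (-(r.hw α + r.hw β - m + 2)) * r.qint (r.hw β + 1)) * e0
      - ρ * x * r.qint (m + 1) * r.qint (r.hw β + 1) * (r.qp (-(r.hw β + 1 - m)) * e2
        + r.qint (r.hw β + 1 - m) * e4 + r.qint (r.hw α + 1) * e3)
      + r.qint (m + 1) * x * r.qp (-(r.hw β + 1 - m)) * hρ + r.qint (m + 1) ^ 2 * x * e3
  rw [r.qint_eq (r.hw β + 1)] at key
  rw [r.qint_eq (r.hw β + 2)]
  generalize r.qbin (2 * r.N - 2 - r.hw β) (r.N - 1) = Q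
  field_simp at key ⊢
  linear_combination -Q * key

end values

end generic

end RootData

namespace RootData

variable {r : RootData}

/-! ### The 6j-symbols at a given level -/

/-- The 6j-symbol of colours `α`, `β`, `γ` with
`α + β - γ ∈ n k N / 2 + k (2 m - (N - 1))`. It vanishes when `m + (ε₁ + ε₂) / 2` is outside
`0, …, N - 1`. -/
def levelValue (r : RootData) (ε₁ ε₂ : ℤˣ) (m : ℕ) (α β : ℂ) : ℂ :=
  if ε₁ = 1 then
    if ε₂ = 1 then
      -(r.qbin (2 * r.N - 2 - r.hw β) (r.N - 1) * r.qint (m + 1) ^ 2 / r.qint (r.hw β + 2))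
    else r.qbin (2 * r.N - 2 - r.hw β) (r.N - 2) * r.qint (r.hw α - m + 1)
  else
    if ε₂ = 1 then
      r.qbin (2 * r.N - 2 - r.hw β) (r.N - 1) * r.qint (r.hw β - m + 1) / r.qint (r.hw β + 2)
    else
      r.qbin (2 * r.N - 2 - r.hw β) (r.N - 2) * r.qint (r.hw α + r.hw β - m + 1) / r.qint m

section level

variable {ε₁ ε₂ : ℤˣ} {α β γ : ℂ} {m : ℕ} {n : ℤ}
  (hα : ∀ t : ℤ, r.br (r.hw α + t) ≠ 0) (hβ : ∀ t : ℤ, r.br (r.hw β + t) ≠ 0)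
  (hγ : γ ∈ r.simpleColours) (hmN : m < r.N)
  (hlev : α + β - γ = n * (r.k * r.N / 2) + r.k * (2 * m - (r.N - 1)))

include hmN hlev

theorem vertex_eq : r.vertex α β γ = r.vertexAt α β (γ + n * (r.k * r.N / 2)) := by
  rw [vertex, vertexAt, shift_eq hmN hlev]

omit hmN in
theorem level_shift :
    (α + β - (γ + n * (r.k * r.N / 2))) / (2 * r.k) + ((r.N : ℂ) - 1) / 2 = m :=
  level_of_eq (by linear_combination hlev)

include hα hβ hγ

theorem isHom_vertex :
    IsHom (r.V (r.shift α β γ)) (Rep.tensor r.q_ne_zero (r.V α) (r.V β)) (r.vertex α β γ) := by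
  rw [vertex_eq hmN hlev, shift_eq hmN hlev]
  exact isHom_vertexAt hα hβ (level_shift hlev) hmN
    fun t ht => br_hw_ne_zero_of_simple hγ n ht

omit hα in
theorem coord_vertex_ne_zero : coord r.N r.N 0 m (r.vertex α β γ (vec r.N 0)) ≠ 0 := by
  have h3 := r.three_le
  rw [vertex_eq hmN hlev, coord_vertexAt_zero (by omega) hmN]
  exact coefD_leading_ne_zero hβ (level_shift hlev) hmN
    (fun t ht => br_hw_ne_zero_of_simple hγ n ht)

omit hmN hlev in
theorem isHom_triangle {m' : ℕ} {n' : ℤ} (hmN' : m' < r.N)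
    (hlev' : α + (ε₁ : ℤ) * r.k + (β + (ε₂ : ℤ) * r.k) - γ
      = n' * (r.k * r.N / 2) + r.k * (2 * m' - (r.N - 1))) :
    IsHom (r.V (γ + n' * (r.k * r.N / 2))) (Rep.tensor r.q_ne_zero (r.V α) (r.V β))
      (r.triangle ε₁ ε₂ α β γ) := by
  rw [triangle_eq (shift_eq hmN' hlev')]
  exact (isHom_exchange hα hβ ε₁ ε₂).comp (isHom_vertexAt (br_hw_shift_ne_zero hα _)
    (br_hw_shift_ne_zero hβ _) (level_shift hlev') hmN'
    fun t ht => br_hw_ne_zero_of_simple hγ n' ht)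

/-- As m' stays in range, the shifted colours have the same n, so triangle and vertex start from the
same module and `eq_smul_vertexAt` applies. -/
theorem triangle_eq_ratioAt {m' : ℕ} (hm' : (2 * m' : ℤ) = 2 * m + ε₁ + ε₂) (hmN' : m' < r.N) :
    r.triangle ε₁ ε₂ α β γ
      = r.ratioAt ε₁ ε₂ α β (γ + n * (r.k * r.N / 2)) m • r.vertex α β γ := by
  have h' : (2 * m' : ℂ) = 2 * m + ((ε₁ : ℤ) : ℂ) + ((ε₂ : ℤ) : ℂ) := by exact_mod_cast hm'
  have hlev' : α + (ε₁ : ℤ) * r.k + (β + (ε₂ : ℤ) * r.k) - γ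
      = n * (r.k * r.N / 2) + r.k * (2 * m' - (r.N - 1)) := by
    linear_combination hlev - r.k * h'
  have := eq_smul_vertexAt hα hβ (level_shift hlev) hmN
    (fun t ht => br_hw_ne_zero_of_simple hγ n ht)
    (isHom_triangle hα hβ hγ hmN' hlev')
  rw [← vertex_eq hmN hlev] at this
  refine this.trans ?_
  rw [ratioAt, triangle_eq (shift_eq hmN' hlev'), LinearMap.comp_apply]

omit hmN hlev in
-- The source has highest weight hw α + hw β − (2m' − ε₁ − ε₂), and `hj` leaves no level for a
-- non-zero morphism. This serves when the shifted level wraps around.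
theorem triangle_eq_zero {m' : ℕ} {n' : ℤ} (hmN' : m' < r.N)
    (hlev' : α + (ε₁ : ℤ) * r.k + (β + (ε₂ : ℤ) * r.k) - γ
      = n' * (r.k * r.N / 2) + r.k * (2 * m' - (r.N - 1)))
    (hj : ∀ j < r.N, (2 * m' : ℤ) - ε₁ - ε₂ ≠ 2 * j) :
    r.triangle ε₁ ε₂ α β γ = 0 := by
  refine eq_zero_of_no_level hα (γ := γ + n' * (r.k * r.N / 2)) (fun j hjN h => hj j hjN ?_)
    (isHom_triangle hα hβ hγ hmN' hlev')
  have := hw_level r (level_shift hlev')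
  rw [hw_add_int, hw_add_int, h] at this
  have h2 : (2 * m' : ℂ) - (ε₁ : ℤ) - (ε₂ : ℤ) = 2 * j := by linear_combination this
  exact_mod_cast h2

theorem triangle_eq_smul :
    r.triangle ε₁ ε₂ α β γ = r.levelValue ε₁ ε₂ m α β • r.vertex α β γ := by
  have h3 := r.three_le
  have hl := level_shift hlev
  have hg : ∀ t < r.N - 1, r.br (r.hw (γ + n * (r.k * r.N / 2)) - t) ≠ 0 :=
    fun t ht => br_hw_ne_zero_of_simple hγ n ht
  rcases Int.units_eq_one_or ε₁ with rfl | rfl <;> rcases Int.units_eq_one_or ε₂ with rfl | rfl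
  · rw [levelValue, if_pos rfl, if_pos rfl]
    rcases (show m + 1 < r.N ∨ m + 1 = r.N by omega) with h | h
    · rw [triangle_eq_ratioAt hα hβ hγ hmN hlev (m' := m + 1) (by push_cast; ring) h,
        ratioAt_pos_pos hα hβ hl hmN hg h]
    · have hm : (m : ℂ) + 1 = r.N := by exact_mod_cast h
      -- Level N is level 0 for n + 4, since 2kN = 4 · kN/2; the weights would then ask for a target
      -- level −1.
      rw [hm, qint_N, triangle_eq_zero hα hβ hγ (m' := 0) (n' := n + 4) (by omega)]
      · simp
      · push_cast
        linear_combination hlev + 2 * r.k * hm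
      · intro j _
        push_cast
        omega
  · rw [levelValue, if_pos rfl, if_neg (by decide),
      triangle_eq_ratioAt hα hβ hγ hmN hlev (m' := m) (by push_cast; ring) hmN,
      ratioAt_pos_neg hα hβ hl hmN hg]
  · rw [levelValue, if_neg (by decide), if_pos rfl,
      triangle_eq_ratioAt hα hβ hγ hmN hlev (m' := m) (by push_cast; ring) hmN,
      ratioAt_neg_pos hα hβ hl hmN hg]
  · rw [levelValue, if_neg (by decide), if_neg (by decide)]
    rcases m with _ | m
    -- Level −1 is level N − 1 for n − 4; the weights would then ask for a target level N.
    · rw [triangle_eq_zero hα hβ hγ (m' := r.N - 1) (n' := n - 4) (by omega)]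
      -- Here `levelValue` is a quotient by [0] = 0, which is 0 by convention.
      · simp [qint_zero]
      · rw [Nat.cast_sub (by omega)]
        push_cast at hlev ⊢
        linear_combination hlev
      · intro j hj
        push_cast
        omega
    · rw [triangle_eq_ratioAt hα hβ hγ hmN hlev (m' := m) (by push_cast; ring) (by omega),
        ratioAt_neg_neg hα hβ hl hmN hg (by omega)]

theorem triangle_eq_smul_iff (s : ℂ) :
    r.triangle ε₁ ε₂ α β γ = s • r.vertex α β γ ↔ s = r.levelValue ε₁ ε₂ m α β := by
  rw [triangle_eq_smul hα hβ hγ hmN hlev]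
  refine ⟨fun h => ?_, fun h => by rw [h]⟩
  have := congrArg (fun f => coord r.N r.N 0 m (f (vec r.N 0))) h
  simp only [LinearMap.smul_apply, map_smul, smul_eq_mul] at this
  exact (mul_right_cancel₀ (coord_vertex_ne_zero hβ hγ hmN hlev) this).symm

theorem sixJ_eq : r.sixJ ε₁ ε₂ α β γ = r.levelValue ε₁ ε₂ m α β := by
  have hex : ∃ s : ℂ, r.triangle ε₁ ε₂ α β γ = s • r.vertex α β γ :=
    ⟨_, triangle_eq_smul hα hβ hγ hmN hlev⟩
  rw [sixJ, dif_pos hex]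
  exact (triangle_eq_smul_iff hα hβ hγ hmN hlev _).1 hex.choose_spec

theorem levelValue_ne_zero_iff : r.levelValue ε₁ ε₂ m α β ≠ 0 ↔
    0 ≤ 2 * (m : ℤ) + ε₁ + ε₂ ∧ 2 * (m : ℤ) + ε₁ + ε₂ ≤ 2 * (r.N - 1) := by
  have h3 := r.three_le
  have hg : ∀ t < r.N - 1, r.br (r.hw (γ + n * (r.k * r.N / 2)) - t) ≠ 0 :=
    fun t ht => br_hw_ne_zero_of_simple hγ n ht
  have hb : r.qint (r.hw β + 2) ≠ 0 := r.qint_ne_zero (by simpa using hβ 2)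
  have h1 := r.qbin_complement_ne_zero hβ (u := r.N - 1) (by omega)
  have h2 := r.qbin_complement_ne_zero hβ (u := r.N - 2) (by omega)
  have hsub : ∀ x : ℂ, (∀ t : ℤ, r.br (x + t) ≠ 0) → r.qint (x - m + 1) ≠ 0 := fun x hx => by
    have := hx (1 - m)
    push_cast at this
    rw [show x - m + 1 = x + (1 - m) by ring]
    exact r.qint_ne_zero this
  rcases Int.units_eq_one_or ε₁ with rfl | rfl <;> rcases Int.units_eq_one_or ε₂ with rfl | rfl
  · rw [levelValue, if_pos rfl, if_pos rfl]
    push_cast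
    rcases (show m + 1 < r.N ∨ m + 1 = r.N by omega) with h | h
    · have h4 := r.qint_ne_zero (r.br_nat_ne_zero (n := m + 1) (by omega) h)
      push_cast at h4
      exact iff_of_true (neg_ne_zero.2 (div_ne_zero (mul_ne_zero h1 (pow_ne_zero 2 h4)) hb))
        (by omega)
    · have hm : (m : ℂ) + 1 = r.N := by exact_mod_cast h
      rw [hm, qint_N]
      refine iff_of_false (by simp) (by omega)
  · rw [levelValue, if_pos rfl, if_neg (by decide)]
    push_cast
    exact iff_of_true (mul_ne_zero h2 (hsub _ hα)) (by omega)
  · rw [levelValue, if_neg (by decide), if_pos rfl]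
    push_cast
    exact iff_of_true (div_ne_zero (mul_ne_zero h1 (hsub _ hβ)) hb) (by omega)
  · rw [levelValue, if_neg (by decide), if_neg (by decide)]
    push_cast
    rcases Nat.eq_zero_or_pos m with rfl | hm
    · exact iff_of_false (by simp [qint_zero]) (by omega)
    · have h4 := r.qint_ne_zero (r.br_nat_ne_zero hm hmN)
      -- Simplicity of γ controls the factor in α + β: modulo N/2, hw γ − (N − 1 − m) is hw α + hw β
      -- − m + 1, and m ≥ 1 puts the index below N − 1.
      have h5 := hg (r.N - 1 - m) (by omega)
      rw [show r.N - 1 - m = r.N - (1 + m) by omega, Nat.cast_sub (by omega),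
        hw_level r (level_shift hlev),
        r.br_congr (y := r.hw α + r.hw β - m + 1) (-2) (by push_cast; ring)] at h5
      exact iff_of_true (div_ne_zero (mul_ne_zero h2 (r.qint_ne_zero h5)) h4) (by omega)

end level

end RootData

namespace RootData

/-! ### Rational functions of the colours -/

/-- `f` is a rational function over `ℚ(A)` in `e^{iπα/N}`, `e^{iπβ/N}`, `e^{iπγ/N}`, regular
wherever the quantum numbers of `β` do not vanish. -/
def IsReg (r : RootData) (f : ℂ → ℂ → ℂ → ℂ) : Prop :=
  ∃ P Q : MvPolynomial (Fin 3) r.QA, ∀ α β γ : ℂ, (∀ t : ℤ, r.br (r.hw β + t) ≠ 0) →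
    MvPolynomial.aeval (r.point α β γ) Q ≠ 0 ∧
      f α β γ = MvPolynomial.aeval (r.point α β γ) P / MvPolynomial.aeval (r.point α β γ) Q

variable {r : RootData}

/-! ### Closure properties of regular functions -/

namespace IsReg

variable {f g : ℂ → ℂ → ℂ → ℂ}

theorem const {c : ℂ} (hc : c ∈ r.QA) : r.IsReg fun _ _ _ => c :=
  ⟨MvPolynomial.C ⟨c, hc⟩, 1, fun α β γ _ => ⟨by simp, by
    rw [map_one, div_one, MvPolynomial.aeval_C]; rfl⟩⟩

theorem coordinate (i : Fin 3) : r.IsReg fun α β γ => r.point α β γ i :=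
  ⟨MvPolynomial.X i, 1, fun α β γ _ => ⟨by simp, by simp⟩⟩

theorem add (hf : r.IsReg f) (hg : r.IsReg g) : r.IsReg fun α β γ => f α β γ + g α β γ := by
  obtain ⟨P, Q, h⟩ := hf
  obtain ⟨P', Q', h'⟩ := hg
  refine ⟨P * Q' + Q * P', Q * Q', fun α β γ hβ => ?_⟩
  obtain ⟨h1, h2⟩ := h α β γ hβ
  obtain ⟨h3, h4⟩ := h' α β γ hβ
  simp only [map_add, map_mul]
  exact ⟨mul_ne_zero h1 h3, by rw [h2, h4, div_add_div _ _ h1 h3]⟩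

theorem mul (hf : r.IsReg f) (hg : r.IsReg g) : r.IsReg fun α β γ => f α β γ * g α β γ := by
  obtain ⟨P, Q, h⟩ := hf
  obtain ⟨P', Q', h'⟩ := hg
  refine ⟨P * P', Q * Q', fun α β γ hβ => ?_⟩
  obtain ⟨h1, h2⟩ := h α β γ hβ
  obtain ⟨h3, h4⟩ := h' α β γ hβ
  simp only [map_mul]
  exact ⟨mul_ne_zero h1 h3, by rw [h2, h4, div_mul_div_comm]⟩

/-- P becomes the denominator; it has no zero at the points concerned because f has none. -/
theorem inv (hf : r.IsReg f)
    (h0 : ∀ α β γ : ℂ, (∀ t : ℤ, r.br (r.hw β + t) ≠ 0) → f α β γ ≠ 0) :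
    r.IsReg fun α β γ => (f α β γ)⁻¹ := by
  obtain ⟨P, Q, h⟩ := hf
  refine ⟨Q, P, fun α β γ hβ => ?_⟩
  obtain ⟨h1, h2⟩ := h α β γ hβ
  refine ⟨fun hP => h0 α β γ hβ (by rw [h2, hP, zero_div]), ?_⟩
  show (f α β γ)⁻¹ = _
  rw [h2, inv_div]

theorem neg (hf : r.IsReg f) : r.IsReg fun α β γ => -f α β γ := by
  have := (const (r := r) (c := -1) (neg_mem (one_mem _))).mul hf
  simpa only [neg_mul, one_mul] using this

theorem sub (hf : r.IsReg f) (hg : r.IsReg g) : r.IsReg fun α β γ => f α β γ - g α β γ := by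
  simpa only [sub_eq_add_neg] using hf.add hg.neg

theorem sum {ι : Type*} (s : Finset ι) {f : ι → ℂ → ℂ → ℂ → ℂ} (hf : ∀ i ∈ s, r.IsReg (f i)) :
    r.IsReg fun α β γ => ∑ i ∈ s, f i α β γ := by
  classical
  induction s using Finset.induction_on with
  | empty => simpa using const (r := r) (zero_mem _)
  | insert a s ha ih =>
    simp only [Finset.sum_insert ha]
    exact (hf a (Finset.mem_insert_self a s)).add
      (ih fun i hi => hf i (Finset.mem_insert_of_mem hi))

theorem prod {ι : Type*} (s : Finset ι) {f : ι → ℂ → ℂ → ℂ → ℂ} (hf : ∀ i ∈ s, r.IsReg (f i)) :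
    r.IsReg fun α β γ => ∏ i ∈ s, f i α β γ := by
  classical
  induction s using Finset.induction_on with
  | empty => simpa using const (r := r) (one_mem _)
  | insert a s ha ih =>
    simp only [Finset.prod_insert ha]
    exact (hf a (Finset.mem_insert_self a s)).mul
      (ih fun i hi => hf i (Finset.mem_insert_of_mem hi))

end IsReg

theorem qp_int_mem (n : ℤ) : r.qp n ∈ r.QA := by
  have h : r.qp n = (r.A ^ 2) ^ n := by
    rw [← r.q_eq, q, qp, qp, ← Complex.exp_int_mul]
    congr 1
    ring
  rw [h]
  exact zpow_mem (pow_mem (IntermediateField.mem_adjoin_simple_self ℚ r.A) 2) n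

theorem br_int_mem (n : ℤ) : r.br n ∈ r.QA := by
  have := qp_int_mem (r := r) (-n)
  push_cast at this
  exact sub_mem (qp_int_mem n) this

theorem brFact_mem (d : ℕ) : r.brFact d ∈ r.QA := by
  refine prod_mem fun t _ => ?_
  have := br_int_mem (r := r) (t + 1)
  push_cast at this
  exact this

theorem br_one_mem : r.br 1 ∈ r.QA := by
  have := br_int_mem (r := r) 1
  rwa [Int.cast_one] at this

/-! ### Regularity of the factors of `levelValue` -/

namespace IsReg

variable {x y : ℂ → ℂ → ℂ → ℂ}

/-- q^(α/k) = e^(2iπα/N) is the square of the first coordinate. -/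
theorem qp_left : r.IsReg fun α _ _ => r.qp (r.hw α) := by
  have h := ((coordinate (r := r) 0).mul (coordinate 0)).mul (const (qp_int_mem (r := r) (r.N - 1)))
  convert h using 4 with α β γ
  have hk := r.k_ne_zero
  rw [point, Matrix.cons_val_zero, ← Complex.exp_add, qp, qp, ← Complex.exp_add, hw]
  congr 1
  push_cast
  field_simp
  ring

theorem qp_right : r.IsReg fun _ β _ => r.qp (r.hw β) := by
  have h := ((coordinate (r := r) 1).mul (coordinate 1)).mul (const (qp_int_mem (r := r) (r.N - 1)))
  convert h using 4 with α β γ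
  have hk := r.k_ne_zero
  rw [point, Matrix.cons_val_one, Matrix.cons_val_zero, ← Complex.exp_add, qp, qp,
    ← Complex.exp_add, hw]
  congr 1
  push_cast
  field_simp
  ring

theorem qp_add_int (h : r.IsReg fun α β γ => r.qp (x α β γ)) (n : ℤ) :
    r.IsReg fun α β γ => r.qp (x α β γ + n) := by
  simpa only [qp_add] using h.mul (const (qp_int_mem n))

theorem qp_add' (h : r.IsReg fun α β γ => r.qp (x α β γ))
    (h' : r.IsReg fun α β γ => r.qp (y α β γ)) :
    r.IsReg fun α β γ => r.qp (x α β γ + y α β γ) := by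
  simpa only [qp_add] using h.mul h'

theorem br (h : r.IsReg fun α β γ => r.qp (x α β γ)) : r.IsReg fun α β γ => r.br (x α β γ) := by
  simpa only [RootData.br, qp_neg] using h.sub (h.inv fun α β γ _ => r.qp_ne_zero _)

theorem qint (h : r.IsReg fun α β γ => r.qp (x α β γ)) :
    r.IsReg fun α β γ => r.qint (x α β γ) := by
  simpa only [qint_eq, div_eq_mul_inv] using h.br.mul (const (inv_mem br_one_mem))

theorem qint_int (n : ℤ) : r.IsReg fun _ _ _ => r.qint n :=
  qint (const (qp_int_mem n))

theorem qbin_complement (d : ℕ) : r.IsReg fun _ β _ => r.qbin (2 * r.N - 2 - r.hw β) d := by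
  have h := (prod (Finset.range d) (f := fun t _ β _ => -r.br (r.hw β + (2 + t - 2 * r.N : ℤ)))
    fun t _ => (qp_right.qp_add_int _).br.neg).mul (const (inv_mem (brFact_mem (r := r) d)))
  convert h using 4 with α β γ
  rw [qbin, div_eq_mul_inv]
  congr 1
  refine Finset.prod_congr rfl fun t _ => ?_
  rw [← br_neg]
  congr 1
  push_cast
  ring

theorem levelValue (ε₁ ε₂ : ℤˣ) (m : ℕ) : r.IsReg fun α β _ => r.levelValue ε₁ ε₂ m α β := by
  have hb : r.IsReg fun _ β _ => (r.qint (r.hw β + 2))⁻¹ := by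
    have := (qp_right (r := r)).qp_add_int 2
    push_cast at this
    exact this.qint.inv fun α β γ hβ => r.qint_ne_zero (by simpa using hβ 2)
  have hsub : ∀ {x : ℂ → ℂ → ℂ → ℂ}, (r.IsReg fun α β γ => r.qp (x α β γ)) →
      r.IsReg fun α β γ => r.qint (x α β γ - m + 1) := fun {x} h => by
    have := (h.qp_add_int (1 - m)).qint
    push_cast at this
    convert this using 5
    ring
  simp only [RootData.levelValue]
  split_ifs
  · have h1 := qint_int (r := r) (m + 1)
    push_cast at h1
    simpa only [div_eq_mul_inv, sq] using (((qbin_complement _).mul (h1.mul h1)).mul hb).neg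
  · exact (qbin_complement _).mul (hsub qp_left)
  · simpa only [div_eq_mul_inv] using ((qbin_complement _).mul (hsub qp_right)).mul hb
  · have h2 : r.qint m ∈ r.QA := by
      have := br_int_mem (r := r) m
      rw [Int.cast_natCast] at this
      rw [qint_eq]
      exact div_mem this br_one_mem
    simpa only [div_eq_mul_inv] using
      ((qbin_complement _).mul (hsub (qp_left.qp_add' qp_right))).mul (const (inv_mem h2))

end IsReg

/-! ### Interpolation of the levels -/

/-- `e^{2iπ(α+β-γ)/N}`, which takes the value `q^{2m+1}` at level `m`. -/
def levelCoord (r : RootData) (α β γ : ℂ) : ℂ :=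
  (r.point α β γ 0 * r.point α β γ 1 * (r.point α β γ 2)⁻¹) ^ 2

/-- The term n k N / 2 contributes e^(2iπk'n) = 1, so a single set of N nodes serves for all n. -/
theorem levelCoord_eq {α β γ : ℂ} {m : ℕ} {n : ℤ}
    (h : α + β - γ = n * (r.k * r.N / 2) + r.k * (2 * m - (r.N - 1))) :
    r.levelCoord α β γ = r.qp (2 * m + 1) := by
  have hN := r.N_ne_zero
  have h1 : r.levelCoord α β γ
      = Complex.exp (2 * Real.pi * Complex.I * (α + β - γ) / r.N) := by
    simp only [levelCoord, point, Matrix.cons_val]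
    rw [← Complex.exp_neg, ← Complex.exp_add, ← Complex.exp_add, ← Complex.exp_nat_mul]
    congr 1
    push_cast
    ring
  rw [h1, h, qp, Complex.exp_eq_exp_iff_exists_int]
  refine ⟨r.k' * n - 2 * r.k', ?_⟩
  rw [k]
  push_cast
  field_simp
  ring

/-- The difference of two nodes is q^(m+j+1) {m − j}, and N does not divide m − j. -/
theorem qp_level_ne {m j : ℕ} (hm : m < r.N) (hj : j < r.N) (h : j ≠ m) :
    r.qp (2 * m + 1) - r.qp (2 * j + 1) ≠ 0 := by
  have h1 : r.br ((m : ℤ) - j : ℤ) ≠ 0 := r.br_int_ne_zero fun hd => by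
    have := Int.eq_zero_of_abs_lt_dvd hd (by rw [abs_lt]; omega)
    omega
  have h2 : r.qp (2 * m + 1) - r.qp (2 * j + 1) = r.qp (m + j + 1) * r.br ((m : ℤ) - j : ℤ) := by
    rw [br, mul_sub, ← qp_add, ← qp_add]
    push_cast
    congr 2 <;> ring
  rw [h2]
  exact mul_ne_zero (r.qp_ne_zero _) h1

/-- The Lagrange interpolation of the 6j-symbols of all levels. -/
def interpolation (r : RootData) (ε₁ ε₂ : ℤˣ) (α β γ : ℂ) : ℂ :=
  ∑ m ∈ Finset.range r.N, (∏ j ∈ (Finset.range r.N).erase m,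
    (r.levelCoord α β γ - r.qp (2 * j + 1)) * (r.qp (2 * m + 1) - r.qp (2 * j + 1))⁻¹)
      * r.levelValue ε₁ ε₂ m α β

theorem interpolation_eq (ε₁ ε₂ : ℤˣ) {α β γ : ℂ} {m : ℕ} {n : ℤ} (hm : m < r.N)
    (h : α + β - γ = n * (r.k * r.N / 2) + r.k * (2 * m - (r.N - 1))) :
    r.interpolation ε₁ ε₂ α β γ = r.levelValue ε₁ ε₂ m α β := by
  rw [interpolation, levelCoord_eq h, Finset.sum_eq_single m]
  · rw [Finset.prod_eq_one, one_mul]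
    intro j hj
    rw [Finset.mem_erase, Finset.mem_range] at hj
    exact mul_inv_cancel₀ (qp_level_ne hm hj.2 hj.1)
  · intro i _ him
    rw [Finset.prod_eq_zero (Finset.mem_erase.2 ⟨him.symm, Finset.mem_range.2 hm⟩), zero_mul]
    rw [sub_self, zero_mul]
  · exact fun h' => absurd (Finset.mem_range.2 hm) h'

theorem isReg_interpolation (ε₁ ε₂ : ℤˣ) : r.IsReg (r.interpolation ε₁ ε₂) := by
  have hq : ∀ j : ℕ, r.qp (2 * j + 1) ∈ r.QA := fun j => by
    have := qp_int_mem (r := r) (2 * j + 1)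
    push_cast at this
    exact this
  have hu : r.IsReg r.levelCoord := by
    have := ((IsReg.coordinate (r := r) 0).mul (IsReg.coordinate 1)).mul
      ((IsReg.coordinate 2).inv fun α β γ _ => by
        simp only [point, Matrix.cons_val]
        exact Complex.exp_ne_zero _)
    have h2 := this.mul this
    simp only [← sq] at h2
    exact h2
  exact IsReg.sum _ fun m _ => (IsReg.prod _ fun j _ => (hu.sub (.const (hq j))).mul
    (.const (inv_mem (sub_mem (hq m) (hq j))))).mul (.levelValue ε₁ ε₂ m)

/-! ### Admissible colours -/

theorem mem_simpleColours_of_im_ne_zero {z : ℂ} (h : z.im ≠ 0) : z ∈ r.simpleColours :=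
  Or.inl fun j hj => h (by
    rw [hj, show ((j : ℂ) / 2) = (((j : ℝ) / 2 : ℝ) : ℂ) by push_cast; ring, Complex.ofReal_im])

/-- With α = β = i all shifts are real, so the five colours have non-zero imaginary part and are
simple. -/
theorem exists_admissible (ε₁ ε₂ : ℤˣ) (m : ℕ) (n : ℤ) : ∃ α β γ : ℂ,
    r.Admissible ε₁ ε₂ α β γ ∧
      α + β - γ = n * (r.k * r.N / 2) + r.k * (2 * m - (r.N - 1)) := by
  have him : ∀ (c : ℂ) (x : ℝ), (c + x).im = c.im := fun c x => by simp
  have hI : ∀ ε : ℤˣ, Complex.I + (ε : ℤ) * r.k ∈ r.simpleColours := fun ε =>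
    mem_simpleColours_of_im_ne_zero (by
      rw [show ((ε : ℤ) : ℂ) * r.k = (((ε : ℤ) * (2 * r.k') : ℝ) : ℂ) by rw [k]; push_cast; ring,
        him]
      simp)
  have hI0 : Complex.I ∈ r.simpleColours := mem_simpleColours_of_im_ne_zero (by simp)
  refine ⟨Complex.I, Complex.I, Complex.I + Complex.I
    - (n * (r.k * r.N / 2) + r.k * (2 * m - (r.N - 1))),
    ⟨hI0, hI0, mem_simpleColours_of_im_ne_zero ?_, hI ε₁, hI ε₂,
      n * r.N + 2 * (2 * m - (r.N - 1)), ?_⟩, by ring⟩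
  · rw [sub_eq_add_neg, show -((n : ℂ) * (r.k * r.N / 2) + r.k * (2 * m - (r.N - 1)))
      = ((-(n * (2 * r.k' * r.N / 2) + 2 * r.k' * (2 * m - (r.N - 1))) : ℝ) : ℂ) by
        rw [k]; push_cast; ring, him]
    simp
  · push_cast
    ring

end RootData

end UnrolledSl2

end

/-! ### The rational fraction R and the non-vanishing criterion -/

open UnrolledSl2 UnrolledSl2.RootData

theorem mainTheorem8 (r : UnrolledSl2.RootData) (ε₁ ε₂ : ℤˣ) :
    ∃ R : FractionRing (MvPolynomial (Fin 3) r.QA), R ≠ 0 ∧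
      (∀ α β γ : ℂ, r.Admissible ε₁ ε₂ α β γ →
        UnrolledSl2.IsHom (r.V (r.shift α β γ))
            (UnrolledSl2.Rep.tensor r.q_ne_zero (r.V α) (r.V β)) (r.vertex α β γ) ∧
        UnrolledSl2.IsHom (r.V (α + (ε₁ : ℤ) * r.k))
            (UnrolledSl2.Rep.tensor r.q_ne_zero (r.V α) r.S₁) (r.emit ε₁ α) ∧
        UnrolledSl2.IsHom (UnrolledSl2.Rep.tensor r.q_ne_zero r.S₁ (r.V (β + (ε₂ : ℤ) * r.k)))
            (r.V β) (r.absorb ε₂ β) ∧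
        (∃! s : ℂ, r.triangle ε₁ ε₂ α β γ = s • r.vertex α β γ) ∧
        r.HasValueAt R (r.point α β γ) (r.sixJ ε₁ ε₂ α β γ)) ∧
      (∀ (m : ℕ) (n : ℤ), m < r.N →
        ((∃ α β γ : ℂ, r.Admissible ε₁ ε₂ α β γ ∧
            α + β - γ = n * (r.k * r.N / 2) + r.k * (2 * m - (r.N - 1)) ∧
            r.sixJ ε₁ ε₂ α β γ ≠ 0) ↔
          0 ≤ 2 * (m : ℤ) + ε₁ + ε₂ ∧ 2 * (m : ℤ) + ε₁ + ε₂ ≤ 2 * (r.N - 1))) := by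
  have h3 := r.three_le
  have hgl : ∀ {α β γ : ℂ}, r.Admissible ε₁ ε₂ α β γ → ∀ t : ℤ, r.br (r.hw α + t) ≠ 0 :=
    fun h => br_hw_ne_zero (r.not_half_int h.left ε₁ h.left')
  have hgr : ∀ {α β γ : ℂ}, r.Admissible ε₁ ε₂ α β γ → ∀ t : ℤ, r.br (r.hw β + t) ≠ 0 :=
    fun h => br_hw_ne_zero (r.not_half_int h.right ε₂ h.right')
  obtain ⟨P, Q, hPQ⟩ := isReg_interpolation (r := r) ε₁ ε₂
  refine ⟨algebraMap _ _ P / algebraMap _ _ Q, ?_, fun α β γ h => ?_, fun m n hm => ?_⟩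
  -- Level 1 meets the criterion for every choice of signs, since 1 + (ε₁ + ε₂)/2 lies between 0 and
  -- 2 ≤ N − 1; the non-zero value there shows R ≠ 0.
  · obtain ⟨α, β, γ, h, hl⟩ := exists_admissible (r := r) ε₁ ε₂ 1 0
    obtain ⟨hQ, hv⟩ := hPQ α β γ (hgr h)
    have hm : 1 < r.N := by omega
    have h0 := (levelValue_ne_zero_iff (ε₁ := ε₁) (ε₂ := ε₂) (hgl h) (hgr h) h.bottom hm hl).2 (by
      rcases Int.units_eq_one_or ε₁ with rfl | rfl <;>
        rcases Int.units_eq_one_or ε₂ with rfl | rfl <;>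
        push_cast <;> exact ⟨by norm_num, by omega⟩)
    rw [← interpolation_eq ε₁ ε₂ hm hl, hv] at h0
    have hinj := IsFractionRing.injective (MvPolynomial (Fin 3) r.QA)
      (FractionRing (MvPolynomial (Fin 3) r.QA))
    refine div_ne_zero ?_ ?_
    · rw [Ne, map_eq_zero_iff _ hinj]
      rintro rfl
      exact h0 (by rw [map_zero, zero_div])
    · rw [Ne, map_eq_zero_iff _ hinj]
      rintro rfl
      exact hQ (map_zero _)
  · obtain ⟨m, n, hm, hl⟩ := exists_level h.vertex
    have hs := triangle_eq_smul_iff (ε₁ := ε₁) (ε₂ := ε₂) (hgl h) (hgr h) h.bottom hm hl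
    obtain ⟨hQ, hv⟩ := hPQ α β γ (hgr h)
    refine ⟨isHom_vertex (hgl h) (hgr h) h.bottom hm hl, isHom_emit (hgl h) ε₁,
      isHom_absorb (hgr h) ε₂, ⟨_, (hs _).2 rfl, fun s h' => (hs s).1 h'⟩, P, Q, rfl, hQ, ?_⟩
    rw [sixJ_eq (hgl h) (hgr h) h.bottom hm hl, ← interpolation_eq ε₁ ε₂ hm hl, hv]
  · constructor
    · rintro ⟨α, β, γ, h, hl, h0⟩
      rw [sixJ_eq (hgl h) (hgr h) h.bottom hm hl] at h0
      exact (levelValue_ne_zero_iff (hgl h) (hgr h) h.bottom hm hl).1 h0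
    · intro hr
      obtain ⟨α, β, γ, h, hl⟩ := exists_admissible (r := r) ε₁ ε₂ m n
      refine ⟨α, β, γ, h, hl, ?_⟩
      rw [sixJ_eq (hgl h) (hgr h) h.bottom hm hl]
      exact (levelValue_ne_zero_iff (hgl h) (hgr h) h.bottom hm hl).2 hr
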